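/- **Setting.** Let $\Omega\subseteq\mathbb R^d$, let $K:\Omega\times\Omega\to\mathbb R$ be a symmetric, (strictly) positive definite kernel with $K(x,x)\le 1$, and let $\mathcal H$ be its reproducing kernel Hilbert space. Let $f\in\mathcal H$ with $\|f\|_{\mathcal H}\le B$, let $\mathcal A\subseteq\Omega$ be finite and non-empty, let $T\ge 1$, $R\ge 0$, and let $\alpha>0$, $q\ge \tfrac12$, $\lambda\ge 1$, $\delta\in(0,1)$. In round $t=1,\dots,T$ a learner plays $x_t\in\mathcal A$ and observes $y_t=f(x_t)+\varepsilon_t$; for a filtration $(\mathcal F_t)$, $x_t$ is $\mathcal F_t$-measurable, $y_t$ is $\mathcal F_{t+1}$-measurable, and $\mathbb E[\exp(s\varepsilon_t)\mid\mathcal F_t]\le\exp(s^2R^2/2)$ for all $s\in\mathbb R$. The regret is $R(T)=\sup_{x\in\mathcal A}\sum_{t=1}^T(f(x)-f(x_t))$. **Algorithm (APG-TS).** Put $\mathfrak e=\alpha/T^q$ and $\epsilon=B\mathfrak e$. The $P$-greedy algorithm on $\mathcal A$ selects $\xi_{m+1}\in\arg\max_{x\in\mathcal A}P_m^2(x)$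 for $m=0,1,\dots$, where $P_m^2(x)=K(x,x)-\sum_{k\le m}N_k(x)^2$ and $N_{m+1}(x)=\bigl(K(x,\xi_{m+1})-\sum_{k\le m}N_k(\xi_{m+1})N_k(x)\bigr)/\sqrt{P_m^2(\xi_{m+1})}$, and stops at the first $m\ge 1$ with $\max_{\mathcal A}P_m^2<\mathfrak e^2$; let $D=D_{q,\alpha}(T)$ be the number of points it returns and $\widetilde x=(N_1(x),\dots,N_D(x))$. With $$A_t=\lambda 1_D+\sum_{s\le t}\widetilde x_s\widetilde x_s^{\mathrm T},\quad \hat\theta_t=A_t^{-1}\sum_{s\le t}y_s\widetilde x_s,\quad \psi_t=\sum_{s\le t}\|\widetilde x_s\|_{A_{s-1}^{-1}},\quad \beta_t=R\sqrt{\log\frac{\det(\lambda^{-1}A_t)}{(\delta/2)^2}}+\sqrt\lambda\,B,$$ where $\|v\|_{M^{-1}}=\sqrt{v^{\mathrm T}M^{-1}v}$, in round $t+1$ the learner draws, given the past arms and rewards, $\mu_t\sim\mathcal N\bigl(\hat\theta_t,(\beta_t+\epsilon\psi_t)^2A_t^{-1}\bigr)$ and plays $x_{t+1}\in\arg\max_{x\in\mathcal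 A}\langle\mu_t,\widetilde x\rangle$. Ties are broken arbitrarily. **Theorem.** (1) There is a universal exponent $c$ and, for all $B,R,\lambda,\alpha$ as above, a constant $C$ depending only on $B,R,\lambda,\alpha$, such that in every such setting, for every execution of APG-TS, with probability at least $1-\delta$, $$R(T)\le C\,(1+\log T)^{c}\,\sqrt{\log|\mathcal A|}\,\Bigl(D\sqrt T+\sqrt{DT\log(1/\delta)}+\log(1/\delta)\sqrt T\Bigr).$$ (2) The total computational complexity of APG-TS is $O(|\mathcal A|TD^2+TD^3)$: there are a universal constant $C'$ and one fixed program of a random-access machine over the real numbers (unit cost for integer addition and subtraction, the real operations $+,-,\times,/,\sqrt{\cdot},\log$, copies and constants, comparisons, loop iterations, evaluations of $K$ at two arms, standard normal draws, and pulls of an arm) with input $|\mathcal A|,T,\lambda,R,B,\delta,\mathfrak e$ which, in every such setting and for every sequence of observed rewards and of normal draws, carries out APG-TS for $T$ rounds in at most $C'(|\mathcal A|TD^2+TD^3)$ steps. The $D$ and $N_1,\dots,N_D$ it uses come from a valid run of the $P$-greedy algorithm that does not depend on rewards or draws, and the $D$ fresh standard normal draws $\zeta_t$ of round $t+1$ are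 turned into $\mu_t=\hat\theta_t+(\beta_t+\epsilon\psi_t)L_t^{-\mathrm T}\zeta_t$, where $A_t=L_tL_t^{\mathrm T}$ is the Cholesky decomposition. -/

import Mathlib

open MeasureTheory ProbabilityTheory

noncomputable section

namespace APG

/-! ### Kernels, the P-greedy algorithm and the Newton basis -/

/-- A symmetric, (strictly) positive definite kernel on `X`, normalized so that `K x x ≤ 1`. -/
structure IsKernel {X : Type*} (K : X → X → ℝ) : Prop where
  symm : ∀ x y, K x y = K y x
  posDef : ∀ (n : ℕ) (p : Fin n → X), Function.Injective p →
    (Matrix.of fun i j => K (p i) (p j)).PosDef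
  diag_le_one : ∀ x, K x x ≤ 1

/-- The Newton functions `N_0, N_1, …` attached to the points `ξ_0, ξ_1, …`:
`N_m(x) = (K(x, ξ_m) - ∑_{k<m} N_k(ξ_m) N_k(x)) / √(K(ξ_m, ξ_m) - ∑_{k<m} N_k(ξ_m)²)`. -/
def newton {X : Type*} (K : X → X → ℝ) (ξ : ℕ → X) (m : ℕ) (x : X) : ℝ :=
  (K x (ξ m) - ∑ k : Fin m, newton K ξ k (ξ m) * newton K ξ k x) /
    √(K (ξ m) (ξ m) - ∑ k : Fin m, newton K ξ k (ξ m) ^ 2)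
  termination_by m
  decreasing_by all_goals exact k.isLt

/-- The squared power function of the first `m` points, `K(x,x) - ∑_{k<m} N_k(x)²`. -/
def powerSq {X : Type*} (K : X → X → ℝ) (ξ : ℕ → X) (m : ℕ) (x : X) : ℝ :=
  K x x - ∑ k ∈ Finset.range m, newton K ξ k x ^ 2

/-- `ξ_0, …, ξ_{D-1}` is an output (with `D` points) of the P-greedy algorithm run on the finite
set `A` with admissible error `e`: each point maximizes the current power function over `A`
(ties are broken arbitrarily), and the algorithm stops as soon as, after at least one point
has been selected, the maximum over `A` of the squared power function is below `e²`. -/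
structure IsPGreedy {X : Type*} (K : X → X → ℝ) (A : Finset X) (e : ℝ) (D : ℕ) (ξ : ℕ → X) :
    Prop where
  pos : 0 < D
  mem : ∀ m < D, ξ m ∈ A
  greedy : ∀ m < D, ∀ x ∈ A, powerSq K ξ m x ≤ powerSq K ξ m (ξ m)
  finished : ∀ x ∈ A, powerSq K ξ D x < e ^ 2
  not_before : ∀ m, 0 < m → m < D → ∃ x ∈ A, e ^ 2 ≤ powerSq K ξ m x

/-- The feature vector `(N_0(x), …, N_{D-1}(x))` of `x`. -/
def feature {X : Type*} (K : X → X → ℝ) (ξ : ℕ → X) (D : ℕ) (x : X) : Fin D → ℝ :=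
  fun i => newton K ξ i x

/-! ### The statistics of the linear bandit.

Rounds are numbered `0, 1, 2, …`; `φ s` is the feature vector of the arm played in round `s` and
`y s` the reward observed in round `s`, so the sums below run over the rounds before `t`. -/

/-- `A_t = λ 1 + ∑_{s<t} φ_s φ_sᵀ`. -/
def gram {D : ℕ} (lam : ℝ) (φ : ℕ → Fin D → ℝ) (t : ℕ) : Matrix (Fin D) (Fin D) ℝ :=
  lam • (1 : Matrix (Fin D) (Fin D) ℝ) + ∑ s ∈ Finset.range t, Matrix.vecMulVec (φ s) (φ s)

/-- `θ̂_t = A_t⁻¹ ∑_{s<t} y_s φ_s`. -/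
def thetaHat {D : ℕ} (lam : ℝ) (φ : ℕ → Fin D → ℝ) (y : ℕ → ℝ) (t : ℕ) : Fin D → ℝ :=
  Matrix.mulVec (gram lam φ t)⁻¹ (∑ s ∈ Finset.range t, y s • φ s)

/-- The Mahalanobis norm `‖v‖_{M⁻¹} = √(vᵀ M⁻¹ v)`. -/
def mahalanobis {D : ℕ} (M : Matrix (Fin D) (Fin D) ℝ) (v : Fin D → ℝ) : ℝ :=
  √(dotProduct v (Matrix.mulVec M⁻¹ v))

/-- `β(M, δ, λ) = R √(log (det (λ⁻¹ M) / δ²)) + √λ B`. -/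
def beta {D : ℕ} (R B : ℝ) (M : Matrix (Fin D) (Fin D) ℝ) (δ lam : ℝ) : ℝ :=
  R * √(Real.log ((lam⁻¹ • M).det / δ ^ 2)) + √lam * B

/-- `ψ_t = ∑_{s<t} ‖φ_s‖_{A_s⁻¹}`, where `A_s` is built from the rounds before `s`. -/
def psi {D : ℕ} (lam : ℝ) (φ : ℕ → Fin D → ℝ) (t : ℕ) : ℝ :=
  ∑ s ∈ Finset.range t, mahalanobis (gram lam φ s) (φ s)

/-- The scale `β(A_t, δ/2, λ) + ε ψ_t` of the sampling distribution of modified Thompson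
Sampling. -/
def width {D : ℕ} (R B lam δ ε : ℝ) (φ : ℕ → Fin D → ℝ) (t : ℕ) : ℝ :=
  beta R B (gram lam φ t) (δ / 2) lam + ε * psi lam φ t

/-- `x` is an arm that maximizes `⟨μ, φ(x)⟩` over the arm set `A`. -/
def IsBest {X : Type*} {D : ℕ} (A : Finset X) (φ : X → Fin D → ℝ) (μ : Fin D → ℝ) (x : X) :
    Prop :=
  x ∈ A ∧ ∀ x' ∈ A, dotProduct μ (φ x') ≤ dotProduct μ (φ x)

/-! ### The stochastic bandit problem and modified Thompson Sampling -/

section Stochastic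

variable {Ψ X : Type*} [mΨ : MeasurableSpace Ψ] [MeasurableSpace X]

/-- In round `t < T` the arm `x t` is played and the reward `y t = g (x t) + noise` is observed;
the noise is conditionally `R`-sub-Gaussian with respect to the filtration `ℱ`, `x t` is
`ℱ t`-measurable and `y t` is `ℱ (t+1)`-measurable. -/
structure IsBandit (P : Measure Ψ) (ℱ : Filtration ℕ mΨ) (g : X → ℝ) (R : ℝ) (T : ℕ)
    (x : ℕ → Ψ → X) (y : ℕ → Ψ → ℝ) : Prop where
  measurable_arm : ∀ t < T, Measurable[ℱ t] (x t)
  measurable_reward : ∀ t < T, Measurable[ℱ (t + 1)] (y t)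
  integrable_noise : ∀ t < T, ∀ s : ℝ,
    Integrable (fun ω => Real.exp (s * (y t ω - g (x t ω)))) P
  subGaussian_noise : ∀ t < T, ∀ s : ℝ,
    P[fun ω => Real.exp (s * (y t ω - g (x t ω))) | ℱ t]
      ≤ᵐ[P] fun _ => Real.exp (s ^ 2 * R ^ 2 / 2)

/-- The σ-algebra generated by the arms and rewards of the rounds before `t`. -/
abbrev history (x : ℕ → Ψ → X) (y : ℕ → Ψ → ℝ) (t : ℕ) : MeasurableSpace Ψ :=
  MeasurableSpace.comap (fun ω (s : Fin t) => (x s ω, y s ω)) inferInstance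

/-- The arms `x` are selected by modified Thompson Sampling with features `φ`: in round `t`, given
the history, `μ t` is drawn from `N(θ̂_t, (β(A_t, δ/2, λ) + ε ψ_t)² A_t⁻¹)`, and `x t` maximizes
`⟨μ t, φ(x)⟩` over `x ∈ A` (ties are broken arbitrarily). -/
structure IsModifiedTS {D : ℕ} (P : Measure Ψ) (A : Finset X) (φ : X → Fin D → ℝ)
    (lam R B ε δ : ℝ) (T : ℕ) (x : ℕ → Ψ → X) (y : ℕ → Ψ → ℝ)
    (μ : ℕ → Ψ → EuclideanSpace ℝ (Fin D)) : Prop where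
  measurable_sample : ∀ t < T, Measurable (μ t)
  law_sample : ∀ t < T, ∀ S : Set (EuclideanSpace ℝ (Fin D)), MeasurableSet S →
    P⟦μ t ⁻¹' S | history x y t⟧ =ᵐ[P] fun ω =>
      (multivariateGaussian
        (WithLp.toLp 2 (thetaHat lam (fun s => φ (x s ω)) (fun s => y s ω) t))
        (width R B lam δ ε (fun s => φ (x s ω)) t ^ 2 •
          (gram lam (fun s => φ (x s ω)) t)⁻¹)).real S
  best : ∀ t < T, ∀ ω, IsBest A φ (WithLp.ofLp (μ t ω)) (x t ω)

end Stochastic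

/-- The regret `R(T) = sup_{x ∈ A} ∑_{t<T} (g(x) - g(x_t))`. -/
def regret {X : Type*} (A : Finset X) (hA : A.Nonempty) (g : X → ℝ) (T : ℕ) (x : ℕ → X) : ℝ :=
  A.sup' hA fun a => ∑ t ∈ Finset.range T, (g a - g (x t))

/-! ### A real random-access machine with step count

A program works on integer variables and on two-dimensional arrays of real numbers, indexed by
integer variables. Arithmetic operations, square roots and logarithms, comparisons, evaluations
of the kernel at two arms, draws from the standard normal distribution, pulls of an arm, and
iterations of a loop cost one step each. -/

/-- The entry of the real array `arr` at the row and the column that are the current values of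
the integer variables `row` and `col`. -/
structure Ref where
  arr : ℕ
  row : ℕ
  col : ℕ

inductive UnOp
  | copy
  | sqrt
  | log

inductive BinOp
  | add
  | sub
  | mul
  | div

/-- Programs. Variables `u v w` are names of integer variables. -/
inductive Cmd
  | skip
  | seq (c₁ c₂ : Cmd)
  | intConst (v k : ℕ)
  | intAdd (v u w : ℕ)
  | intSub (v u w : ℕ)
  | realConst (dst : Ref) (k : ℕ)
  | unary (o : UnOp) (dst r : Ref)
  | binary (o : BinOp) (dst r₁ r₂ : Ref)
  /-- `dst := K(a_u, a_w)`, where `a_0, a_1, …` are the arms -/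
  | kernel (dst : Ref) (u w : ℕ)
  /-- `dst :=` the next standard normal draw -/
  | normal (dst : Ref)
  /-- play the arm with number `u` in the current round, `dst :=` the observed reward -/
  | pull (dst : Ref) (u : ℕ)
  | ifIntLt (u w : ℕ) (c₁ c₂ : Cmd)
  | ifRealLe (r₁ r₂ : Ref) (c₁ c₂ : Cmd)
  /-- execute `c` for `v = 0, …, w - 1` (with the value that `w` has at the start) -/
  | loop (v w : ℕ) (c : Cmd)

def UnOp.eval : UnOp → ℝ → ℝ
  | .copy, a => a
  | .sqrt, a => √a
  | .log, a => Real.log a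

def BinOp.eval : BinOp → ℝ → ℝ → ℝ
  | .add, a, b => a + b
  | .sub, a, b => a - b
  | .mul, a, b => a * b
  | .div, a, b => a / b

/-- The part of the world that a program can only access through its instructions: the values
`kernel i j` of the kernel at the arms with numbers `i` and `j`, the reward `reward t i` that
is observed if arm `i` is played in round `t`, and the stream of standard normal draws. -/
structure World where
  kernel : ℕ → ℕ → ℝ
  reward : ℕ → ℕ → ℝ
  normal : ℕ → ℝ

structure State where
  /-- integer variables -/
  ints : ℕ → ℕ
  /-- real arrays: name, row, column -/
  reals : ℕ → ℕ → ℕ → ℝ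
  /-- number of normal draws so far -/
  draws : ℕ
  /-- number of rounds played so far -/
  rounds : ℕ
  /-- `played t` is the number of the arm played in round `t < rounds` -/
  played : ℕ → ℕ
  /-- number of steps so far -/
  steps : ℕ

namespace State

def tick (σ : State) : State := { σ with steps := σ.steps + 1 }

def get (σ : State) (r : Ref) : ℝ := σ.reals r.arr (σ.ints r.row) (σ.ints r.col)

def set (σ : State) (r : Ref) (a : ℝ) : State :=
  { σ with
    reals := fun n i j =>
      if n = r.arr ∧ i = σ.ints r.row ∧ j = σ.ints r.col then a else σ.reals n i j }

def setInt (σ : State) (v k : ℕ) : State := { σ with ints := Function.update σ.ints v k }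

/-- `iter f n σ = f (n-1) (… (f 1 (f 0 σ)))`. -/
def iter (f : ℕ → State → State) : ℕ → State → State
  | 0, σ => σ
  | n + 1, σ => f n (iter f n σ)

end State

open scoped Classical in
/-- The effect of a program, with its step count. -/
def Cmd.exec (W : World) : Cmd → State → State
  | .skip, σ => σ
  | .seq c₁ c₂, σ => c₂.exec W (c₁.exec W σ)
  | .intConst v k, σ => (σ.setInt v k).tick
  | .intAdd v u w, σ => (σ.setInt v (σ.ints u + σ.ints w)).tick
  | .intSub v u w, σ => (σ.setInt v (σ.ints u - σ.ints w)).tick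
  | .realConst dst k, σ => (σ.set dst k).tick
  | .unary o dst r, σ => (σ.set dst (o.eval (σ.get r))).tick
  | .binary o dst r₁ r₂, σ => (σ.set dst (o.eval (σ.get r₁) (σ.get r₂))).tick
  | .kernel dst u w, σ => (σ.set dst (W.kernel (σ.ints u) (σ.ints w))).tick
  | .normal dst, σ => { (σ.set dst (W.normal σ.draws)).tick with draws := σ.draws + 1 }
  | .pull dst u, σ =>
      { (σ.set dst (W.reward σ.rounds (σ.ints u))).tick with
        rounds := σ.rounds + 1
        played := Function.update σ.played σ.rounds (σ.ints u) }
  | .ifIntLt u w c₁ c₂, σ =>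
      if σ.ints u < σ.ints w then c₁.exec W σ.tick else c₂.exec W σ.tick
  | .ifRealLe r₁ r₂ c₁ c₂, σ =>
      if σ.get r₁ ≤ σ.get r₂ then c₁.exec W σ.tick else c₂.exec W σ.tick
  | .loop v w c, σ =>
      State.iter (fun i τ => c.exec W (τ.setInt v i).tick) (σ.ints w) σ.tick

/-- The state in which a program starts: the integer variables `0` and `1` hold the number `n` of
arms and the time horizon `T`, the entries `0, …, 4` of row `0` of the real array `0` hold
`λ, R, B, δ` and the admissible error `e`; everything else is zero. -/
def startState (n T : ℕ) (lam R B δ e : ℝ) : State where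
  ints v := if v = 0 then n else if v = 1 then T else 0
  reals k i j :=
    if k = 0 ∧ i = 0 then
      if j = 0 then lam else if j = 1 then R else if j = 2 then B else if j = 3 then δ
      else if j = 4 then e else 0
    else 0
  draws := 0
  rounds := 0
  played _ := 0
  steps := 0

/-- `μ` is the sample from `N(θ, v² M⁻¹)` obtained from the vector `ζ` of independent standard
normal draws through the Cholesky decomposition `M = L Lᵀ` (which is unique): `μ = θ + v L⁻ᵀ ζ`,
and `L⁻ᵀ (L⁻ᵀ)ᵀ = M⁻¹`. -/
def IsCholeskySample {D : ℕ} (M : Matrix (Fin D) (Fin D) ℝ) (θ : Fin D → ℝ) (v : ℝ)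
    (ζ μ : Fin D → ℝ) : Prop :=
  ∃ L : Matrix (Fin D) (Fin D) ℝ, (∀ i j, i < j → L i j = 0) ∧ (∀ i, 0 < L i i) ∧
    L * L.transpose = M ∧ μ = θ + v • Matrix.mulVec (L⁻¹).transpose ζ

end APG

end

/-!
**Regret.** In the reproducing kernel Hilbert space the Newton functions `N_k` are represented by the
Gram-Schmidt vectors of the kernel functions at the selected points, and the power function is the
distance to their span (`powerSq_eq_norm_sq`). So the coefficients `θ` of the orthogonal projection
of `f` satisfy `|f - ⟨θ, φ⟩| ≤ B e` on the arms, where `φ` are the features, of length at most one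
(`exists_approx`). The learner therefore faces a linear bandit with misspecification `ε = B e`.

For such a bandit, the ridge estimate is accurate in all rounds at once with probability `1 - δ / 2`:
the noise is controlled by the self-normalized inequality `measure_selfNormalized`, which is Ville's
inequality for a Gaussian mixture of exponential supermartingales, and the misspecification adds at
most `ε ψ_t` (`abs_thetaHat_sub_le`). Given an accurate estimate, a sample from the posterior is
optimistic with at least the constant probability `upperProb`, so that the expected width of the
played arm dominates, up to a constant, the width of some arm that is not yet known to be bad; this
controls the expected gap (`condExp_gap_le`). Summing over the rounds with the Azuma-Hoeffding
inequality (`measure_sum_gt_le`) and the elliptical potential bound (`sum_mahalanobis_sq_le`) gives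
an explicit regret bound (`measure_regret_gt_le`). As `q ≥ 1/2`, the misspecification costs no more
than the noise, and `bound_le_regretConst` brings the bound into the claimed form, with exponent
`c = 3`.

**Complexity.** The recursion for the next Newton function, given the earlier ones, is at the same
time one column of a Cholesky decomposition, and one step of the forward substitution for all other
rows of a table. The program keeps a single table that holds the features of the arms, the
matrix `A_t` and the vector `∑ y_s φ_s`; the same loop (`colStep_reals`) runs the P-greedy algorithm
on kernel values and, on the table, computes `L` and applies `L⁻¹` to all other rows in
`O(|A| D² + D³)` steps (`choleskyFactor_mulVec`). Determinant, norms and the objective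
`⟨μ_t, φ⟩ = ⟨Lᵀ μ_t, L⁻¹ φ⟩` are then cheap (`sample_dotProduct_eq`). Correctness is shown by loop
invariants (`pGreedy_spec`, `RoundInv.step`), and the number of steps is read off from the text of the
program and bounds for its integer variables (`exec_steps_le`). The P-greedy part contains no draw
and no pull, so its result depends on the kernel only (`exec_congr_of_isOffline`).
-/


noncomputable section

namespace APG

/-! ### The Newton basis as a Gram-Schmidt process -/

section Newton

variable {X : Type*} {K : X → X → ℝ} {ξ : ℕ → X}

lemma newton_eq (K : X → X → ℝ) (ξ : ℕ → X) (m : ℕ) (x : X) :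
    newton K ξ m x =
      (K x (ξ m) - ∑ k ∈ Finset.range m, newton K ξ k (ξ m) * newton K ξ k x) /
        √(powerSq K ξ m (ξ m)) := by
  rw [newton, powerSq, Finset.sum_range, Finset.sum_range]

lemma newton_congr {ξ ξ' : ℕ → X} {m : ℕ} (h : ∀ k ≤ m, ξ k = ξ' k) (x : X) :
    newton K ξ m x = newton K ξ' m x := by
  induction m using Nat.strong_induction_on generalizing x with
  | _ m ih =>
    have h1 : ∀ k ∈ Finset.range m, ∀ z, newton K ξ k z = newton K ξ' k z := fun k hk z =>
      ih k (Finset.mem_range.1 hk) (fun j hj => h j (hj.trans (Finset.mem_range.1 hk).le)) z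
    rw [newton_eq, newton_eq, powerSq, powerSq, h m le_rfl]
    congr 2
    · exact Finset.sum_congr rfl fun k hk => by rw [h1 k hk, h1 k hk]
    · congr 1
      exact Finset.sum_congr rfl fun k hk => by rw [h1 k hk]

lemma powerSq_congr {ξ ξ' : ℕ → X} {m : ℕ} (h : ∀ k < m, ξ k = ξ' k) (x : X) :
    powerSq K ξ m x = powerSq K ξ' m x := by
  rw [powerSq, powerSq]
  congr 1
  refine Finset.sum_congr rfl fun k hk => ?_
  rw [newton_congr fun j hj => h j (hj.trans_lt (Finset.mem_range.1 hk))]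

/-- Newton functions only depend on the kernel matrix: they may be computed on the numbers `i` of the
points `a i`. -/
lemma newton_comp {Y : Type*} (a : Y → X) (η : ℕ → Y) (m : ℕ) (i : Y) :
    newton K (fun k => a (η k)) m (a i) = newton (fun i j => K (a i) (a j)) η m i := by
  induction m using Nat.strong_induction_on generalizing i with
  | _ m ih =>
    rw [newton_eq, newton_eq, powerSq, powerSq]
    congr 2
    · exact Finset.sum_congr rfl fun k hk => by
        rw [ih k (Finset.mem_range.1 hk), ih k (Finset.mem_range.1 hk)]
    · congr 1
      exact Finset.sum_congr rfl fun k hk => by rw [ih k (Finset.mem_range.1 hk)]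

lemma powerSq_comp {Y : Type*} (a : Y → X) (η : ℕ → Y) (m : ℕ) (i : Y) :
    powerSq K (fun k => a (η k)) m (a i) = powerSq (fun i j => K (a i) (a j)) η m i := by
  simp only [powerSq, newton_comp]

lemma powerSq_succ (m : ℕ) (x : X) :
    powerSq K ξ (m + 1) x = powerSq K ξ m x - newton K ξ m x ^ 2 := by
  simp only [powerSq, Finset.sum_range_succ]; ring

lemma newton_self {m : ℕ} : newton K ξ m (ξ m) = √(powerSq K ξ m (ξ m)) := by
  rw [newton_eq]
  simp only [← pow_two]
  exact Real.div_sqrt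

/-- Each column of the kernel at a selected point is recovered from the Newton functions; for
the points themselves this is the Cholesky decomposition of the kernel matrix. -/
lemma kernel_eq_sum_newton {m : ℕ} (h : 0 < powerSq K ξ m (ξ m)) (x : X) :
    K x (ξ m) = ∑ k ∈ Finset.range (m + 1), newton K ξ k (ξ m) * newton K ξ k x := by
  rw [Finset.sum_range_succ, newton_self, newton_eq K ξ m x,
    mul_div_cancel₀ _ (Real.sqrt_pos.2 h).ne']
  ring

/-- The matrix of the Newton functions at the selected points is triangular. Symmetry of the kernel is
only assumed at these points, since the lemma is also applied to tables that are not symmetric. -/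
lemma newton_eq_zero {M : ℕ} (hs : ∀ j < M, ∀ k < M, K (ξ j) (ξ k) = K (ξ k) (ξ j))
    (h : ∀ m < M, 0 < powerSq K ξ m (ξ m)) {k m : ℕ} (hkm : k < m) (hm : m < M) :
    newton K ξ m (ξ k) = 0 := by
  induction m using Nat.strong_induction_on with
  | _ m ih =>
    rw [newton_eq]
    have h1 : ∑ j ∈ Finset.range m, newton K ξ j (ξ m) * newton K ξ j (ξ k)
        = ∑ j ∈ Finset.range (k + 1), newton K ξ j (ξ m) * newton K ξ j (ξ k) := by
      symm
      apply Finset.sum_subset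
      · intro j; simp only [Finset.mem_range]; omega
      · intro j hj hj'
        simp only [Finset.mem_range] at hj hj'
        rw [ih j hj (by omega) (by omega), mul_zero]
    rw [h1, hs k (by omega) m hm, kernel_eq_sum_newton (h k (by omega)) (ξ m)]
    simp only [mul_comm, sub_self, zero_div]

/-- The power function vanishes at the points selected so far. -/
lemma powerSq_self_eq_zero {M : ℕ} (hs : ∀ j < M, ∀ k < M, K (ξ j) (ξ k) = K (ξ k) (ξ j))
    (h : ∀ m < M, 0 < powerSq K ξ m (ξ m)) {k m : ℕ} (hkm : k < m) (hm : m ≤ M) :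
    powerSq K ξ m (ξ k) = 0 := by
  have h2 : ∑ j ∈ Finset.range m, newton K ξ j (ξ k) ^ 2
      = ∑ j ∈ Finset.range (k + 1), newton K ξ j (ξ k) * newton K ξ j (ξ k) := by
    simp only [← pow_two]
    symm
    apply Finset.sum_subset
    · intro j; simp only [Finset.mem_range]; omega
    · intro j hj hj'
      simp only [Finset.mem_range] at hj hj'
      rw [newton_eq_zero hs h (by omega : k < j) (by omega)]; simp
  rw [powerSq, h2, ← kernel_eq_sum_newton (h k (by omega)), sub_self]

/-- As the power function vanishes at selected points, no point is selected twice. -/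
lemma injOn_of_powerSq_pos {M : ℕ} (hs : ∀ j < M, ∀ k < M, K (ξ j) (ξ k) = K (ξ k) (ξ j))
    (h : ∀ m < M, 0 < powerSq K ξ m (ξ m)) : Set.InjOn ξ (Set.Iio M) := by
  have key : ∀ j k, j < k → k < M → ξ j ≠ ξ k := fun j k hjk hk he => by
    have := powerSq_self_eq_zero hs h hjk hk.le
    rw [he] at this
    exact (h k hk).ne' this
  intro j hj k hk he
  rcases lt_trichotomy j k with h1 | h1 | h1
  · exact absurd he (key j k h1 hk)
  · exact h1
  · exact absurd he.symm (key k j h1 hj)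

variable {E : Type*} [NormedAddCommGroup E] [InnerProductSpace ℝ E]

open scoped RealInnerProductSpace

/-- The Newton functions as vectors of an inner product space in which the kernel is realized as
`K x y = ⟪u x, u y⟫`: the Gram-Schmidt vectors of `u (ξ 0), u (ξ 1), …`. -/
def newtonVec (u : X → E) (K : X → X → ℝ) (ξ : ℕ → X) (m : ℕ) : E :=
  (√(powerSq K ξ m (ξ m)))⁻¹ • (u (ξ m) - ∑ k : Fin m, newton K ξ k (ξ m) • newtonVec u K ξ k)
  termination_by m
  decreasing_by all_goals exact k.isLt

lemma newtonVec_eq (u : X → E) (K : X → X → ℝ) (ξ : ℕ → X) (m : ℕ) :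
    newtonVec u K ξ m = (√(powerSq K ξ m (ξ m)))⁻¹ •
      (u (ξ m) - ∑ k ∈ Finset.range m, newton K ξ k (ξ m) • newtonVec u K ξ k) := by
  rw [newtonVec, Finset.sum_range]

variable {u : X → E} {S : Set X} {M : ℕ}

lemma inner_newtonVec (hu : ∀ x ∈ S, ∀ y ∈ S, ⟪u x, u y⟫ = K x y) (hξ : ∀ m < M, ξ m ∈ S)
    {m : ℕ} (hm : m < M) {x : X} (hx : x ∈ S) : ⟪newtonVec u K ξ m, u x⟫ = newton K ξ m x := by
  induction m using Nat.strong_induction_on with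
  | _ m ih =>
    rw [newtonVec_eq, newton_eq, real_inner_smul_left, inner_sub_left, real_inner_comm,
      hu x hx _ (hξ m hm), sum_inner, div_eq_inv_mul]
    congr 2
    refine Finset.sum_congr rfl fun k hk => ?_
    rw [real_inner_smul_left, ih k (Finset.mem_range.1 hk) ((Finset.mem_range.1 hk).trans hm)]

/-- The Newton vectors are orthonormal. -/
lemma inner_newtonVec_newtonVec (hu : ∀ x ∈ S, ∀ y ∈ S, ⟪u x, u y⟫ = K x y)
    (hξ : ∀ m < M, ξ m ∈ S) (hp : ∀ m < M, 0 < powerSq K ξ m (ξ m)) {j m : ℕ} (hj : j < M)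
    (hm : m < M) :
    ⟪newtonVec u K ξ j, newtonVec u K ξ m⟫ = if j = m then 1 else 0 := by
  have key : ∀ m < M, ∀ j < m, ⟪newtonVec u K ξ j, newtonVec u K ξ m⟫ = 0 := by
    intro m
    induction m using Nat.strong_induction_on with
    | _ m ih =>
      intro hm j hj
      have hnorm : ⟪newtonVec u K ξ j, newtonVec u K ξ j⟫ = 1 := by
        nth_rw 2 [newtonVec_eq]
        rw [real_inner_smul_right, inner_sub_right,
          inner_newtonVec hu hξ (hj.trans hm) (hξ j (hj.trans hm)), inner_sum,
          Finset.sum_eq_zero, sub_zero, newton_self, inv_mul_cancel₀]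
        · exact (Real.sqrt_pos.2 (hp j (hj.trans hm))).ne'
        · intro k hk
          rw [real_inner_smul_right, real_inner_comm,
            ih j hj (hj.trans hm) k (Finset.mem_range.1 hk), mul_zero]
      rw [newtonVec_eq u K ξ m, real_inner_smul_right, inner_sub_right,
        inner_newtonVec hu hξ (hj.trans hm) (hξ m hm), inner_sum,
        Finset.sum_eq_single_of_mem j (Finset.mem_range.2 hj), real_inner_smul_right, hnorm]
      · simp
      · intro k hk hkj
        rw [real_inner_smul_right]
        rcases lt_or_gt_of_ne hkj with h | h
        · rw [real_inner_comm, ih j hj (hj.trans hm) k h, mul_zero]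
        · rw [ih k (Finset.mem_range.1 hk) ((Finset.mem_range.1 hk).trans hm) j h, mul_zero]
  split_ifs with h
  · subst h
    nth_rw 2 [newtonVec_eq]
    rw [real_inner_smul_right, inner_sub_right, inner_newtonVec hu hξ hj (hξ j hj), inner_sum,
      Finset.sum_eq_zero, sub_zero, newton_self, inv_mul_cancel₀]
    · exact (Real.sqrt_pos.2 (hp j hj)).ne'
    · intro k hk
      rw [real_inner_smul_right, real_inner_comm, key j hj k (Finset.mem_range.1 hk), mul_zero]
  · rcases lt_or_gt_of_ne h with h | h
    · exact key m hm j h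
    · rw [real_inner_comm]; exact key j hj m h

/-- The power function is the distance of `u x` to the span of the Newton vectors. -/
lemma powerSq_eq_norm_sq (hu : ∀ x ∈ S, ∀ y ∈ S, ⟪u x, u y⟫ = K x y) (hξ : ∀ m < M, ξ m ∈ S)
    (hp : ∀ m < M, 0 < powerSq K ξ m (ξ m)) {x : X} (hx : x ∈ S) :
    powerSq K ξ M x
      = ‖u x - ∑ k ∈ Finset.range M, newton K ξ k x • newtonVec u K ξ k‖ ^ 2 := by
  have h1 : ⟪u x, ∑ k ∈ Finset.range M, newton K ξ k x • newtonVec u K ξ k⟫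
      = ∑ k ∈ Finset.range M, newton K ξ k x ^ 2 := by
    rw [inner_sum]
    refine Finset.sum_congr rfl fun k hk => ?_
    rw [real_inner_smul_right, real_inner_comm,
      inner_newtonVec hu hξ (Finset.mem_range.1 hk) hx, pow_two]
  have h2 : ‖∑ k ∈ Finset.range M, newton K ξ k x • newtonVec u K ξ k‖ ^ 2
      = ∑ k ∈ Finset.range M, newton K ξ k x ^ 2 := by
    rw [← real_inner_self_eq_norm_sq, inner_sum]
    refine Finset.sum_congr rfl fun k hk => ?_
    rw [real_inner_smul_right, sum_inner, Finset.sum_eq_single_of_mem k hk, real_inner_smul_left,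
      inner_newtonVec_newtonVec hu hξ hp (Finset.mem_range.1 hk) (Finset.mem_range.1 hk), if_pos rfl]
    · ring
    · intro j hj hjk
      rw [real_inner_smul_left,
        inner_newtonVec_newtonVec hu hξ hp (Finset.mem_range.1 hj) (Finset.mem_range.1 hk),
        if_neg hjk, mul_zero]
  rw [norm_sub_sq_real, h1, h2, ← real_inner_self_eq_norm_sq, hu x hx x hx, powerSq]
  ring

lemma newtonVec_mem_span (u : X → E) (K : X → X → ℝ) (ξ : ℕ → X) (m : ℕ) :
    newtonVec u K ξ m ∈ Submodule.span ℝ ((fun k => u (ξ k)) '' Set.Iic m) := by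
  induction m using Nat.strong_induction_on with
  | _ m ih =>
    rw [newtonVec_eq]
    refine Submodule.smul_mem _ _ (Submodule.sub_mem _ (Submodule.subset_span ⟨m, by simp, rfl⟩)
      (Submodule.sum_mem _ fun k hk => Submodule.smul_mem _ _ ?_))
    refine Submodule.span_mono ?_ (ih k (Finset.mem_range.1 hk))
    exact Set.image_mono (Set.Iic_subset_Iic.2 (Finset.mem_range.1 hk).le)

/-- The power function does not vanish at a point that is independent of the earlier points. -/
lemma powerSq_pos (hu : ∀ x ∈ S, ∀ y ∈ S, ⟪u x, u y⟫ = K x y) (hξ : ∀ m < M, ξ m ∈ S)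
    (hli : ∀ m < M, u (ξ m) ∉ Submodule.span ℝ ((fun k => u (ξ k)) '' Set.Iio m)) :
    ∀ m < M, 0 < powerSq K ξ m (ξ m) := by
  intro m
  induction m using Nat.strong_induction_on with
  | _ m ih =>
    intro hm
    rw [powerSq_eq_norm_sq (M := m) hu (fun k hk => hξ k (hk.trans hm))
      (fun k hk => ih k hk (hk.trans hm)) (hξ m hm)]
    refine pow_pos (norm_pos_iff.2 fun h0 => hli m hm ?_) 2
    rw [sub_eq_zero.1 h0]
    refine Submodule.sum_mem _ fun k hk => Submodule.smul_mem _ _ ?_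
    refine Submodule.span_mono ?_ (newtonVec_mem_span u K ξ k)
    exact Set.image_mono fun j hj => lt_of_le_of_lt hj (Finset.mem_range.1 hk)

end Newton

/-! ### The P-greedy algorithm -/

section Greedy

variable {X : Type*} {K : X → X → ℝ} {ξ : ℕ → X} {A : Finset X} {e : ℝ} {D : ℕ}

lemma IsKernel.diag_pos (hK : IsKernel K) (x : X) : 0 < K x x := by
  have := (hK.posDef 1 (fun _ => x) (fun _ _ _ => Subsingleton.elim _ _)).diag_pos (i := 0)
  simpa using this

/-- The P-greedy algorithm never divides by zero: the first power function is the diagonal of a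
strictly positive definite kernel, and later ones are at least `e²` at the selected point. -/
lemma IsPGreedy.powerSq_pos (hK : IsKernel K) (he : 0 < e) (h : IsPGreedy K A e D ξ) :
    ∀ m < D, 0 < powerSq K ξ m (ξ m) := by
  intro m hm
  rcases Nat.eq_zero_or_pos m with rfl | h0
  · simpa [powerSq] using hK.diag_pos (ξ 0)
  · obtain ⟨x, hx, hx'⟩ := h.not_before m h0 hm
    exact (pow_pos he 2).trans_le (hx'.trans (h.greedy m hm x hx))

end Greedy

/-! ### Linear algebra of the Gram matrices -/

section Linear

open Matrix

variable {D : ℕ} {lam : ℝ} {φ : ℕ → Fin D → ℝ}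

/-- The bilinear form `uᵀ M⁻¹ v` behind the Mahalanobis norm. -/
def invForm (M : Matrix (Fin D) (Fin D) ℝ) (u v : Fin D → ℝ) : ℝ := u ⬝ᵥ (M⁻¹ *ᵥ v)

lemma gram_zero (lam : ℝ) (φ : ℕ → Fin D → ℝ) :
    gram lam φ 0 = lam • (1 : Matrix (Fin D) (Fin D) ℝ) := by simp [gram]

lemma gram_succ (lam : ℝ) (φ : ℕ → Fin D → ℝ) (t : ℕ) :
    gram lam φ (t + 1) = gram lam φ t + vecMulVec (φ t) (φ t) := by
  simp [gram, Finset.sum_range_succ, add_assoc]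

lemma gram_posDef (hl : 0 < lam) (φ : ℕ → Fin D → ℝ) (t : ℕ) : (gram lam φ t).PosDef := by
  induction t with
  | zero => rw [gram_zero]; exact PosDef.one.smul hl
  | succ t ih =>
    rw [gram_succ]
    have := posSemidef_vecMulVec_self_star (φ t)
    exact ih.add_posSemidef (by simpa using this)

lemma gram_isUnit_det (hl : 0 < lam) (φ : ℕ → Fin D → ℝ) (t : ℕ) :
    IsUnit (gram lam φ t).det := (gram_posDef hl φ t).det_pos.ne'.isUnit

variable {M : Matrix (Fin D) (Fin D) ℝ}

lemma invForm_add_right (u v w : Fin D → ℝ) :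
    invForm M u (v + w) = invForm M u v + invForm M u w := by
  simp [invForm, mulVec_add, dotProduct_add]

lemma invForm_smul_right (c : ℝ) (u v : Fin D → ℝ) :
    invForm M u (c • v) = c * invForm M u v := by
  simp [invForm, mulVec_smul, dotProduct_smul]

lemma invForm_sum_right {ι : Type*} (s : Finset ι) (u : Fin D → ℝ) (v : ι → Fin D → ℝ) :
    invForm M u (∑ i ∈ s, v i) = ∑ i ∈ s, invForm M u (v i) := by
  classical
  induction s using Finset.induction_on with
  | empty => simp [invForm]
  | insert i s hi ih => rw [Finset.sum_insert hi, Finset.sum_insert hi, invForm_add_right, ih]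

lemma invForm_comm (hM : M.PosDef) (u v : Fin D → ℝ) : invForm M u v = invForm M v u := by
  have h : (M⁻¹)ᵀ = M⁻¹ := by simpa using hM.inv.isHermitian.eq
  rw [invForm, invForm, dotProduct_mulVec, ← mulVec_transpose, h, dotProduct_comm]

lemma invForm_self_nonneg (hM : M.PosDef) (u : Fin D → ℝ) : 0 ≤ invForm M u u := by
  have := hM.inv.posSemidef.dotProduct_mulVec_nonneg u
  simpa [invForm] using this

lemma mahalanobis_nonneg (M : Matrix (Fin D) (Fin D) ℝ) (u : Fin D → ℝ) : 0 ≤ mahalanobis M u :=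
  Real.sqrt_nonneg _

lemma mahalanobis_sq (hM : M.PosDef) (u : Fin D → ℝ) : mahalanobis M u ^ 2 = invForm M u u :=
  Real.sq_sqrt (invForm_self_nonneg hM u)

lemma mahalanobis_smul {c : ℝ} (hc : 0 ≤ c) (u : Fin D → ℝ) :
    mahalanobis M (c • u) = c * mahalanobis M u := by
  rw [mahalanobis, mahalanobis, mulVec_smul, dotProduct_smul, smul_dotProduct, smul_eq_mul,
    smul_eq_mul, ← mul_assoc, Real.sqrt_mul (mul_self_nonneg c), Real.sqrt_mul_self hc]

lemma abs_invForm_le (hM : M.PosDef) (u v : Fin D → ℝ) :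
    |invForm M u v| ≤ mahalanobis M u * mahalanobis M v := by
  have hB := LinearMap.BilinForm.apply_mul_apply_le_of_forall_zero_le (Matrix.toBilin' M⁻¹)
    (fun x => by simpa [Matrix.toBilin'_apply', invForm] using invForm_self_nonneg hM x) u v
  simp only [Matrix.toBilin'_apply'] at hB
  refine abs_le_of_sq_le_sq ?_ (mul_nonneg (mahalanobis_nonneg _ _) (mahalanobis_nonneg _ _))
  rw [mul_pow, mahalanobis_sq hM, mahalanobis_sq hM, pow_two]
  nth_rw 2 [invForm_comm hM]
  exact hB

/-- The Sherman-Morrison formula for the inverse Gram matrices. -/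
lemma invForm_gram_succ (hl : 0 < lam) (φ : ℕ → Fin D → ℝ) (t : ℕ) (u v : Fin D → ℝ) :
    invForm (gram lam φ (t + 1)) u v = invForm (gram lam φ t) u v -
      invForm (gram lam φ t) u (φ t) * invForm (gram lam φ t) (φ t) v /
        (1 + invForm (gram lam φ t) (φ t) (φ t)) := by
  have hM := gram_posDef hl φ t
  have hpos : 0 < 1 + invForm (gram lam φ t) (φ t) (φ t) := by
    linarith [invForm_self_nonneg hM (φ t)]
  have hu := gram_isUnit_det hl φ t
  have hu' := gram_isUnit_det hl φ (t + 1)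
  have hrank : ∀ z : Fin D → ℝ, vecMulVec (φ t) (φ t) *ᵥ z = (φ t ⬝ᵥ z) • φ t := by
    intro z
    ext i
    simp [mulVec, vecMulVec, dotProduct, Finset.sum_mul]
    exact Finset.sum_congr rfl fun j _ => by ring
  have key : (gram lam φ (t + 1))⁻¹ *ᵥ v = (gram lam φ t)⁻¹ *ᵥ v -
      (invForm (gram lam φ t) (φ t) v / (1 + invForm (gram lam φ t) (φ t) (φ t))) •
        (gram lam φ t)⁻¹ *ᵥ φ t := by
    have h1 : gram lam φ (t + 1) *ᵥ ((gram lam φ t)⁻¹ *ᵥ v -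
      (invForm (gram lam φ t) (φ t) v / (1 + invForm (gram lam φ t) (φ t) (φ t))) •
        (gram lam φ t)⁻¹ *ᵥ φ t) = v := by
      rw [gram_succ, add_mulVec, hrank, mulVec_sub, mulVec_smul, mulVec_mulVec, mulVec_mulVec,
        mul_nonsing_inv _ hu, one_mulVec, one_mulVec, dotProduct_sub, dotProduct_smul]
      change v - _ • φ t + (invForm _ _ _ - _ • invForm _ _ _) • φ t = v
      rw [smul_eq_mul, sub_add, ← sub_smul]
      have : invForm (gram lam φ t) (φ t) v / (1 + invForm (gram lam φ t) (φ t) (φ t)) -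
          (invForm (gram lam φ t) (φ t) v - invForm (gram lam φ t) (φ t) v /
            (1 + invForm (gram lam φ t) (φ t) (φ t)) * invForm (gram lam φ t) (φ t) (φ t)) = 0 := by
        field_simp; ring
      rw [this, zero_smul, sub_zero]
    nth_rw 1 [← h1]
    rw [mulVec_mulVec, nonsing_inv_mul _ hu', one_mulVec]
  rw [invForm, key, dotProduct_sub, dotProduct_smul, smul_eq_mul]
  change invForm _ _ _ - _ * invForm _ _ _ = _
  ring

lemma det_gram_succ (hl : 0 < lam) (φ : ℕ → Fin D → ℝ) (t : ℕ) :
    (gram lam φ (t + 1)).det =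
      (gram lam φ t).det * (1 + mahalanobis (gram lam φ t) (φ t) ^ 2) := by
  rw [gram_succ, vecMulVec_eq Unit, det_add_replicateCol_mul_replicateRow (gram_isUnit_det hl φ t),
    mahalanobis_sq (gram_posDef hl φ t)]
  congr 1
  rw [det_unique, Matrix.add_apply, one_apply_eq, invForm,
    dotProduct_mulVec, ← Matrix.replicateRow_vecMul, Matrix.replicateRow_mul_replicateCol_apply]

lemma mahalanobis_gram_succ_le (hl : 0 < lam) (φ : ℕ → Fin D → ℝ) (t : ℕ) (v : Fin D → ℝ) :
    mahalanobis (gram lam φ (t + 1)) v ≤ mahalanobis (gram lam φ t) v := by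
  refine Real.sqrt_le_sqrt ?_
  change invForm _ v v ≤ invForm _ v v
  rw [invForm_gram_succ hl, invForm_comm (gram_posDef hl φ t) v (φ t)]
  have := invForm_self_nonneg (gram_posDef hl φ t) (φ t)
  have : 0 ≤ invForm (gram lam φ t) (φ t) v * invForm (gram lam φ t) (φ t) v /
        (1 + invForm (gram lam φ t) (φ t) (φ t)) :=
    div_nonneg (mul_self_nonneg _) (by linarith)
  linarith

/-- More observations shrink the confidence ellipsoid. -/
lemma mahalanobis_gram_anti (hl : 0 < lam) (φ : ℕ → Fin D → ℝ) (v : Fin D → ℝ) :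
    Antitone fun t => mahalanobis (gram lam φ t) v :=
  antitone_nat_of_succ_le fun t => mahalanobis_gram_succ_le hl φ t v

lemma mahalanobis_gram_zero (φ : ℕ → Fin D → ℝ) (v : Fin D → ℝ) :
    mahalanobis (gram lam φ 0) v = √(lam⁻¹ * (v ⬝ᵥ v)) := by
  have h : (lam • (1 : Matrix (Fin D) (Fin D) ℝ))⁻¹ = lam⁻¹ • 1 := by
    rcases eq_or_ne lam 0 with rfl | h0
    · simp
    · refine Matrix.inv_eq_left_inv ?_
      rw [smul_mul_smul_comm, one_mul, inv_mul_cancel₀ h0, one_smul]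
  rw [mahalanobis, gram_zero, h, smul_mulVec, one_mulVec, dotProduct_smul, smul_eq_mul]

lemma mahalanobis_gram_le_one (hl : 1 ≤ lam) (φ : ℕ → Fin D → ℝ) (t : ℕ) {v : Fin D → ℝ}
    (hv : v ⬝ᵥ v ≤ 1) : mahalanobis (gram lam φ t) v ≤ 1 := by
  refine (mahalanobis_gram_anti (by linarith) φ v (Nat.zero_le t)).trans ?_
  change mahalanobis (gram lam φ 0) v ≤ 1
  have h0 : 0 ≤ v ⬝ᵥ v := Finset.sum_nonneg fun i _ => mul_self_nonneg _
  rw [mahalanobis_gram_zero, Real.sqrt_le_one]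
  exact mul_le_one₀ (inv_le_one_of_one_le₀ hl) h0 hv

/-- `det (λ⁻¹ A_t)`, normalized to be `1` for `t = 0`. -/
lemma det_inv_smul_gram_zero (hl : 0 < lam) (φ : ℕ → Fin D → ℝ) :
    (lam⁻¹ • gram lam φ 0).det = 1 := by
  rw [gram_zero, smul_smul, inv_mul_cancel₀ hl.ne', one_smul, det_one]

lemma det_inv_smul_gram_succ (hl : 0 < lam) (φ : ℕ → Fin D → ℝ) (t : ℕ) :
    (lam⁻¹ • gram lam φ (t + 1)).det =
      (lam⁻¹ • gram lam φ t).det * (1 + mahalanobis (gram lam φ t) (φ t) ^ 2) := by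
  rw [det_smul, det_smul, det_gram_succ hl, mul_assoc]

lemma one_le_det_inv_smul_gram (hl : 0 < lam) (φ : ℕ → Fin D → ℝ) (t : ℕ) :
    1 ≤ (lam⁻¹ • gram lam φ t).det := by
  induction t with
  | zero => rw [det_inv_smul_gram_zero hl]
  | succ t ih =>
    rw [det_inv_smul_gram_succ hl]
    exact one_le_mul_of_one_le_of_one_le ih (by nlinarith [sq_nonneg (mahalanobis (gram lam φ t) (φ t))])

lemma dotProduct_gram_mulVec_le {t : ℕ} (hφ : ∀ s < t, φ s ⬝ᵥ φ s ≤ 1)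
    (v : Fin D → ℝ) : v ⬝ᵥ (gram lam φ t *ᵥ v) ≤ (lam + t) * (v ⬝ᵥ v) := by
  have hv : 0 ≤ v ⬝ᵥ v := Finset.sum_nonneg fun i _ => mul_self_nonneg _
  induction t with
  | zero => simp [gram_zero, smul_mulVec]
  | succ t ih =>
    have hcs : (v ⬝ᵥ φ t) ^ 2 ≤ (v ⬝ᵥ v) * (φ t ⬝ᵥ φ t) := by
      simp only [dotProduct, ← pow_two]
      exact Finset.sum_mul_sq_le_sq_mul_sq _ _ _
    have hr : v ⬝ᵥ (vecMulVec (φ t) (φ t) *ᵥ v) = (v ⬝ᵥ φ t) ^ 2 := by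
      rw [← mul_one (vecMulVec _ _), vecMulVec_mul, vecMul_one, vecMulVec_mulVec,
        dotProduct_comm (φ t) v]
      simp [dotProduct_smul, pow_two]
    rw [gram_succ, add_mulVec, dotProduct_add, hr]
    have := ih fun s hs => hφ s (by omega)
    have := mul_le_of_le_one_right hv (hφ t (by omega))
    push_cast
    nlinarith

/-- All eigenvalues of the Gram matrix are at most `λ + t ≤ λ (1 + t)`. -/
lemma det_inv_smul_gram_le (hl : 1 ≤ lam) {t : ℕ} (hφ : ∀ s < t, φ s ⬝ᵥ φ s ≤ 1) :
    (lam⁻¹ • gram lam φ t).det ≤ (1 + (t : ℝ)) ^ D := by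
  have hl0 : 0 < lam := by linarith
  have hM := gram_posDef hl0 φ t
  rw [det_smul, hM.isHermitian.det_eq_prod_eigenvalues, ← Finset.card_univ, ← Finset.prod_const,
    ← Finset.prod_mul_distrib]
  have hle : ∀ i : Fin D, lam⁻¹ * (hM.isHermitian.eigenvalues i : ℝ) ≤ 1 + t := by
    intro i
    have h1 := hM.isHermitian.eigenvalues_eq i
    have h2 := dotProduct_gram_mulVec_le (lam := lam) hφ (hM.isHermitian.eigenvectorBasis i).ofLp
    have h3 : (hM.isHermitian.eigenvectorBasis i).ofLp ⬝ᵥ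
        (hM.isHermitian.eigenvectorBasis i).ofLp = 1 := by
      have := hM.isHermitian.eigenvectorBasis.orthonormal.1 i
      rw [EuclideanSpace.norm_eq, Real.sqrt_eq_one] at this
      rw [← this]
      simp [dotProduct, pow_two]
    rw [h3, mul_one] at h2
    simp only [star_trivial, RCLike.re_to_real] at h1
    rw [h1, inv_mul_le_iff₀ hl0]
    have : (0 : ℝ) ≤ t := Nat.cast_nonneg t
    nlinarith
  have h0 : ∀ i : Fin D, 0 ≤ lam⁻¹ * (hM.isHermitian.eigenvalues i : ℝ) := fun i =>
    mul_nonneg (inv_nonneg.2 hl0.le) (hM.eigenvalues_pos i).le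
  calc _ ≤ ∏ _i : Fin D, (1 + (t : ℝ)) := Finset.prod_le_prod (fun i _ => h0 i) fun i _ => hle i
    _ = _ := by simp

/-- The elliptical potential bound. -/
lemma sum_mahalanobis_sq_le (hl : 1 ≤ lam) {t : ℕ} (hφ : ∀ s < t, φ s ⬝ᵥ φ s ≤ 1) :
    ∑ s ∈ Finset.range t, mahalanobis (gram lam φ s) (φ s) ^ 2 ≤ 2 * (D * Real.log (1 + t)) := by
  have hl0 : 0 < lam := by linarith
  have h1 : ∑ s ∈ Finset.range t, mahalanobis (gram lam φ s) (φ s) ^ 2 ≤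
      2 * Real.log (lam⁻¹ • gram lam φ t).det := by
    induction t with
    | zero => simp [det_inv_smul_gram_zero hl0]
    | succ t ih =>
      have hw := mahalanobis_gram_le_one hl φ t (hφ t (by omega))
      have hw0 := mahalanobis_nonneg (gram lam φ t) (φ t)
      rw [Finset.sum_range_succ, det_inv_smul_gram_succ hl0, Real.log_mul
        (by linarith [one_le_det_inv_smul_gram hl0 φ t]) (by positivity)]
      have h2 := Real.le_log_one_add_of_nonneg (sq_nonneg (mahalanobis (gram lam φ t) (φ t)))
      have h3 : mahalanobis (gram lam φ t) (φ t) ^ 2 / 2 ≤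
          2 * mahalanobis (gram lam φ t) (φ t) ^ 2 / (mahalanobis (gram lam φ t) (φ t) ^ 2 + 2) := by
        rw [div_le_div_iff₀ (by norm_num) (by positivity)]
        nlinarith [sq_nonneg (mahalanobis (gram lam φ t) (φ t)), pow_le_one₀ hw0 hw (n := 2)]
      have := ih fun s hs => hφ s (by omega)
      linarith
  refine h1.trans ?_
  have h2 := Real.log_le_log (by linarith [one_le_det_inv_smul_gram hl0 φ t])
    (det_inv_smul_gram_le hl hφ)
  rw [Real.log_pow] at h2
  linarith

/-- The elliptical potential bound and the Cauchy-Schwarz inequality. -/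
lemma psi_le (hl : 1 ≤ lam) {t : ℕ} (hφ : ∀ s < t, φ s ⬝ᵥ φ s ≤ 1) :
    psi lam φ t ≤ √(t * (2 * (D * Real.log (1 + t)))) := by
  refine Real.le_sqrt_of_sq_le ?_
  have h1 := sum_mahalanobis_sq_le hl hφ
  have h2 := sq_sum_le_card_mul_sum_sq (s := Finset.range t)
    (f := fun s => mahalanobis (gram lam φ s) (φ s))
  rw [Finset.card_range] at h2
  exact h2.trans (mul_le_mul_of_nonneg_left h1 (Nat.cast_nonneg t))

lemma psi_nonneg (lam : ℝ) (φ : ℕ → Fin D → ℝ) (t : ℕ) : 0 ≤ psi lam φ t :=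
  Finset.sum_nonneg fun _ _ => mahalanobis_nonneg _ _

/-- If the self-normalized noise is controlled, then the ridge estimate of the misspecified
linear model deviates from the true parameter by at most `width` in the direction `u`. -/
lemma abs_thetaHat_sub_le (hl : 0 < lam) {R B ε δ : ℝ} (hB : 0 ≤ B) (hε : 0 ≤ ε)
    {y : ℕ → ℝ} {θ : Fin D → ℝ}
    {η : ℕ → ℝ} {t : ℕ} (hη : ∀ s < t, |y s - η s - θ ⬝ᵥ φ s| ≤ ε) (hθ : θ ⬝ᵥ θ ≤ B ^ 2)
    (hS : mahalanobis (gram lam φ t) (∑ s ∈ Finset.range t, η s • φ s) ≤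
      R * √(Real.log ((lam⁻¹ • gram lam φ t).det / (δ / 2) ^ 2))) (u : Fin D → ℝ) :
    |thetaHat lam φ y t ⬝ᵥ u - θ ⬝ᵥ u| ≤
      width R B lam δ ε φ t * mahalanobis (gram lam φ t) u := by
  have hM := gram_posDef hl φ t
  have hgθ : gram lam φ t *ᵥ θ = lam • θ + ∑ s ∈ Finset.range t, (θ ⬝ᵥ φ s) • φ s := by
    rw [gram, add_mulVec, smul_mulVec, one_mulVec, sum_mulVec]
    congr 1
    refine Finset.sum_congr rfl fun s _ => ?_
    ext i
    simp [mulVec, vecMulVec, dotProduct, Finset.sum_mul]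
    exact Finset.sum_congr rfl fun j _ => by ring
  have hθ' : θ ⬝ᵥ u = invForm (gram lam φ t) u (gram lam φ t *ᵥ θ) := by
    rw [invForm, mulVec_mulVec, nonsing_inv_mul _ (gram_isUnit_det hl φ t), one_mulVec,
      dotProduct_comm]
  have hdec : thetaHat lam φ y t ⬝ᵥ u - θ ⬝ᵥ u =
      invForm (gram lam φ t) u (∑ s ∈ Finset.range t, η s • φ s) +
      ∑ s ∈ Finset.range t, (y s - η s - θ ⬝ᵥ φ s) * invForm (gram lam φ t) u (φ s) -
      invForm (gram lam φ t) u (lam • θ) := by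
    rw [hθ', hgθ, thetaHat, dotProduct_comm]
    change invForm _ _ _ - _ = _
    rw [invForm_add_right, invForm_sum_right, invForm_sum_right, invForm_sum_right]
    simp only [invForm_smul_right, sub_mul, Finset.sum_sub_distrib]
    ring
  have h1 := (abs_invForm_le hM u (∑ s ∈ Finset.range t, η s • φ s)).trans
    (mul_le_mul_of_nonneg_left hS (mahalanobis_nonneg _ _))
  have h2 : |∑ s ∈ Finset.range t, (y s - η s - θ ⬝ᵥ φ s) * invForm (gram lam φ t) u (φ s)| ≤
      mahalanobis (gram lam φ t) u * (ε * psi lam φ t) := by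
    refine (Finset.abs_sum_le_sum_abs _ _).trans ?_
    rw [psi, Finset.mul_sum, Finset.mul_sum]
    refine Finset.sum_le_sum fun s hs => ?_
    rw [abs_mul]
    have hs' := Finset.mem_range.1 hs
    have h3 := (abs_invForm_le hM u (φ s)).trans (mul_le_mul_of_nonneg_left
      (mahalanobis_gram_anti hl φ (φ s) hs'.le) (mahalanobis_nonneg _ _))
    calc _ ≤ ε * (mahalanobis (gram lam φ t) u * mahalanobis (gram lam φ s) (φ s)) :=
          mul_le_mul (hη s hs') h3 (abs_nonneg _) hε
      _ = _ := by ring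
  have h3 : |invForm (gram lam φ t) u (lam • θ)| ≤ mahalanobis (gram lam φ t) u * (√lam * B) := by
    refine (abs_invForm_le hM u _).trans (mul_le_mul_of_nonneg_left ?_ (mahalanobis_nonneg _ _))
    refine (mahalanobis_gram_anti hl φ _ (Nat.zero_le t)).trans ?_
    change mahalanobis (gram lam φ 0) _ ≤ _
    rw [mahalanobis_smul hl.le, mahalanobis_gram_zero, Real.sqrt_mul (inv_nonneg.2 hl.le),
      ← mul_assoc, Real.sqrt_inv, ← div_eq_mul_inv, Real.div_sqrt]
    refine mul_le_mul_of_nonneg_left ?_ (Real.sqrt_nonneg _)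
    exact (Real.sqrt_le_sqrt hθ).trans (by rw [Real.sqrt_sq hB])
  rw [hdec, width, beta]
  calc _ ≤ _ + _ + _ := (abs_sub _ _).trans (add_le_add_left (abs_add_le _ _) _)
    _ ≤ _ := add_le_add (add_le_add h1 h2) h3
    _ = _ := by ring

/-- A deterministic bound for the scale of the sampling distribution in all rounds. -/
lemma width_le {R B ε δ : ℝ} (hR : 0 ≤ R) (hε : 0 ≤ ε) (hl : 1 ≤ lam) (hδ : 0 < δ)
    {t T : ℕ} (htT : t ≤ T) (hφ : ∀ s < t, φ s ⬝ᵥ φ s ≤ 1) :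
    width R B lam δ ε φ t ≤ R * √(D * Real.log (1 + T) + 2 * Real.log (2 / δ)) + √lam * B
      + ε * √(T * (2 * (D * Real.log (1 + T)))) := by
  have hl0 : 0 < lam := by linarith
  have hT : (t : ℝ) ≤ T := by exact_mod_cast htT
  have ht0 : (0 : ℝ) ≤ t := Nat.cast_nonneg t
  have hlog : Real.log (1 + t) ≤ Real.log (1 + T) := Real.log_le_log (by linarith) (by linarith)
  have hlog0 : 0 ≤ Real.log (1 + t) := Real.log_nonneg (by linarith)
  rw [width, beta]
  refine add_le_add (add_le_add_left (mul_le_mul_of_nonneg_left (Real.sqrt_le_sqrt ?_) hR) _)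
    (mul_le_mul_of_nonneg_left ((psi_le hl hφ).trans (Real.sqrt_le_sqrt ?_)) hε)
  · have h1 := one_le_det_inv_smul_gram hl0 φ t
    rw [Real.log_div (by linarith) (by positivity), Real.log_pow]
    have h2 := Real.log_le_log (by linarith) (det_inv_smul_gram_le hl hφ)
    rw [Real.log_pow] at h2
    have h3 : Real.log (2 / δ) = - Real.log (δ / 2) := by rw [← Real.log_inv, inv_div]
    rw [h3]
    have h4 : (D : ℝ) * Real.log (1 + t) ≤ D * Real.log (1 + T) :=
      mul_le_mul_of_nonneg_left hlog (Nat.cast_nonneg D)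
    push_cast
    linarith
  · have h4 : (D : ℝ) * Real.log (1 + t) ≤ D * Real.log (1 + T) :=
      mul_le_mul_of_nonneg_left hlog (Nat.cast_nonneg D)
    have h5 : 0 ≤ (D : ℝ) * Real.log (1 + t) := mul_nonneg (Nat.cast_nonneg D) hlog0
    exact mul_le_mul hT (by linarith) (by linarith) (by linarith)

end Linear

/-! ### Ville's inequality and the method of mixtures -/

section Ville

open scoped ENNReal

variable {Ψ : Type*} {m mΨ : MeasurableSpace Ψ} {P : Measure Ψ}

/-- The inequality `E[Q | m] ≤ 1`, for a nonnegative `Q`, stated by testing against all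
nonnegative `m`-measurable functions; no integrability is involved. -/
def CondLeOne (P : Measure Ψ) (m : MeasurableSpace Ψ) (Q : Ψ → ℝ≥0∞) : Prop :=
  ∀ g : Ψ → ℝ≥0∞, Measurable[m] g → ∫⁻ ω, g ω * Q ω ∂P ≤ ∫⁻ ω, g ω ∂P

/-- Ville's maximal inequality for a nonnegative supermartingale that starts at `1`. -/
lemma measure_exists_ge_le_inv [IsProbabilityMeasure P] {m : ℕ → MeasurableSpace Ψ} {n : ℕ}
    (hmono : Monotone m) (hle : ∀ t ≤ n, m t ≤ mΨ) {M Q : ℕ → Ψ → ℝ≥0∞}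
    (hM : ∀ t ≤ n, Measurable[m t] (M t)) (h0 : ∀ ω, M 0 ω = 1)
    (hQM : ∀ t < n, ∀ ω, M (t + 1) ω = M t ω * Q t ω) (hQ : ∀ t < n, CondLeOne P (m t) (Q t))
    {c : ℝ≥0∞} (hc : c ≠ 0) (hc' : c ≠ ∞) :
    P {ω | ∃ t ≤ n, c ≤ M t ω} ≤ c⁻¹ := by
  classical
  -- the process `M` stopped when it first reaches the level `c`
  obtain ⟨N, hN0, hN1⟩ : ∃ N : ℕ → Ψ → ℝ≥0∞, N 0 = M 0 ∧
      ∀ t ω, N (t + 1) ω = if c ≤ N t ω then N t ω else M (t + 1) ω :=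
    ⟨fun t => Nat.rec (motive := fun _ => Ψ → ℝ≥0∞) (M 0)
      (fun t Nt ω => if c ≤ Nt ω then Nt ω else M (t + 1) ω) t, rfl, fun _ _ => rfl⟩
  have hNmeas : ∀ t ≤ n, Measurable[m t] (N t) := by
    intro t
    induction t with
    | zero => intro h; rw [hN0]; exact hM 0 h
    | succ t ih =>
      intro h
      have hfun : N (t + 1) = fun ω => if c ≤ N t ω then N t ω else M (t + 1) ω := funext (hN1 t)
      rw [hfun]
      have h1 : Measurable[m (t + 1)] (N t) := (ih (by omega)).mono (hmono (Nat.le_succ t)) le_rfl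
      have h2 : MeasurableSet[m (t + 1)] {ω | c ≤ N t ω} := h1 measurableSet_Ici
      exact Measurable.ite h2 h1 (hM (t + 1) h)
  have hNM : ∀ t ω, N t ω < c → N t ω = M t ω := by
    intro t ω
    cases t with
    | zero => intro _; rw [hN0]
    | succ t =>
      rw [hN1]
      split_ifs with h
      · intro h'; exact absurd h (not_le.2 h')
      · intro _; rfl
  -- the stopped process stays above `c` once `M` has reached `c`
  have hcN : ∀ t ω, (∃ s ≤ t, c ≤ M s ω) → c ≤ N t ω := by
    intro t ω
    induction t with
    | zero => rintro ⟨s, hs, h⟩; rw [Nat.le_zero.1 hs] at h; rwa [hN0]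
    | succ t ih =>
      rintro ⟨s, hs, h⟩
      rw [hN1]
      split_ifs with h1
      · exact h1
      · rcases Nat.lt_or_ge s (t + 1) with h2 | h2
        · exact absurd (ih ⟨s, by omega, h⟩) h1
        · rwa [le_antisymm hs h2] at h
  -- the stopped process is again a supermartingale
  have hint : ∀ t ≤ n, ∫⁻ ω, N t ω ∂P ≤ 1 := by
    intro t
    induction t with
    | zero => intro _; rw [hN0]; simp [h0]
    | succ t ih =>
      intro ht
      refine le_trans ?_ (ih (by omega))
      have hm1 := hNmeas t (by omega)
      have hS : MeasurableSet[m t] {ω | c ≤ N t ω} := hm1 measurableSet_Ici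
      have hS' : MeasurableSet {ω | c ≤ N t ω} := hle t (by omega) _ hS
      have h2 : ∀ ω, N (t + 1) ω = {ω | c ≤ N t ω}.indicator (N t) ω +
          {ω | c ≤ N t ω}ᶜ.indicator (N t) ω * Q t ω := by
        intro ω
        rw [hN1]
        by_cases h : c ≤ N t ω
        · simp [h]
        · rw [if_neg h, hQM t (by omega), ← hNM t ω (not_le.1 h)]
          simp [h]
      have hm3 : Measurable (N t) := hm1.mono (hle t (by omega)) le_rfl
      calc ∫⁻ ω, N (t + 1) ω ∂P
          = ∫⁻ ω, {ω | c ≤ N t ω}.indicator (N t) ω ∂P +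
            ∫⁻ ω, {ω | c ≤ N t ω}ᶜ.indicator (N t) ω * Q t ω ∂P := by
            simp_rw [h2]
            exact lintegral_add_left (hm3.indicator hS') _
        _ ≤ ∫⁻ ω, {ω | c ≤ N t ω}.indicator (N t) ω ∂P +
            ∫⁻ ω, {ω | c ≤ N t ω}ᶜ.indicator (N t) ω ∂P :=
            add_le_add le_rfl (hQ t (by omega) _ (hm1.indicator hS.compl))
        _ = ∫⁻ ω, N t ω ∂P := by
            rw [← lintegral_add_left (hm3.indicator hS')]
            refine lintegral_congr fun ω => ?_
            by_cases h : c ≤ N t ω <;> simp [h]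
  calc P {ω | ∃ t ≤ n, c ≤ M t ω} ≤ P {ω | c ≤ N n ω} := measure_mono fun ω h => hcN n ω h
    _ ≤ (∫⁻ ω, N n ω ∂P) / c :=
      meas_ge_le_lintegral_div ((hNmeas n le_rfl).mono (hle n le_rfl) le_rfl).aemeasurable hc hc'
    _ ≤ 1 / c := ENNReal.div_le_div_right (hint n le_rfl) c
    _ = c⁻¹ := one_div c

/-- The measures `Q P` and `c P`, restricted to `m`, are compared set by set. -/
lemma lintegral_mul_le_of_condExp_le [IsProbabilityMeasure P] (hm : m ≤ mΨ)
    {Q : Ψ → ℝ} (hQ : Integrable Q P) (hQ0 : ∀ ω, 0 ≤ Q ω) {c : ℝ}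
    (h : P[Q | m] ≤ᵐ[P] fun _ => c) {g : Ψ → ℝ≥0∞} (hg : Measurable[m] g) :
    ∫⁻ ω, g ω * ENNReal.ofReal (Q ω) ∂P ≤ ENNReal.ofReal c * ∫⁻ ω, g ω ∂P := by
  have hqm : AEMeasurable (fun ω => ENNReal.ofReal (Q ω)) P :=
    hQ.aestronglyMeasurable.aemeasurable.ennreal_ofReal
  have hle : (P.withDensity fun ω => ENNReal.ofReal (Q ω)).trim hm ≤
      ENNReal.ofReal c • P.trim hm := by
    refine Measure.le_iff.2 fun S hS => ?_
    rw [Measure.smul_apply, trim_measurableSet_eq hm hS, trim_measurableSet_eq hm hS,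
      withDensity_apply _ (hm S hS),
      ← ofReal_integral_eq_lintegral_ofReal hQ.integrableOn (Filter.Eventually.of_forall hQ0),
      ← setIntegral_condExp hm hQ hS, smul_eq_mul]
    refine (ENNReal.ofReal_le_ofReal (setIntegral_mono_ae integrable_condExp.integrableOn
      (integrable_const c).integrableOn h)).trans ?_
    rw [setIntegral_const, smul_eq_mul, mul_comm]
    rcases le_total 0 c with hc | hc
    · rw [ENNReal.ofReal_mul hc, Measure.real, ENNReal.ofReal_toReal (measure_ne_top _ _)]
    · rw [ENNReal.ofReal_of_nonpos (mul_nonpos_of_nonpos_of_nonneg hc measureReal_nonneg)]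
      exact bot_le
  calc ∫⁻ ω, g ω * ENNReal.ofReal (Q ω) ∂P
      = ∫⁻ ω, g ω ∂(P.withDensity fun ω => ENNReal.ofReal (Q ω)) := by
        rw [lintegral_withDensity_eq_lintegral_mul₀ hqm (hg.mono hm le_rfl).aemeasurable]
        simp [mul_comm]
    _ = ∫⁻ ω, g ω ∂((P.withDensity fun ω => ENNReal.ofReal (Q ω)).trim hm) :=
        (lintegral_trim hm hg).symm
    _ ≤ ∫⁻ ω, g ω ∂(ENNReal.ofReal c • P.trim hm) := lintegral_mono' hle le_rfl
    _ = _ := by rw [lintegral_smul_measure, lintegral_trim hm hg, smul_eq_mul]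

lemma condLeOne_exp_sub_of_condExp_le [IsProbabilityMeasure P] (hm : m ≤ mΨ) {X : Ψ → ℝ} {c : ℝ}
    (hX : Integrable (fun ω => Real.exp (X ω)) P)
    (h : P[fun ω => Real.exp (X ω) | m] ≤ᵐ[P] fun _ => Real.exp c) :
    CondLeOne P m fun ω => ENNReal.ofReal (Real.exp (X ω - c)) := by
  intro g hg
  have h2 := lintegral_mul_le_of_condExp_le hm hX (fun ω => (Real.exp_pos _).le) h hg
  calc ∫⁻ ω, g ω * ENNReal.ofReal (Real.exp (X ω - c)) ∂P
      = ∫⁻ ω, ENNReal.ofReal (Real.exp (-c)) * (g ω * ENNReal.ofReal (Real.exp (X ω))) ∂P := by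
        refine lintegral_congr fun ω => ?_
        rw [sub_eq_neg_add, Real.exp_add, ENNReal.ofReal_mul (Real.exp_pos _).le]
        ring
    _ = ENNReal.ofReal (Real.exp (-c)) * ∫⁻ ω, g ω * ENNReal.ofReal (Real.exp (X ω)) ∂P :=
        lintegral_const_mul' _ _ ENNReal.ofReal_ne_top
    _ ≤ ENNReal.ofReal (Real.exp (-c)) * (ENNReal.ofReal (Real.exp c) * ∫⁻ ω, g ω ∂P) :=
        mul_le_mul_right h2 _
    _ = ∫⁻ ω, g ω ∂P := by
        rw [← mul_assoc, ← ENNReal.ofReal_mul (Real.exp_pos _).le, ← Real.exp_add]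
        simp

end Ville

section Mixture

open scoped ENNReal

variable {Ψ : Type*} {m mΨ : MeasurableSpace Ψ} {P : Measure Ψ}

/-- Simple functions approximate `s`. The σ-algebra is an instance argument of this lemma so that it
can be applied to a sub-σ-algebra. -/
lemma exists_finite_range_tendsto {α : Type*} [MeasurableSpace α] {s : α → ℝ}
    (hs : Measurable s) : ∃ f : ℕ → α → ℝ, (∀ k, Measurable (f k)) ∧
      (∀ k, (Set.range (f k)).Finite) ∧
      ∀ a, Filter.Tendsto (fun k => f k a) Filter.atTop (nhds (s a)) :=
  ⟨fun k => hs.stronglyMeasurable.approx k, fun k => (hs.stronglyMeasurable.approx k).measurable,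
    fun k => (hs.stronglyMeasurable.approx k).finite_range,
    fun a => hs.stronglyMeasurable.tendsto_approx a⟩

/-- A conditional sub-Gaussian bound for all deterministic parameters holds for parameters that
are measurable with respect to the conditioning σ-algebra. -/
lemma condLeOne_exp_of_forall (hm : m ≤ mΨ) {e : Ψ → ℝ}
    (he : Measurable e)
    (h : ∀ s : ℝ, CondLeOne P m fun ω => ENNReal.ofReal (Real.exp (s * e ω - s ^ 2 / 2)))
    {s : Ψ → ℝ} (hs : Measurable[m] s) :
    CondLeOne P m fun ω => ENNReal.ofReal (Real.exp (s ω * e ω - s ω ^ 2 / 2)) := by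
  intro g hg
  have hg' : Measurable g := hg.mono hm le_rfl
  -- for simple functions, split according to the value
  have hsimple : ∀ f : Ψ → ℝ, Measurable[m] f → (Set.range f).Finite →
      ∫⁻ ω, g ω * ENNReal.ofReal (Real.exp (f ω * e ω - f ω ^ 2 / 2)) ∂P ≤ ∫⁻ ω, g ω ∂P := by
    intro f hf hfin
    have hset : ∀ c, MeasurableSet[m] (f ⁻¹' {c}) := fun c => hf (measurableSet_singleton c)
    have hsum : ∀ (F : Ψ → ℝ≥0∞) (ω : Ψ),
        F ω = ∑ c ∈ hfin.toFinset, (f ⁻¹' {c}).indicator F ω := by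
      intro F ω
      rw [Finset.sum_eq_single_of_mem (f ω) (by simp)]
      · simp
      · intro b _ hb
        exact Set.indicator_of_notMem (fun h => hb h.symm) _
    have hc : ∀ c, ∫⁻ ω, ((f ⁻¹' {c}).indicator
        (fun ω => g ω * ENNReal.ofReal (Real.exp (f ω * e ω - f ω ^ 2 / 2))) ω) ∂P ≤
        ∫⁻ ω, (f ⁻¹' {c}).indicator g ω ∂P := by
      intro c
      refine le_trans (le_of_eq (lintegral_congr fun ω => ?_)) (h c _ (hg.indicator (hset c)))
      by_cases hω : f ω = c
      · simp [hω]
      · simp [hω]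
    have hfm : Measurable f := hf.mono hm le_rfl
    calc ∫⁻ ω, g ω * ENNReal.ofReal (Real.exp (f ω * e ω - f ω ^ 2 / 2)) ∂P
        = ∑ c ∈ hfin.toFinset, ∫⁻ ω, ((f ⁻¹' {c}).indicator
        (fun ω => g ω * ENNReal.ofReal (Real.exp (f ω * e ω - f ω ^ 2 / 2))) ω) ∂P := by
          rw [← lintegral_finsetSum]
          · exact lintegral_congr fun ω =>
              hsum (fun ω => g ω * ENNReal.ofReal (Real.exp (f ω * e ω - f ω ^ 2 / 2))) ω
          · intro c _
            exact Measurable.indicator (by fun_prop) (hm _ (hset c))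
      _ ≤ ∑ c ∈ hfin.toFinset, ∫⁻ ω, (f ⁻¹' {c}).indicator g ω ∂P :=
          Finset.sum_le_sum fun c _ => hc c
      _ = ∫⁻ ω, g ω ∂P := by
          rw [← lintegral_finsetSum]
          · exact lintegral_congr fun ω => (hsum _ ω).symm
          · intro c _
            exact hg'.indicator (hm _ (hset c))
  obtain ⟨f, hf, hfin, hft⟩ := @exists_finite_range_tendsto Ψ m s hs
  -- Fatou's lemma passes to the limit
  have hfat := lintegral_liminf_le (μ := P) (u := Filter.atTop) (f := fun (k : ℕ) ω => g ω *
    ENNReal.ofReal (Real.exp (f k ω * e ω - f k ω ^ 2 / 2))) (fun k => by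
      have : Measurable (f k) := (hf k).mono hm le_rfl
      fun_prop)
  beta_reduce
  refine le_trans (le_of_eq ?_) (hfat.trans ?_)
  · refine lintegral_congr fun ω => ?_
    have ht := hft ω
    have h2 : Filter.Tendsto (fun k => ENNReal.ofReal
        (Real.exp (f k ω * e ω - f k ω ^ 2 / 2))) Filter.atTop
        (nhds (ENNReal.ofReal (Real.exp (s ω * e ω - s ω ^ 2 / 2)))) :=
      ENNReal.tendsto_ofReal ((Real.continuous_exp.tendsto _).comp
        ((ht.mul_const _).sub ((ht.pow 2).div_const 2)))
    exact (ENNReal.Tendsto.const_mul h2 (Or.inl (by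
      simp [Real.exp_pos]))).liminf_eq.symm
  · exact Filter.liminf_le_of_le (by isBoundedDefault) fun b hb => by
      obtain ⟨k, hk⟩ := hb.exists
      exact hk.trans (hsimple _ (hf k) (hfin k))

/-- Averaging the exponential supermartingale over its parameter `s = a + w z`, with `z` standard
normal, gives the factor by which the self-normalized supermartingale changes in one round. -/
lemma lintegral_gaussian_exp (a w e : ℝ) :
    ∫⁻ z, ENNReal.ofReal (Real.exp ((a + w * z) * e - (a + w * z) ^ 2 / 2)) ∂(gaussianReal 0 1) =
      ENNReal.ofReal (Real.exp ((2 * e * a + e ^ 2 * w ^ 2 - a ^ 2) / (2 * (1 + w ^ 2))) /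
        √(1 + w ^ 2)) := by
  have hw : 0 < 1 + w ^ 2 := by positivity
  set v : NNReal := ⟨(1 + w ^ 2)⁻¹, (inv_pos.2 hw).le⟩ with hv
  have hv0 : v ≠ 0 := by
    intro h
    have := congrArg NNReal.toReal h
    simp only [hv, NNReal.coe_zero] at this
    exact (inv_pos.2 hw).ne' this
  have hvr : (v : ℝ) = (1 + w ^ 2)⁻¹ := rfl
  have hmgf : ∫⁻ z, ENNReal.ofReal (Real.exp ((w * (e - a)) * z)) ∂(gaussianReal 0 v) =
      ENNReal.ofReal (Real.exp (v * (w * (e - a)) ^ 2 / 2)) := by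
    rw [← ofReal_integral_eq_lintegral_ofReal (integrable_exp_mul_gaussianReal _)
      (Filter.Eventually.of_forall fun _ => (Real.exp_pos _).le)]
    congr 1
    have := congrFun (mgf_id_gaussianReal (μ := 0) (v := v)) (w * (e - a))
    simpa [mgf] using this
  have hpt : ∀ z, gaussianPDF 0 1 z *
      ENNReal.ofReal (Real.exp ((a + w * z) * e - (a + w * z) ^ 2 / 2)) =
      ENNReal.ofReal (Real.exp (a * e - a ^ 2 / 2) / √(1 + w ^ 2)) *
      (gaussianPDF 0 v z * ENNReal.ofReal (Real.exp ((w * (e - a)) * z))) := by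
    intro z
    rw [gaussianPDF, gaussianPDF, ← ENNReal.ofReal_mul (gaussianPDFReal_nonneg _ _ _),
      ← ENNReal.ofReal_mul (gaussianPDFReal_nonneg _ _ _), ← ENNReal.ofReal_mul (by positivity)]
    congr 1
    rw [gaussianPDFReal, gaussianPDFReal, hvr, Real.sqrt_mul (by positivity) (1 + w ^ 2)⁻¹,
      Real.sqrt_inv]
    have h1 : Real.exp (-(z - 0) ^ 2 / (2 * (1 : NNReal))) *
        Real.exp ((a + w * z) * e - (a + w * z) ^ 2 / 2) =
        Real.exp (a * e - a ^ 2 / 2) * (Real.exp (-(z - 0) ^ 2 / (2 * (1 + w ^ 2)⁻¹)) *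
          Real.exp (w * (e - a) * z)) := by
      rw [← Real.exp_add, ← Real.exp_add, ← Real.exp_add]
      congr 1
      rw [NNReal.coe_one]
      field_simp
      ring
    have hs : √(1 + w ^ 2) ≠ 0 := (Real.sqrt_pos.2 hw).ne'
    have h2 : √(2 * Real.pi) ≠ 0 := (Real.sqrt_pos.2 (by positivity)).ne'
    simp only [NNReal.coe_one, mul_one] at h1 ⊢
    rw [mul_assoc, h1]
    field_simp
  rw [gaussianReal_of_var_ne_zero _ one_ne_zero, lintegral_withDensity_eq_lintegral_mul _
    (measurable_gaussianPDF _ _) (by fun_prop)]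
  simp only [Pi.mul_apply, hpt]
  rw [lintegral_const_mul _ (by fun_prop)]
  rw [gaussianReal_of_var_ne_zero _ hv0, lintegral_withDensity_eq_lintegral_mul _
    (measurable_gaussianPDF _ _) (by fun_prop)] at hmgf
  simp only [Pi.mul_apply] at hmgf
  rw [hmgf, ← ENNReal.ofReal_mul (by positivity)]
  congr 1
  rw [div_mul_eq_mul_div, ← Real.exp_add, hvr]
  congr 2
  field_simp
  ring

/-- One step of the method of mixtures: `e` is the noise of the round, `w` the norm of the feature
vector and `a` its product with the accumulated noise, both in the inverse Gram matrix. -/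
lemma condLeOne_mixture [IsProbabilityMeasure P] (hm : m ≤ mΨ)
    {e : Ψ → ℝ} (he : Measurable e)
    (h : ∀ s : ℝ, CondLeOne P m fun ω => ENNReal.ofReal (Real.exp (s * e ω - s ^ 2 / 2)))
    {a w : Ψ → ℝ} (ha : Measurable[m] a) (hw : Measurable[m] w) :
    CondLeOne P m fun ω => ENNReal.ofReal
      (Real.exp ((2 * e ω * a ω + e ω ^ 2 * w ω ^ 2 - a ω ^ 2) / (2 * (1 + w ω ^ 2))) /
        √(1 + w ω ^ 2)) := by
  intro g hg
  have hg' : Measurable g := hg.mono hm le_rfl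
  have ha' : Measurable a := ha.mono hm le_rfl
  have hw' : Measurable w := hw.mono hm le_rfl
  simp_rw [← lintegral_gaussian_exp]
  calc ∫⁻ ω, g ω * ∫⁻ z, ENNReal.ofReal (Real.exp ((a ω + w ω * z) * e ω -
        (a ω + w ω * z) ^ 2 / 2)) ∂(gaussianReal 0 1) ∂P
      = ∫⁻ ω, ∫⁻ z, g ω * ENNReal.ofReal (Real.exp ((a ω + w ω * z) * e ω -
        (a ω + w ω * z) ^ 2 / 2)) ∂(gaussianReal 0 1) ∂P := by
        refine lintegral_congr fun ω => ?_
        rw [lintegral_const_mul _ (by fun_prop)]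
    _ = ∫⁻ z, ∫⁻ ω, g ω * ENNReal.ofReal (Real.exp ((a ω + w ω * z) * e ω -
        (a ω + w ω * z) ^ 2 / 2)) ∂P ∂(gaussianReal 0 1) := by
        refine lintegral_lintegral_swap (Measurable.aemeasurable ?_)
        fun_prop
    _ ≤ ∫⁻ _z, (∫⁻ ω, g ω ∂P) ∂(gaussianReal 0 1) := by
        refine lintegral_mono fun z => ?_
        exact condLeOne_exp_of_forall hm he h (s := fun ω => a ω + w ω * z)
          (ha.add (hw.mul_const z)) g hg
    _ = ∫⁻ ω, g ω ∂P := by simp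

end Mixture

/-! ### Concentration: self-normalized martingales and bounded differences -/

section MatrixMeasurability

open Matrix

variable {Ψ : Type*} [MeasurableSpace Ψ] {D : ℕ}

lemma measurable_det {G : Ψ → Matrix (Fin D) (Fin D) ℝ} (hG : ∀ i j, Measurable fun ω => G ω i j) :
    Measurable fun ω => (G ω).det := by
  have h : Continuous fun A : Fin D → Fin D → ℝ => (Matrix.of A).det :=
    Continuous.matrix_det continuous_id
  exact h.measurable.comp (measurable_pi_lambda (fun ω i j => G ω i j)
    fun i => measurable_pi_lambda _ fun j => hG i j)

lemma measurable_inv_apply {G : Ψ → Matrix (Fin D) (Fin D) ℝ}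
    (hG : ∀ i j, Measurable fun ω => G ω i j) (i j : Fin D) :
    Measurable fun ω => (G ω)⁻¹ i j := by
  have h : Continuous fun A : Fin D → Fin D → ℝ => (Matrix.of A).adjugate i j :=
    (Continuous.matrix_adjugate continuous_id).matrix_elem i j
  have h1 : Measurable fun ω => (G ω).adjugate i j :=
    h.measurable.comp (measurable_pi_lambda (fun ω i j => G ω i j)
      fun i => measurable_pi_lambda _ fun j => hG i j)
  simp_rw [Matrix.inv_def, Matrix.smul_apply, smul_eq_mul, Ring.inverse_eq_inv']
  exact (measurable_det hG).inv.mul h1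

lemma measurable_dotProduct {u v : Ψ → Fin D → ℝ} (hu : Measurable u) (hv : Measurable v) :
    Measurable fun ω => u ω ⬝ᵥ v ω := by
  unfold dotProduct
  exact Finset.measurable_sum _ fun i _ => by fun_prop

lemma measurable_mulVec_inv {G : Ψ → Matrix (Fin D) (Fin D) ℝ}
    (hG : ∀ i j, Measurable fun ω => G ω i j) {v : Ψ → Fin D → ℝ} (hv : Measurable v) :
    Measurable fun ω => (G ω)⁻¹ *ᵥ v ω := by
  refine measurable_pi_lambda _ fun i => ?_
  unfold mulVec dotProduct
  exact Finset.measurable_sum _ fun j _ => (measurable_inv_apply hG i j).mul (by fun_prop)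

lemma measurable_invForm {G : Ψ → Matrix (Fin D) (Fin D) ℝ}
    (hG : ∀ i j, Measurable fun ω => G ω i j) {u v : Ψ → Fin D → ℝ} (hu : Measurable u)
    (hv : Measurable v) : Measurable fun ω => invForm (G ω) (u ω) (v ω) :=
  measurable_dotProduct hu (measurable_mulVec_inv hG hv)

lemma measurable_mahalanobis {G : Ψ → Matrix (Fin D) (Fin D) ℝ}
    (hG : ∀ i j, Measurable fun ω => G ω i j) {u : Ψ → Fin D → ℝ} (hu : Measurable u) :
    Measurable fun ω => mahalanobis (G ω) (u ω) :=
  (measurable_invForm hG hu hu).sqrt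

lemma measurable_gram_apply (lam : ℝ) {φ : ℕ → Ψ → Fin D → ℝ} {t : ℕ}
    (hφ : ∀ s < t, Measurable (φ s)) (i j : Fin D) :
    Measurable fun ω => gram lam (fun s => φ s ω) t i j := by
  simp only [gram, Matrix.add_apply, Matrix.sum_apply, vecMulVec_apply]
  refine measurable_const.add (Finset.measurable_sum _ fun s hs => ?_)
  have := hφ s (Finset.mem_range.1 hs)
  fun_prop

lemma measurable_sum_smul {c : ℕ → Ψ → ℝ} {φ : ℕ → Ψ → Fin D → ℝ} {t : ℕ}
    (hc : ∀ s < t, Measurable (c s)) (hφ : ∀ s < t, Measurable (φ s)) :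
    Measurable fun ω => ∑ s ∈ Finset.range t, c s ω • φ s ω :=
  Finset.measurable_sum _ fun s hs =>
    (hc s (Finset.mem_range.1 hs)).smul (hφ s (Finset.mem_range.1 hs))

/-- The scale of the sampling distribution depends measurably on the features. -/
lemma measurable_width (R B lam δ ε : ℝ) {φ : ℕ → Ψ → Fin D → ℝ} {t : ℕ}
    (hφ : ∀ s < t, Measurable (φ s)) :
    Measurable fun ω => width R B lam δ ε (fun s => φ s ω) t := by
  unfold width beta psi
  refine Measurable.add (Measurable.add (measurable_const.mul (Measurable.sqrt
    (Measurable.log (Measurable.div_const (measurable_det fun i j => ?_) _)))) measurable_const)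
    (measurable_const.mul (Finset.measurable_sum _ fun s hs => ?_))
  · simp only [Matrix.smul_apply, smul_eq_mul]
    exact (measurable_gram_apply lam hφ i j).const_mul _
  · have := Finset.mem_range.1 hs
    exact measurable_mahalanobis (measurable_gram_apply lam fun r hr => hφ r (by omega)) (hφ s this)

end MatrixMeasurability

section SelfNormalized

open scoped ENNReal

variable {Ψ : Type*} {mΨ : MeasurableSpace Ψ} {P : Measure Ψ} [IsProbabilityMeasure P]
  {m : ℕ → MeasurableSpace Ψ} {n D : ℕ}

/-- How `‖S‖²` in the norm of the inverse Gram matrix changes in one round. -/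
lemma invForm_gram_succ_add {lam : ℝ} (hl : 0 < lam) (φ : ℕ → Fin D → ℝ) (t : ℕ)
    (S : Fin D → ℝ) (e : ℝ) :
    invForm (gram lam φ (t + 1)) (S + e • φ t) (S + e • φ t) = invForm (gram lam φ t) S S +
      (2 * e * invForm (gram lam φ t) (φ t) S + e ^ 2 * mahalanobis (gram lam φ t) (φ t) ^ 2
        - invForm (gram lam φ t) (φ t) S ^ 2) / (1 + mahalanobis (gram lam φ t) (φ t) ^ 2) := by
  have hM := gram_posDef hl φ t
  have hc := invForm_comm hM S (φ t)
  have hpos : 0 < 1 + invForm (gram lam φ t) (φ t) (φ t) := by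
    linarith [invForm_self_nonneg hM (φ t)]
  rw [mahalanobis_sq hM, invForm_gram_succ hl]
  have h1 : ∀ u, invForm (gram lam φ t) (S + e • φ t) u =
      invForm (gram lam φ t) S u + e * invForm (gram lam φ t) (φ t) u := fun u => by
    rw [invForm_comm hM, invForm_add_right, invForm_smul_right, invForm_comm hM u,
      invForm_comm hM u]
  rw [h1, h1, invForm_add_right, invForm_add_right, invForm_smul_right, invForm_smul_right, hc]
  field_simp
  ring

/-- The supermartingale is `exp (‖S_t‖² / 2) / √(det (λ⁻¹ A_t))`, where `S_t` is the accumulated noise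
divided by `R` and `‖·‖` is the norm of `A_t⁻¹`. Its factors are Gaussian mixtures of the exponential
supermartingales of the noise. -/
lemma measure_selfNormalized_of_pos (hmono : Monotone m) (hle : ∀ t ≤ n, m t ≤ mΨ)
    {φ : ℕ → Ψ → Fin D → ℝ} (hφ : ∀ t < n, Measurable[m t] (φ t)) {η : ℕ → Ψ → ℝ}
    (hη : ∀ t < n, Measurable[m (t + 1)] (η t)) {R : ℝ} (hR : 0 < R)
    (hsub : ∀ t < n, ∀ s : ℝ, CondLeOne P (m t) fun ω =>
      ENNReal.ofReal (Real.exp (s * η t ω - s ^ 2 * R ^ 2 / 2)))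
    {lam δ : ℝ} (hl : 0 < lam) (hδ : 0 < δ) :
    P {ω | ∃ t ≤ n, R * √(Real.log ((lam⁻¹ • gram lam (fun s => φ s ω) t).det / δ ^ 2)) <
      mahalanobis (gram lam (fun s => φ s ω) t) (∑ s ∈ Finset.range t, η s ω • φ s ω)} ≤
      ENNReal.ofReal δ := by
  set A : ℕ → Ψ → Matrix (Fin D) (Fin D) ℝ := fun t ω => gram lam (fun s => φ s ω) t with hA
  set S : ℕ → Ψ → Fin D → ℝ := fun t ω => ∑ s ∈ Finset.range t, (η s ω / R) • φ s ω with hS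
  have hApos : ∀ t ω, (A t ω).PosDef := fun t ω => gram_posDef hl _ t
  have hdet : ∀ t ω, 1 ≤ (lam⁻¹ • A t ω).det := fun t ω => one_le_det_inv_smul_gram hl _ t
  have hAm : ∀ t ≤ n, ∀ i j, Measurable[m t] fun ω => A t ω i j := fun t ht i j =>
    @measurable_gram_apply Ψ (m t) D lam φ t
      (fun s hs => (hφ s (by omega)).mono (hmono hs.le) le_rfl) i j
  have hSm : ∀ t ≤ n, Measurable[m t] (S t) := fun t ht =>
    @measurable_sum_smul Ψ (m t) D (fun s ω => η s ω / R) φ t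
      (fun s hs => ((hη s (by omega)).mono (hmono hs) le_rfl).div_const R)
      (fun s hs => (hφ s (by omega)).mono (hmono hs.le) le_rfl)
  -- the nonnegative supermartingale
  set M : ℕ → Ψ → ℝ≥0∞ := fun t ω => ENNReal.ofReal
    (Real.exp (invForm (A t ω) (S t ω) (S t ω) / 2) / √(lam⁻¹ • A t ω).det) with hMdef
  set Q : ℕ → Ψ → ℝ≥0∞ := fun t ω => ENNReal.ofReal
    (Real.exp ((2 * (η t ω / R) * invForm (A t ω) (φ t ω) (S t ω) +
      (η t ω / R) ^ 2 * mahalanobis (A t ω) (φ t ω) ^ 2 - invForm (A t ω) (φ t ω) (S t ω) ^ 2) /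
      (2 * (1 + mahalanobis (A t ω) (φ t ω) ^ 2))) / √(1 + mahalanobis (A t ω) (φ t ω) ^ 2))
    with hQdef
  have hville := measure_exists_ge_le_inv (P := P) (M := M) (Q := Q) (c := ENNReal.ofReal δ⁻¹)
    hmono hle ?_ ?_ ?_ ?_ ?_ ENNReal.ofReal_ne_top
  · rw [← ENNReal.ofReal_inv_of_pos (inv_pos.2 hδ), inv_inv] at hville
    refine (measure_mono ?_).trans hville
    rintro ω ⟨t, ht, h⟩
    refine ⟨t, ht, ENNReal.ofReal_le_ofReal ?_⟩
    have hSR : ∑ s ∈ Finset.range t, η s ω • φ s ω = R • S t ω := by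
      simp only [hS, Finset.smul_sum, smul_smul]
      exact Finset.sum_congr rfl fun s _ => by rw [mul_div_cancel₀ _ hR.ne']
    rw [hSR, mahalanobis_smul hR.le, mul_lt_mul_iff_right₀ hR] at h
    change √(Real.log ((lam⁻¹ • A t ω).det / δ ^ 2)) < mahalanobis (A t ω) (S t ω) at h
    have hd := hdet t ω
    have hd0 : 0 < (lam⁻¹ • A t ω).det := by linarith
    have h1 := Real.lt_sq_of_sqrt_lt h
    rw [mahalanobis_sq (hApos t ω), Real.log_div hd0.ne' (by positivity), Real.log_pow] at h1
    rw [le_div_iff₀ (Real.sqrt_pos.2 hd0)]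
    have h2 : δ⁻¹ * √(lam⁻¹ • A t ω).det =
        Real.exp (Real.log (lam⁻¹ • A t ω).det / 2 - Real.log δ) := by
      rw [Real.exp_sub, Real.exp_log hδ, ← Real.log_sqrt hd0.le,
        Real.exp_log (Real.sqrt_pos.2 hd0), div_eq_inv_mul]
    rw [h2]
    push_cast at h1
    exact Real.exp_le_exp.2 (by linarith)
  · intro t ht
    have h1 := @measurable_invForm Ψ (m t) D _ (hAm t ht) _ _ (hSm t ht) (hSm t ht)
    have h2 := @measurable_det Ψ (m t) D (fun ω => lam⁻¹ • A t ω)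
      (fun i j => by
        simp only [Matrix.smul_apply, smul_eq_mul]
        exact (hAm t ht i j).const_mul _)
    exact ((Real.measurable_exp.comp (h1.div_const 2)).div h2.sqrt).ennreal_ofReal
  · intro ω
    have : (lam⁻¹ • A 0 ω).det = 1 := det_inv_smul_gram_zero hl _
    have h2 : S 0 ω = 0 := by simp [hS]
    simp only [hMdef]
    rw [this, h2]
    simp [invForm]
  · intro t ht ω
    have h1 : S (t + 1) ω = S t ω + (η t ω / R) • φ t ω := Finset.sum_range_succ _ _
    have h2 : (lam⁻¹ • A (t + 1) ω).det =
      (lam⁻¹ • A t ω).det * (1 + mahalanobis (A t ω) (φ t ω) ^ 2) := det_inv_smul_gram_succ hl _ t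
    have h3 := invForm_gram_succ_add hl (fun s => φ s ω) t (S t ω) (η t ω / R)
    change invForm (A (t + 1) ω) _ _ = invForm (A t ω) _ _ + (2 * _ * invForm (A t ω) _ _ +
      _ * mahalanobis (A t ω) _ ^ 2 - invForm (A t ω) _ _ ^ 2) / (1 + mahalanobis (A t ω) _ ^ 2)
      at h3
    simp only [hMdef, hQdef]
    rw [h1, h2, h3, ← ENNReal.ofReal_mul (by positivity), Real.sqrt_mul (by linarith [hdet t ω]),
      div_mul_div_comm, ← Real.exp_add]
    congr 4
    rw [add_div, div_div, mul_comm (1 + _) (2 : ℝ)]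
  · intro t ht
    refine condLeOne_mixture (hle t ht.le)
      (((hη t ht).mono (hle (t + 1) ht) le_rfl).div_const R) ?_
      (@measurable_invForm Ψ (m t) D _ (hAm t ht.le) _ _ (hφ t ht) (hSm t ht.le))
      (@measurable_mahalanobis Ψ (m t) D _ (hAm t ht.le) _ (hφ t ht))
    intro s
    convert hsub t ht (s / R) using 5 with ω <;> field_simp
  · simpa using hδ

/-- The self-normalized tail bound for vector-valued martingales, by the method of mixtures. -/
lemma measure_selfNormalized (hmono : Monotone m) (hle : ∀ t ≤ n, m t ≤ mΨ)
    {φ : ℕ → Ψ → Fin D → ℝ} (hφ : ∀ t < n, Measurable[m t] (φ t)) {η : ℕ → Ψ → ℝ}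
    (hη : ∀ t < n, Measurable[m (t + 1)] (η t)) {R : ℝ} (hR : 0 ≤ R)
    (hsub : ∀ t < n, ∀ s : ℝ, CondLeOne P (m t) fun ω =>
      ENNReal.ofReal (Real.exp (s * η t ω - s ^ 2 * R ^ 2 / 2)))
    {lam δ : ℝ} (hl : 0 < lam) (hδ : 0 < δ) :
    P {ω | ∃ t ≤ n, R * √(Real.log ((lam⁻¹ • gram lam (fun s => φ s ω) t).det / δ ^ 2)) <
      mahalanobis (gram lam (fun s => φ s ω) t) (∑ s ∈ Finset.range t, η s ω • φ s ω)} ≤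
      ENNReal.ofReal δ := by
  -- the noise is sub-Gaussian for all `r > R`; let `r` tend to `R`
  set E : ℝ → Set Ψ := fun r => {ω | ∃ t ≤ n,
    r * √(Real.log ((lam⁻¹ • gram lam (fun s => φ s ω) t).det / δ ^ 2)) <
      mahalanobis (gram lam (fun s => φ s ω) t) (∑ s ∈ Finset.range t, η s ω • φ s ω)} with hE
  have hr : ∀ r, R < r → P (E r) ≤ ENNReal.ofReal δ := fun r hr => by
    refine measure_selfNormalized_of_pos hmono hle hφ hη (hR.trans_lt hr) (fun t ht s g hg => ?_)
      hl hδ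
    refine (lintegral_mono fun ω => ?_).trans (hsub t ht s g hg)
    refine mul_le_mul_right (ENNReal.ofReal_le_ofReal (Real.exp_le_exp.2 ?_)) _
    have := mul_le_mul_of_nonneg_left (pow_le_pow_left₀ hR hr.le 2) (sq_nonneg s)
    linarith
  have hmonoE : Monotone fun k : ℕ => E (R + 1 / ((k : ℝ) + 1)) := by
    intro k l hkl ω
    rintro ⟨t, ht, h⟩
    refine ⟨t, ht, lt_of_le_of_lt (mul_le_mul_of_nonneg_right ?_ (Real.sqrt_nonneg _)) h⟩
    have : (k : ℝ) ≤ l := by exact_mod_cast hkl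
    gcongr
  have hsub' : E R ⊆ ⋃ k : ℕ, E (R + 1 / ((k : ℝ) + 1)) := by
    rintro ω ⟨t, ht, h⟩
    have hlim : Filter.Tendsto (fun k : ℕ => (R + 1 / ((k : ℝ) + 1)) *
        √(Real.log ((lam⁻¹ • gram lam (fun s => φ s ω) t).det / δ ^ 2))) Filter.atTop
        (nhds ((R + 0) * √(Real.log ((lam⁻¹ • gram lam (fun s => φ s ω) t).det / δ ^ 2)))) :=
      (tendsto_const_nhds.add tendsto_one_div_add_atTop_nhds_zero_nat).mul_const _
    rw [add_zero] at hlim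
    obtain ⟨k, hk⟩ := (hlim.eventually (gt_mem_nhds h)).exists
    exact Set.mem_iUnion.2 ⟨k, t, ht, hk⟩
  refine (measure_mono hsub').trans ?_
  rw [hmonoE.measure_iUnion]
  exact iSup_le fun k => hr _ (by simp; positivity)

end SelfNormalized

section Azuma

open scoped ENNReal

variable {Ψ : Type*} {mΨ : MeasurableSpace Ψ} {P : Measure Ψ} [IsProbabilityMeasure P]
  {m : ℕ → MeasurableSpace Ψ} {n : ℕ}

/-- The Azuma-Hoeffding inequality: by convexity of `exp`, differences bounded by `b` are
sub-Gaussian, and `s` is the optimal parameter of the resulting exponential supermartingale. -/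
lemma measure_sum_gt_le (hmono : Monotone m) (hle : ∀ t ≤ n, m t ≤ mΨ) {ζ : ℕ → Ψ → ℝ}
    (hζ : ∀ t < n, Measurable[m (t + 1)] (ζ t)) {b : ℝ} (hb : 0 < b)
    (hbd : ∀ t < n, ∀ᵐ ω ∂P, |ζ t ω| ≤ b) (h0 : ∀ t < n, P[ζ t | m t] =ᵐ[P] 0)
    (hn : 0 < n) {δ : ℝ} (hδ : 0 < δ) (hδ1 : δ < 1) :
    P {ω | b * √(2 * n * Real.log (1 / δ)) ≤ ∑ t ∈ Finset.range n, ζ t ω} ≤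
      ENNReal.ofReal δ := by
  have hlog : 0 < Real.log (1 / δ) := Real.log_pos ((one_lt_div hδ).2 hδ1)
  have hn' : (0 : ℝ) < n := Nat.cast_pos.2 hn
  set L := √(2 * n * Real.log (1 / δ)) with hL
  have hL2 : L ^ 2 = 2 * n * Real.log (1 / δ) := Real.sq_sqrt (by positivity)
  set s := L / (n * b) with hs
  have hsb : ∀ t < n, CondLeOne P (m t) fun ω =>
      ENNReal.ofReal (Real.exp (s * ζ t ω - s ^ 2 * b ^ 2 / 2)) := by
    intro t ht
    have hζm : Measurable (ζ t) := (hζ t ht).mono (hle (t + 1) ht) le_rfl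
    have hζi : Integrable (ζ t) P := Integrable.of_bound hζm.aestronglyMeasurable b (hbd t ht)
    -- the chord of `exp` over `[-s b, s b]`
    have hpt : ∀ᵐ ω ∂P, Real.exp (s * ζ t ω) ≤
        Real.cosh (s * b) + ζ t ω * (Real.sinh (s * b) / b) := by
      filter_upwards [hbd t ht] with ω hω
      have h1 : |ζ t ω / b| ≤ 1 := by rwa [abs_div, abs_of_pos hb, div_le_one hb]
      have := Real.exp_mul_le_cosh_add_mul_sinh h1 (s * b)
      have h2 : ζ t ω / b * (s * b) = s * ζ t ω := by field_simp
      rw [h2] at this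
      exact this.trans (le_of_eq (by ring))
    have hei : Integrable (fun ω => Real.exp (s * ζ t ω)) P := by
      refine Integrable.of_bound (by fun_prop)
        (Real.exp (|s| * b)) ?_
      filter_upwards [hbd t ht] with ω hω
      rw [Real.norm_eq_abs, abs_of_pos (Real.exp_pos _), Real.exp_le_exp]
      calc s * ζ t ω ≤ |s * ζ t ω| := le_abs_self _
        _ = |s| * |ζ t ω| := abs_mul _ _
        _ ≤ _ := mul_le_mul_of_nonneg_left hω (abs_nonneg _)
    have hce : P[fun ω => Real.exp (s * ζ t ω) | m t] ≤ᵐ[P]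
        fun _ => Real.exp (s ^ 2 * b ^ 2 / 2) := by
      have hm := hle t ht.le
      have h1 := condExp_mono (m := m t) hei ((integrable_const (Real.cosh (s * b))).add
        (hζi.mul_const (Real.sinh (s * b) / b))) hpt
      have h2 := condExp_add (integrable_const (Real.cosh (s * b)))
        (hζi.mul_const (Real.sinh (s * b) / b)) (μ := P) (m t)
      have h3 := condExp_mul_of_stronglyMeasurable_right (m := m t) (μ := P) (f := ζ t)
        (g := fun _ => Real.sinh (s * b) / b) stronglyMeasurable_const
        (hζi.mul_const (Real.sinh (s * b) / b)) hζi
      have h4 := condExp_const (μ := P) hm (Real.cosh (s * b))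
      filter_upwards [h1, h2, h3, h0 t ht] with ω h1 h2 h3 h5
      refine (h1.trans (le_of_eq h2)).trans ?_
      change (P[fun _ => Real.cosh (s * b) | m t]) ω +
        (P[ζ t * (fun _ => Real.sinh (s * b) / b) | m t]) ω ≤ _
      rw [h3, h4, Pi.mul_apply, h5, Pi.zero_apply, zero_mul, add_zero, ← mul_pow]
      exact Real.cosh_le_exp_half_sq _
    exact condLeOne_exp_sub_of_condExp_le (hle t ht.le) hei hce
  have hville := measure_exists_ge_le_inv (P := P) (n := n) (c := ENNReal.ofReal δ⁻¹)
    (M := fun t ω => ENNReal.ofReal (Real.exp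
      (s * (∑ r ∈ Finset.range t, ζ r ω) - t * (s ^ 2 * b ^ 2 / 2))))
    (Q := fun t ω => ENNReal.ofReal (Real.exp (s * ζ t ω - s ^ 2 * b ^ 2 / 2)))
    hmono hle ?_ ?_ ?_ hsb (by simpa using hδ) ENNReal.ofReal_ne_top
  · rw [← ENNReal.ofReal_inv_of_pos (inv_pos.2 hδ), inv_inv] at hville
    refine (measure_mono ?_).trans hville
    intro ω hω
    refine ⟨n, le_rfl, ENNReal.ofReal_le_ofReal ?_⟩
    have h1 : δ⁻¹ = Real.exp (Real.log (1 / δ)) := by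
      rw [Real.exp_log (by positivity), one_div]
    have hs0 : 0 ≤ s := by positivity
    have h2 := mul_le_mul_of_nonneg_left (show b * L ≤ _ from hω) hs0
    have h3 : s * (b * L) - n * (s ^ 2 * b ^ 2 / 2) = Real.log (1 / δ) := by
      have : s * b = L / n := by rw [hs]; field_simp
      have h4 : s * (b * L) - n * (s ^ 2 * b ^ 2 / 2) = (s * b) * L - n * (s * b) ^ 2 / 2 := by ring
      rw [h4, this]
      have : L / n * L - n * (L / n) ^ 2 / 2 = L ^ 2 / (2 * n) := by field_simp; ring
      rw [this, hL2]
      field_simp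
    rw [h1, Real.exp_le_exp]
    linarith
  · intro t ht
    have : Measurable[m t] fun ω => ∑ r ∈ Finset.range t, ζ r ω :=
      Finset.measurable_sum _ fun r hr => by
        have := Finset.mem_range.1 hr
        exact (hζ r (by omega)).mono (hmono this) le_rfl
    exact (Real.measurable_exp.comp ((this.const_mul s).sub_const _)).ennreal_ofReal
  · intro ω; simp
  · intro t ht ω
    rw [← ENNReal.ofReal_mul (Real.exp_pos _).le, ← Real.exp_add, Finset.sum_range_succ]
    congr 2
    push_cast
    ring

end Azuma

/-! ### One round of Thompson Sampling -/

section Sampling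

variable {Ψ : Type*} {m mΨ : MeasurableSpace Ψ} {P : Measure Ψ} [IsProbabilityMeasure P]

/-- If `z (X) + s (X) u`, with `u` standard normal, describes the conditional law of `Z` given
`X`, then it also describes the conditional probabilities of events that involve `X` and `Z`
jointly. -/
lemma condExp_indicator_comap_of_law {β : Type*} {mβ : MeasurableSpace β} {X : Ψ → β}
    (hX : Measurable X) {Z : Ψ → ℝ} (hZ : Measurable Z) {z s : β → ℝ}
    (hlaw : ∀ S : Set ℝ, MeasurableSet S → P⟦Z ⁻¹' S | mβ.comap X⟧ =ᵐ[P] fun ω =>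
      ((gaussianReal 0 1).map fun u => z (X ω) + s (X ω) * u).real S)
    {F : Set (β × ℝ)} (hF : MeasurableSet F) :
    P⟦{ω | (X ω, Z ω) ∈ F} | mβ.comap X⟧ =ᵐ[P] fun ω =>
      (gaussianReal 0 1).real {u | (X ω, z (X ω) + s (X ω) * u) ∈ F} := by
  have hprob : ∀ ω, IsProbabilityMeasure
      ((gaussianReal 0 1).map fun u => z (X ω) + s (X ω) * u) :=
    fun ω => Measure.isProbabilityMeasure_map (by fun_prop)
  -- compare on a countable generating system of intervals
  have hrat : ∀ᵐ ω ∂P, ∀ q : ℚ, (condDistrib Z X P (X ω)).real (Set.Iic (q : ℝ)) =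
      ((gaussianReal 0 1).map fun u => z (X ω) + s (X ω) * u).real (Set.Iic (q : ℝ)) := by
    rw [ae_all_iff]
    intro q
    exact (condDistrib_ae_eq_condExp hX hZ measurableSet_Iic).trans (hlaw _ measurableSet_Iic)
  have hEq : ∀ᵐ ω ∂P, condDistrib Z X P (X ω) =
      (gaussianReal 0 1).map fun u => z (X ω) + s (X ω) * u := by
    filter_upwards [hrat] with ω hω
    have := hprob ω
    refine ext_of_generate_finite _ (BorelSpace.measurable_eq.trans
      Real.borel_eq_generateFrom_Iic_rat) Real.isPiSystem_Iic_rat ?_ (by simp)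
    intro S hS
    obtain ⟨q, rfl⟩ := by simpa using hS
    have h := hω q
    rwa [measureReal_eq_measureReal_iff] at h
  have hFm : MeasurableSet {ω | (X ω, Z ω) ∈ F} := (hX.prodMk hZ) hF
  have h2 := condExp_prod_ae_eq_integral_condDistrib (μ := P) (f := F.indicator fun _ => (1 : ℝ))
    hX hZ.aemeasurable (stronglyMeasurable_const.indicator hF)
    ((integrable_const (1 : ℝ)).indicator hFm)
  refine Filter.EventuallyEq.trans (Filter.EventuallyEq.of_eq ?_) (h2.trans ?_)
  · rfl
  · filter_upwards [hEq] with ω hω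
    have hsec : MeasurableSet {y : ℝ | (X ω, y) ∈ F} := measurable_prodMk_left hF
    have h3 : ∀ y : ℝ, F.indicator (fun _ => (1 : ℝ)) (X ω, y) =
      {y : ℝ | (X ω, y) ∈ F}.indicator (fun _ => (1 : ℝ)) y := fun y => rfl
    simp_rw [h3]
    rw [integral_indicator_const _ hsec, hω, smul_eq_mul, mul_one,
      map_measureReal_apply (by fun_prop) hsec]
    rfl

/-- The version of `condExp_indicator_comap_of_law` for a sub-σ-algebra. -/
lemma condExp_indicator_of_law (hm : m ≤ mΨ) {Z : Ψ → ℝ} (hZ : Measurable Z) {z s : Ψ → ℝ}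
    (hlaw : ∀ S : Set ℝ, MeasurableSet S → P⟦Z ⁻¹' S | m⟧ =ᵐ[P] fun ω =>
      ((gaussianReal 0 1).map fun u => z ω + s ω * u).real S)
    {F : Set (Ψ × ℝ)} (hF : MeasurableSet[m.prod inferInstance] F) :
    P⟦{ω | (ω, Z ω) ∈ F} | m⟧ =ᵐ[P] fun ω =>
      (gaussianReal 0 1).real {u | (ω, z ω + s ω * u) ∈ F} := by
  have h := condExp_indicator_comap_of_law (mβ := m) (X := id) (P := P) (z := z) (s := s)
    (measurable_id'' hm) hZ (by simpa only [MeasurableSpace.comap_id, id] using hlaw) hF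
  simpa only [MeasurableSpace.comap_id, id] using h

end Sampling

/-- The probability that a standard normal variable exceeds one. -/
def upperProb : ℝ := (gaussianReal 0 1).real (Set.Ici 1)

/-- The two-sided tail of the standard normal distribution. -/
def tailProb (κ : ℝ) : ℝ := (gaussianReal 0 1).real {u | κ < |u|}

section OneRound

/-- `measurableSet_le` for a σ-algebra that is found by unification, not by instance search. -/
lemma measurableSet_setOf_le {α : Type*} {m : MeasurableSpace α} {f g : α → ℝ} (hf : Measurable f)
    (hg : Measurable g) : MeasurableSet {a | f a ≤ g a} := measurableSet_le hf hg

/-- `measurableSet_lt` for a σ-algebra that is found by unification, not by instance search. -/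
lemma measurableSet_setOf_lt {α : Type*} {m : MeasurableSpace α} {f g : α → ℝ} (hf : Measurable f)
    (hg : Measurable g) : MeasurableSet {a | f a < g a} := measurableSet_lt hf hg

lemma measurable_finset_inf' {α ι : Type*} {m : MeasurableSpace α} {s : Finset ι}
    (hs : s.Nonempty) {f : ι → α → ℝ} (hf : ∀ i ∈ s, Measurable (f i)) :
    Measurable (s.inf' hs f) :=
  Finset.inf'_induction hs _ (fun _ hf _ hg => hf.inf hg) fun i hi => hf i hi

variable {Ψ : Type*} {m mΨ : MeasurableSpace Ψ} {P : Measure Ψ}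

/-- A function of the played arm is measurable, whatever the σ-algebra on the set of arms, as there
are only finitely many arms. -/
lemma measurable_comp_finite {X β : Type*} [MeasurableSpace β] {Ψ : Type*} [MeasurableSpace Ψ]
    {A : Finset X} {x : Ψ → X} (hxA : ∀ ω, x ω ∈ A)
    (hx : ∀ a ∈ A, MeasurableSet (x ⁻¹' {a})) {f : X → Ψ → β} (hf : ∀ a ∈ A, Measurable (f a)) :
    Measurable fun ω => f (x ω) ω := by
  intro S hS
  have : (fun ω => f (x ω) ω) ⁻¹' S = ⋃ a ∈ A, x ⁻¹' {a} ∩ f a ⁻¹' S := by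
    ext ω
    simp only [Set.mem_preimage, Set.mem_iUnion, Set.mem_inter_iff, Set.mem_singleton_iff]
    constructor
    · intro h; exact ⟨x ω, hxA ω, rfl, h⟩
    · rintro ⟨a, _, rfl, h⟩; exact h
  rw [this]
  exact Finset.measurableSet_biUnion A fun a ha => (hx a ha).inter (hf a ha hS)

variable [IsProbabilityMeasure P]

lemma integrable_of_measurable_of_abs_le {f : Ψ → ℝ} (hf : Measurable f) {C : ℝ}
    (h : ∀ ω, |f ω| ≤ C) : Integrable f P :=
  Integrable.of_bound hf.aestronglyMeasurable C (Filter.Eventually.of_forall h)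

/-- One round of Thompson Sampling. As long as the estimate is accurate, the conditional expected
gap of the played arm is controlled by the conditional expected width of the played arm: the
sample is optimistic with at least constant probability, and then an arm is played whose width
is at least the smallest width among the arms that are not yet known to be bad. -/
lemma condExp_gap_le (hm : m ≤ mΨ) {X : Type*} {A : Finset X} {x : Ψ → X} (hxA : ∀ ω, x ω ∈ A)
    (hx : ∀ a ∈ A, MeasurableSet (x ⁻¹' {a})) {g : X → ℝ} {B : ℝ} (hg : ∀ a ∈ A, |g a| ≤ B)
    {w z Z : X → Ψ → ℝ} {v : Ψ → ℝ} {V : ℝ} (hv0 : ∀ ω, 0 ≤ v ω) (hvV : ∀ ω, v ω ≤ V)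
    (hvm : Measurable[m] v) (hw : ∀ a ∈ A, Measurable[m] (w a)) (hw0 : ∀ a ∈ A, ∀ ω, 0 ≤ w a ω)
    (hw1 : ∀ a ∈ A, ∀ ω, w a ω ≤ 1) (hz : ∀ a ∈ A, Measurable[m] (z a))
    (hZ : ∀ a ∈ A, Measurable (Z a))
    (hlaw : ∀ a ∈ A, ∀ S : Set ℝ, MeasurableSet S → P⟦Z a ⁻¹' S | m⟧ =ᵐ[P] fun ω =>
      ((gaussianReal 0 1).map fun u => z a ω + v ω * w a ω * u).real S)
    (hbest : ∀ ω, ∀ a ∈ A, Z a ω ≤ Z (x ω) ω) {κ : ℝ} (hκ : 0 ≤ κ)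
    (htail : A.card * tailProb κ ≤ upperProb / 2) (hup : 0 < upperProb)
    {a₀ : X} (ha₀ : a₀ ∈ A) {ε : ℝ} (hε : 0 ≤ ε) :
    ∀ᵐ ω ∂P, (∀ a ∈ A, |z a ω - g a| ≤ v ω * w a ω + ε) →
      (P[fun ω => g a₀ - g (x ω) | m]) ω ≤
        (1 + κ) * V * (4 / upperProb + 1) * (P[fun ω => w (x ω) ω | m]) ω + 4 * ε +
          2 * B * (A.card * tailProb κ) := by
  classical
  obtain ⟨ω₀⟩ : Nonempty Ψ := P.nonempty_of_neZero
  have hB : 0 ≤ B := (abs_nonneg _).trans (hg a₀ ha₀)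
  have hV : 0 ≤ V := (hv0 ω₀).trans (hvV ω₀)
  set c := (1 + κ) * V with hc
  have hc0 : 0 ≤ c := mul_nonneg (by linarith) hV
  have hA : A.Nonempty := ⟨a₀, ha₀⟩
  -- accuracy of the estimate, concentration and optimism of the sample
  set G : Set Ψ := {ω | ∀ a ∈ A, |z a ω - g a| ≤ v ω * w a ω + ε} with hG
  set E : X → Set Ψ := fun a => {ω | κ * (v ω * w a ω) < |Z a ω - z a ω|} with hE
  set O : Set Ψ := {ω | z a₀ ω + v ω * w a₀ ω ≤ Z a₀ ω} with hO
  -- the arms that are not yet known to be bad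
  set U : Ψ → X → Prop := fun ω a => g a₀ - g a ≤ c * w a ω + 2 * ε with hU
  set I : Set Ψ := {ω | U ω (x ω)} with hI
  -- the smallest width of such an arm; the value `1` for the other arms is never smaller
  set wJ : Ψ → ℝ := fun ω => A.inf' hA fun a => if U ω a then w a ω else 1 with hwJ
  have hUa₀ : ∀ ω, U ω a₀ := fun ω => by
    have := mul_nonneg hc0 (hw0 a₀ ha₀ ω)
    simp only [hU, sub_self]; linarith
  have hJ : ∀ ω, ∃ J ∈ A, U ω J ∧ w J ω = wJ ω := by
    intro ω
    obtain ⟨J, hJA, hJ⟩ := A.exists_mem_eq_inf' hA fun a => if U ω a then w a ω else 1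
    by_cases h : U ω J
    · exact ⟨J, hJA, h, by rw [hwJ]; simp only [hJ, if_pos h]⟩
    · refine ⟨a₀, ha₀, hUa₀ ω, le_antisymm ?_ ?_⟩
      · rw [hwJ]; simp only [hJ, if_neg h]; exact hw1 a₀ ha₀ ω
      · exact (A.inf'_le _ ha₀).trans (by rw [if_pos (hUa₀ ω)])
  have hwJle : ∀ ω, ∀ a ∈ A, U ω a → wJ ω ≤ w a ω := fun ω a ha h =>
    (A.inf'_le _ ha).trans (by rw [if_pos h])
  have hwJ0 : ∀ ω, 0 ≤ wJ ω := fun ω => by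
    obtain ⟨J, hJA, -, h⟩ := hJ ω; rw [← h]; exact hw0 J hJA ω
  have hwJ1 : ∀ ω, wJ ω ≤ 1 := fun ω => by
    obtain ⟨J, hJA, -, h⟩ := hJ ω; rw [← h]; exact hw1 J hJA ω
  -- measurability
  have hUm : ∀ a ∈ A, MeasurableSet[m] {ω | U ω a} := fun a ha =>
    measurableSet_setOf_le (@measurable_const _ _ _ m _)
      (((hw a ha).const_mul c).add_const _)
  have hwJm : Measurable[m] wJ := by
    have : wJ = A.inf' hA fun a ω => if U ω a then w a ω else 1 := by
      ext ω; rw [Finset.inf'_apply]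
    rw [this]
    exact measurable_finset_inf' hA fun a ha =>
      Measurable.ite (hUm a ha) (hw a ha) (@measurable_const _ _ _ m _)
  have hGm : MeasurableSet[m] G := by
    have : G = ⋂ a ∈ A, {ω | |z a ω - g a| ≤ v ω * w a ω + ε} := by
      ext ω; simp [hG]
    rw [this]
    exact @Finset.measurableSet_biInter Ψ X m _ A fun a ha =>
      measurableSet_setOf_le
        (measurable_abs.comp ((hz a ha).sub_const _)) ((hvm.mul (hw a ha)).add_const _)
  have hv' : Measurable v := hvm.mono hm le_rfl
  have hw' : ∀ a ∈ A, Measurable (w a) := fun a ha => (hw a ha).mono hm le_rfl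
  have hz' : ∀ a ∈ A, Measurable (z a) := fun a ha => (hz a ha).mono hm le_rfl
  have hEm : ∀ a ∈ A, MeasurableSet (E a) := fun a ha =>
    measurableSet_lt ((hv'.mul (hw' a ha)).const_mul κ)
      (measurable_abs.comp ((hZ a ha).sub (hz' a ha)))
  have hOm : MeasurableSet O := measurableSet_le
    ((hz' a₀ ha₀).add (hv'.mul (hw' a₀ ha₀))) (hZ a₀ ha₀)
  have hIm : MeasurableSet I := by
    have h1 : Measurable fun ω => c * w (x ω) ω + 2 * ε :=
      ((measurable_comp_finite hxA hx hw').const_mul c).add_const _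
    have h2 : Measurable fun ω => g a₀ - g (x ω) :=
      measurable_comp_finite hxA hx (f := fun a _ => g a₀ - g a) fun a _ => measurable_const
    exact measurableSet_le h2 h1
  have hWm : Measurable fun ω => w (x ω) ω := measurable_comp_finite hxA hx hw'
  have hΔm : Measurable fun ω => g a₀ - g (x ω) :=
    measurable_comp_finite hxA hx (f := fun a _ => g a₀ - g a) fun a _ => measurable_const
  have hWi : Integrable (fun ω => w (x ω) ω) P := integrable_of_measurable_of_abs_le hWm (C := 1)
    fun ω => by rw [abs_of_nonneg (hw0 _ (hxA ω) ω)]; exact hw1 _ (hxA ω) ω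
  have hΔle : ∀ ω, |g a₀ - g (x ω)| ≤ 2 * B := fun ω =>
    (abs_sub _ _).trans (by linarith [hg a₀ ha₀, hg _ (hxA ω)])
  have hΔi : Integrable (fun ω => g a₀ - g (x ω)) P :=
    integrable_of_measurable_of_abs_le hΔm hΔle
  have hind : ∀ {S : Set Ψ}, MeasurableSet S → Integrable (S.indicator fun _ => (1 : ℝ)) P :=
    fun hS => (integrable_const _).indicator hS
  have hwJi : Integrable wJ P := integrable_of_measurable_of_abs_le (hwJm.mono hm le_rfl) (C := 1)
    fun ω => by rw [abs_of_nonneg (hwJ0 ω)]; exact hwJ1 ω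
  -- probabilities given the past
  have hOp : ∀ᵐ ω ∂P, upperProb ≤ (P⟦O | m⟧) ω := by
    have hF : MeasurableSet[m.prod inferInstance]
        {q : Ψ × ℝ | z a₀ q.1 + v q.1 * w a₀ q.1 ≤ q.2} := by
      refine measurableSet_setOf_le (m := m.prod inferInstance) ?_
        (@measurable_snd Ψ ℝ m _)
      exact ((hz a₀ ha₀).add (hvm.mul (hw a₀ ha₀))).comp (@measurable_fst Ψ ℝ m _)
    filter_upwards [condExp_indicator_of_law hm (hZ a₀ ha₀) (hlaw a₀ ha₀) hF] with ω hω
    refine le_trans ?_ (le_of_eq hω.symm)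
    refine measureReal_mono fun u hu => ?_
    have := mul_le_mul_of_nonneg_left (Set.mem_Ici.1 hu) (mul_nonneg (hv0 ω) (hw0 a₀ ha₀ ω))
    change z a₀ ω + v ω * w a₀ ω ≤ z a₀ ω + v ω * w a₀ ω * u
    linarith
  have hEp : ∀ᵐ ω ∂P, ∀ a ∈ A, (P⟦E a | m⟧) ω ≤ tailProb κ := by
    rw [Filter.eventually_all_finset]
    intro a ha
    have hF : MeasurableSet[m.prod inferInstance]
        {q : Ψ × ℝ | κ * (v q.1 * w a q.1) < |q.2 - z a q.1|} := by
      refine measurableSet_setOf_lt (m := m.prod inferInstance) ?_ ?_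
      · exact ((hvm.mul (hw a ha)).const_mul κ).comp (@measurable_fst Ψ ℝ m _)
      · exact measurable_abs.comp ((@measurable_snd Ψ ℝ m _).sub
          ((hz a ha).comp (@measurable_fst Ψ ℝ m _)))
    filter_upwards [condExp_indicator_of_law hm (hZ a ha) (hlaw a ha) hF] with ω hω
    refine (le_of_eq hω).trans (measureReal_mono fun u hu => ?_)
    change κ * (v ω * w a ω) < |z a ω + v ω * w a ω * u - z a ω| at hu
    have h0 := mul_nonneg (hv0 ω) (hw0 a ha ω)
    rw [add_sub_cancel_left, abs_mul, abs_of_nonneg h0, mul_comm κ] at hu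
    exact lt_of_mul_lt_mul_left hu h0
  -- pointwise inequalities
  -- an optimistic and concentrated sample leads to an arm that is not yet known to be bad
  have hle_ind : ∀ ω, O.indicator (fun _ => (1 : ℝ)) ω ≤ I.indicator (fun _ => (1 : ℝ)) ω +
      ∑ a ∈ A, (E a).indicator (fun _ => (1 : ℝ)) ω + Gᶜ.indicator (fun _ => (1 : ℝ)) ω := by
    intro ω
    have hn1 : 0 ≤ I.indicator (fun _ => (1 : ℝ)) ω := Set.indicator_nonneg (by simp) _
    have hn2 : ∀ a ∈ A, 0 ≤ (E a).indicator (fun _ => (1 : ℝ)) ω :=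
      fun a _ => Set.indicator_nonneg (by simp) _
    have hn3 : 0 ≤ Gᶜ.indicator (fun _ => (1 : ℝ)) ω := Set.indicator_nonneg (by simp) _
    have hn4 := Finset.sum_nonneg hn2
    by_cases hωG : ω ∈ G
    swap
    · have h1 : O.indicator (fun _ => (1 : ℝ)) ω ≤ 1 := Set.indicator_le_self' (by simp) ω
      rw [Set.indicator_of_mem (show ω ∈ Gᶜ from hωG)]; linarith
    by_cases hωE : ∃ a ∈ A, ω ∈ E a
    · obtain ⟨a, ha, hE⟩ := hωE
      have h1 : O.indicator (fun _ => (1 : ℝ)) ω ≤ 1 := Set.indicator_le_self' (by simp) ω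
      have h2 := Finset.single_le_sum hn2 ha
      rw [Set.indicator_of_mem hE] at h2
      linarith
    have hωE : ∀ a ∈ A, |Z a ω - z a ω| ≤ κ * (v ω * w a ω) := fun a ha =>
      not_lt.1 fun h => hωE ⟨a, ha, h⟩
    by_cases hωO : ω ∈ O
    swap
    · rw [Set.indicator_of_notMem hωO]; linarith
    have hωI : ω ∈ I := by
      by_contra hne
      have h1 : c * w (x ω) ω + 2 * ε < g a₀ - g (x ω) := not_le.1 hne
      have h2 := abs_le.1 (hωG (x ω) (hxA ω))
      have h3 := abs_le.1 (hωG a₀ ha₀)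
      have h4 := abs_le.1 (hωE (x ω) (hxA ω))
      have h5 := hbest ω a₀ ha₀
      have h6 : z a₀ ω + v ω * w a₀ ω ≤ Z a₀ ω := hωO
      have h7 : (1 + κ) * (v ω * w (x ω) ω) ≤ c * w (x ω) ω := by
        rw [hc, mul_assoc (1 + κ)]
        exact mul_le_mul_of_nonneg_left (mul_le_mul_of_nonneg_right (hvV ω) (hw0 _ (hxA ω) ω))
          (by linarith)
      nlinarith
    rw [Set.indicator_of_mem hωO, Set.indicator_of_mem hωI]; linarith
  have hWI : ∀ ω, wJ ω * I.indicator (fun _ => (1 : ℝ)) ω ≤ w (x ω) ω := by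
    intro ω
    by_cases h : ω ∈ I
    · rw [Set.indicator_of_mem h, mul_one]; exact hwJle ω _ (hxA ω) h
    · rw [Set.indicator_of_notMem h, mul_zero]; exact hw0 _ (hxA ω) ω
  -- compare the played arm with the arm of smallest width that is not yet known to be bad
  have hΔ : ∀ ω, g a₀ - g (x ω) ≤ 2 * c * wJ ω + c * w (x ω) ω + 4 * ε +
      2 * B * (∑ a ∈ A, (E a).indicator (fun _ => (1 : ℝ)) ω) +
      2 * B * Gᶜ.indicator (fun _ => (1 : ℝ)) ω := by
    intro ω
    have hn2 : ∀ a ∈ A, 0 ≤ (E a).indicator (fun _ => (1 : ℝ)) ω :=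
      fun a _ => Set.indicator_nonneg (by simp) _
    have hn3 : 0 ≤ 2 * B * Gᶜ.indicator (fun _ => (1 : ℝ)) ω :=
      mul_nonneg (by linarith) (Set.indicator_nonneg (by simp) _)
    have hn4 : 0 ≤ 2 * B * (∑ a ∈ A, (E a).indicator (fun _ => (1 : ℝ)) ω) :=
      mul_nonneg (by linarith) (Finset.sum_nonneg hn2)
    have hn5 := mul_nonneg hc0 (hwJ0 ω)
    have hn6 := mul_nonneg hc0 (hw0 _ (hxA ω) ω)
    have hle := (abs_le.1 (hΔle ω)).2
    by_cases hωG : ω ∈ G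
    swap
    · rw [Set.indicator_of_mem (show ω ∈ Gᶜ from hωG)]; linarith
    by_cases hωE : ∃ a ∈ A, ω ∈ E a
    · obtain ⟨a, ha, hE⟩ := hωE
      have h2 := Finset.single_le_sum hn2 ha
      rw [Set.indicator_of_mem hE] at h2
      have := mul_le_mul_of_nonneg_left h2 (by linarith : 0 ≤ 2 * B)
      linarith
    have hωE : ∀ a ∈ A, |Z a ω - z a ω| ≤ κ * (v ω * w a ω) := fun a ha =>
      not_lt.1 fun h => hωE ⟨a, ha, h⟩
    obtain ⟨J, hJA, hUJ, hJw⟩ := hJ ω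
    have h1 : g a₀ - g J ≤ c * w J ω + 2 * ε := hUJ
    have h2 := abs_le.1 (hωG (x ω) (hxA ω))
    have h3 := abs_le.1 (hωG J hJA)
    have h4 := abs_le.1 (hωE (x ω) (hxA ω))
    have h4' := abs_le.1 (hωE J hJA)
    have h5 := hbest ω J hJA
    have h7 : ∀ a ∈ A, (1 + κ) * (v ω * w a ω) ≤ c * w a ω := fun a ha => by
      rw [hc, mul_assoc (1 + κ)]
      exact mul_le_mul_of_nonneg_left (mul_le_mul_of_nonneg_right (hvV ω) (hw0 a ha ω))
        (by linarith)
    have h8 := h7 J hJA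
    have h9 := h7 _ (hxA ω)
    rw [← hJw]
    nlinarith
  -- conditional expectations
  have hsumi : Integrable (fun ω => ∑ a ∈ A, (E a).indicator (fun _ => (1 : ℝ)) ω) P :=
    integrable_finsetSum _ fun a ha => hind (hEm a ha)
  have hsum : ∀ᵐ ω ∂P, (P[fun ω => ∑ a ∈ A, (E a).indicator (fun _ => (1 : ℝ)) ω | m]) ω ≤
      A.card * tailProb κ := by
    have h1 := condExp_finsetSum (μ := P) (m := m) (s := A)
      (f := fun a => (E a).indicator (fun _ => (1 : ℝ))) (fun a ha => hind (hEm a ha))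
    have h2 : (∑ a ∈ A, (E a).indicator (fun _ => (1 : ℝ))) =
      fun ω => ∑ a ∈ A, (E a).indicator (fun _ => (1 : ℝ)) ω := by ext ω; simp
    rw [h2] at h1
    filter_upwards [h1, hEp] with ω h1 h3
    rw [h1, Finset.sum_apply]
    exact (Finset.sum_le_card_nsmul A _ _ h3).trans (by rw [nsmul_eq_mul])
  have hGi : Integrable (Gᶜ.indicator fun _ => (1 : ℝ)) P := hind (hm _ hGm.compl)
  have hGc : P[Gᶜ.indicator (fun _ => (1 : ℝ)) | m] = Gᶜ.indicator fun _ => (1 : ℝ) :=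
    condExp_of_stronglyMeasurable hm
      (((@stronglyMeasurable_const _ _ m _ (1 : ℝ))).indicator hGm.compl) hGi
  have hwJc : P[wJ | m] = wJ := condExp_of_stronglyMeasurable hm hwJm.stronglyMeasurable hwJi
  have hI1 : ∀ᵐ ω ∂P, (P⟦O | m⟧) ω ≤ (P⟦I | m⟧) ω + A.card * tailProb κ +
      Gᶜ.indicator (fun _ => (1 : ℝ)) ω := by
    have h1 := condExp_mono (m := m) (hind hOm) (((hind hIm).add hsumi).add hGi)
      (Filter.Eventually.of_forall hle_ind)
    have h2 := condExp_add ((hind hIm).add hsumi) hGi m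
    have h3 := condExp_add (hind hIm) hsumi m
    filter_upwards [h1, h2, h3, hsum] with ω h1 h2 h3 h4
    refine h1.trans ((le_of_eq h2).trans ?_)
    rw [Pi.add_apply, h3, hGc, Pi.add_apply]
    linarith
  have hI2 : ∀ᵐ ω ∂P, wJ ω * (P⟦I | m⟧) ω ≤ (P[fun ω => w (x ω) ω | m]) ω := by
    have hprod : Integrable (wJ * I.indicator fun _ => (1 : ℝ)) P :=
      (hind hIm).bdd_mul (c := 1) (hwJm.mono hm le_rfl).aestronglyMeasurable
        (Filter.Eventually.of_forall fun ω => by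
          rw [Real.norm_eq_abs, abs_of_nonneg (hwJ0 ω)]; exact hwJ1 ω)
    have h1 := condExp_mono (m := m) hprod hWi (Filter.Eventually.of_forall hWI)
    have h2 := condExp_mul_of_stronglyMeasurable_left (m := m) (μ := P)
      hwJm.stronglyMeasurable hprod (hind hIm)
    filter_upwards [h1, h2] with ω h1 h2
    exact (le_of_eq h2.symm).trans h1
  have hΔ1 : ∀ᵐ ω ∂P, (P[fun ω => g a₀ - g (x ω) | m]) ω ≤ 2 * c * wJ ω +
      c * (P[fun ω => w (x ω) ω | m]) ω + 4 * ε + 2 * B * (A.card * tailProb κ) +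
      2 * B * Gᶜ.indicator (fun _ => (1 : ℝ)) ω := by
    have i1 : Integrable (fun ω => 2 * c * wJ ω) P := hwJi.const_mul _
    have i2 : Integrable (fun ω => c * w (x ω) ω) P := hWi.const_mul _
    have i3 : Integrable (fun _ : Ψ => 4 * ε) P := integrable_const _
    have i4 : Integrable (fun ω => 2 * B * ∑ a ∈ A, (E a).indicator (fun _ => (1 : ℝ)) ω) P :=
      hsumi.const_mul _
    have i5 : Integrable (fun ω => 2 * B * Gᶜ.indicator (fun _ => (1 : ℝ)) ω) P :=
      hGi.const_mul _
    have h1 := condExp_mono (m := m) hΔi ((((i1.add i2).add i3).add i4).add i5)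
      (Filter.Eventually.of_forall hΔ)
    have h2 := condExp_add (((i1.add i2).add i3).add i4) i5 m
    have h3 := condExp_add ((i1.add i2).add i3) i4 m
    have h4 := condExp_add (i1.add i2) i3 m
    have h5 := condExp_add i1 i2 m
    have s1 := condExp_smul (μ := P) (2 * c) wJ m
    have s2 := condExp_smul (μ := P) c (fun ω => w (x ω) ω) m
    have s3 := condExp_const (μ := P) hm (4 * ε)
    have s4 := condExp_smul (μ := P) (2 * B)
      (fun ω => ∑ a ∈ A, (E a).indicator (fun _ => (1 : ℝ)) ω) m
    have s5 := condExp_smul (μ := P) (2 * B) (Gᶜ.indicator (fun _ => (1 : ℝ))) m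
    filter_upwards [h1, h2, h3, h4, h5, s1, s2, s4, s5, hsum] with ω h1 h2 h3 h4 h5 s1 s2 s4 s5 h6
    refine h1.trans ((le_of_eq h2).trans ?_)
    rw [Pi.add_apply, h3, Pi.add_apply, h4, Pi.add_apply, h5, Pi.add_apply, s3]
    have e1 : (P[fun ω => 2 * c * wJ ω | m]) ω = 2 * c * wJ ω := by
      refine s1.trans ?_
      rw [Pi.smul_apply, hwJc, smul_eq_mul]
    have e5 : (P[fun ω => 2 * B * Gᶜ.indicator (fun _ => (1 : ℝ)) ω | m]) ω =
        2 * B * Gᶜ.indicator (fun _ => (1 : ℝ)) ω := by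
      refine s5.trans ?_
      rw [Pi.smul_apply, hGc, smul_eq_mul]
    have e2 : (P[fun ω => c * w (x ω) ω | m]) ω = c * (P[fun ω => w (x ω) ω | m]) ω := s2
    have e4 : (P[fun ω => 2 * B * ∑ a ∈ A, (E a).indicator (fun _ => (1 : ℝ)) ω | m]) ω =
      2 * B * (P[fun ω => ∑ a ∈ A, (E a).indicator (fun _ => (1 : ℝ)) ω | m]) ω := s4
    rw [e1, e2, e4, e5]
    have := mul_le_mul_of_nonneg_left h6 (by linarith : 0 ≤ 2 * B)
    linarith
  filter_upwards [hOp, hI1, hI2, hΔ1] with ω h1 h2 h3 h4 hωG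
  have h5 : Gᶜ.indicator (fun _ => (1 : ℝ)) ω = 0 :=
    Set.indicator_of_notMem (Set.notMem_compl_iff.2 (show ω ∈ G from hωG)) _
  rw [h5] at h2 h4
  -- hence the smallest width is at most a constant multiple of the expected width of the played arm
  have h6 : upperProb / 2 ≤ (P⟦I | m⟧) ω := by linarith
  have h7 : wJ ω * (upperProb / 2) ≤ (P[fun ω => w (x ω) ω | m]) ω :=
    (mul_le_mul_of_nonneg_left h6 (hwJ0 ω)).trans h3
  have h8 : wJ ω ≤ 2 / upperProb * (P[fun ω => w (x ω) ω | m]) ω := by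
    rw [div_mul_eq_mul_div, le_div_iff₀ hup]
    linarith
  have h9 := mul_le_mul_of_nonneg_left h8 hc0
  have h10 : c * (4 / upperProb + 1) * (P[fun ω => w (x ω) ω | m]) ω =
      2 * (c * (2 / upperProb * (P[fun ω => w (x ω) ω | m]) ω)) +
      c * (P[fun ω => w (x ω) ω | m]) ω := by ring
  rw [h10]
  linarith

end OneRound

/-! ### The normal distribution -/

section GaussianFacts

lemma upperProb_pos : 0 < upperProb := by
  have h : gaussianReal 0 1 (Set.Ici 1) ≠ 0 := by
    intro h
    have := gaussianReal_absolutelyContinuous' 0 one_ne_zero h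
    simp at this
  exact ENNReal.toReal_pos h (measure_ne_top _ _)

lemma upperProb_le_one : upperProb ≤ 1 := measureReal_le_one

/-- The Chernoff bound for both tails. -/
lemma tailProb_le {κ : ℝ} (hκ : 0 ≤ κ) : tailProb κ ≤ 2 * Real.exp (-κ ^ 2 / 2) := by
  have h1 : ∀ X : ℝ → ℝ, (gaussianReal 0 1).map X = gaussianReal 0 1 → Measurable X →
      (gaussianReal 0 1).real {u | κ ≤ X u} ≤ Real.exp (-κ ^ 2 / 2) := by
    intro X hX hXm
    have hid : (gaussianReal 0 1).real {u | κ ≤ X u} = (gaussianReal 0 1).real {u | κ ≤ id u} := by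
      have h := map_measureReal_apply (μ := gaussianReal 0 1) hXm (measurableSet_Ici (a := κ))
      rw [hX] at h
      exact h.symm
    rw [hid]
    refine (measure_ge_le_exp_mul_mgf (X := id) (t := κ) κ hκ
      (integrable_exp_mul_gaussianReal κ)).trans (le_of_eq ?_)
    rw [mgf_id_gaussianReal, ← Real.exp_add]
    congr 1
    simp only [NNReal.coe_one]
    ring
  have h2 : {u : ℝ | κ < |u|} ⊆ {u | κ ≤ id u} ∪ {u | κ ≤ -u} := by
    intro u hu
    rcases lt_abs.1 (show κ < |u| from hu) with h | h
    · exact Or.inl h.le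
    · exact Or.inr h.le
  have h3 := h1 id Measure.map_id measurable_id
  have h4 := h1 (fun u => -u) (by rw [gaussianReal_map_neg, neg_zero]) measurable_neg
  refine (measureReal_mono h2).trans ((measureReal_union_le _ _).trans ?_)
  linarith

open Matrix

/-- One-dimensional marginals of the sampling distribution. -/
lemma multivariateGaussian_map_dotProduct {D : ℕ} {M : Matrix (Fin D) (Fin D) ℝ} (hM : M.PosDef)
    (θ u : Fin D → ℝ) (v : ℝ) :
    (multivariateGaussian (WithLp.toLp 2 θ) (v ^ 2 • M⁻¹)).map
        (fun μ => WithLp.ofLp μ ⬝ᵥ u) =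
      (gaussianReal 0 1).map fun z => θ ⬝ᵥ u + v * mahalanobis M u * z := by
  have hS : (v ^ 2 • M⁻¹).PosSemidef := hM.inv.posSemidef.smul (sq_nonneg v)
  set L : StrongDual ℝ (EuclideanSpace ℝ (Fin D)) := innerSL ℝ (WithLp.toLp 2 u) with hL
  have hLfun : (fun μ : EuclideanSpace ℝ (Fin D) => WithLp.ofLp μ ⬝ᵥ u) = L := by
    ext μ
    simp [hL, EuclideanSpace.inner_eq_star_dotProduct]
  have hcov : Var[L; multivariateGaussian (WithLp.toLp 2 θ) (v ^ 2 • M⁻¹)] =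
      (v * mahalanobis M u) ^ 2 := by
    have h1 := covarianceBilin_multivariateGaussian (μ := WithLp.toLp 2 θ) hS
      (WithLp.toLp 2 u) (WithLp.toLp 2 u)
    rw [covarianceBilin_self IsGaussian.memLp_two_id] at h1
    rw [mul_pow, mahalanobis_sq hM, invForm]
    refine Eq.trans ?_ (h1.trans ?_)
    · rfl
    · simp [smul_mulVec, dotProduct_smul]
  rw [hLfun, IsGaussian.map_eq_gaussianReal, hcov, L.integral_comp_id_comm IsGaussian.integrable_id,
    integral_id_multivariateGaussian]
  have h2 : (fun z : ℝ => θ ⬝ᵥ u + v * mahalanobis M u * z) =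
      (fun z => θ ⬝ᵥ u + z) ∘ fun z => v * mahalanobis M u * z := rfl
  rw [h2, ← Measure.map_map (by fun_prop) (by fun_prop), gaussianReal_map_const_mul,
    gaussianReal_map_const_add, mul_zero, zero_add]
  congr 1
  rw [mul_one, Real.toNNReal_of_nonneg (sq_nonneg _)]

end GaussianFacts

/-! ### Approximation in the reproducing kernel Hilbert space -/

section Approximation

open scoped RealInnerProductSpace

variable {X : Type*} {K : X → X → ℝ} {ξ : ℕ → X} {A : Finset X} {e : ℝ} {D : ℕ}

/-- Functions in the reproducing kernel Hilbert space are almost linear in the features of the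
P-greedy algorithm, and these features have length at most one. -/
lemma exists_approx (hK : IsKernel K) {H : Type*} [NormedAddCommGroup H] [InnerProductSpace ℝ H]
    [CompleteSpace H] [RKHS ℝ H X ℝ] (hker : ∀ x y, RKHS.kernel H x y 1 = K x y) {f : H} {B : ℝ}
    (hf : ‖f‖ ≤ B) (he : 0 < e) (hξ : IsPGreedy K A e D ξ) :
    (∀ x, dotProduct (feature K ξ D x) (feature K ξ D x) ≤ 1) ∧ (∀ x, |f x| ≤ B) ∧
    ∃ θ : Fin D → ℝ, dotProduct θ θ ≤ B ^ 2 ∧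
      ∀ x ∈ A, |f x - dotProduct θ (feature K ξ D x)| ≤ B * e := by
  have hp := hξ.powerSq_pos hK he
  set u : X → H := fun x => RKHS.kerFun H x 1 with hu
  have huK : ∀ x ∈ Set.univ, ∀ y ∈ Set.univ, ⟪u x, u y⟫ = K x y := by
    intro x _ y _
    have := RKHS.kernel_inner H y x (1 : ℝ) (1 : ℝ)
    rw [← this, hker, hK.symm y x]
    simp
  have hfu : ∀ x, ⟪f, u x⟫ = f x := fun x => by simp [hu, -RKHS.kerFun_inner]
  have hξS : ∀ m < D, ξ m ∈ Set.univ := fun _ _ => Set.mem_univ _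
  have hB : 0 ≤ B := (norm_nonneg f).trans hf
  have hps : ∀ x, powerSq K ξ D x = _ := fun x => powerSq_eq_norm_sq huK hξS hp (Set.mem_univ x)
  have hdot : ∀ x, dotProduct (feature K ξ D x) (feature K ξ D x) =
      ∑ k ∈ Finset.range D, newton K ξ k x ^ 2 := fun x => by
    rw [Finset.sum_range]
    simp [dotProduct, feature, pow_two]
  -- the coefficients of the orthogonal projection of `f` to the span of the selected kernel functions
  refine ⟨fun x => ?_, fun x => ?_, fun k => ⟪newtonVec u K ξ k, f⟫, ?_, fun x hx => ?_⟩
  · have h1 : 0 ≤ powerSq K ξ D x := by rw [hps]; positivity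
    have h2 := hK.diag_le_one x
    rw [powerSq] at h1
    rw [hdot]; linarith
  · have h1 : ‖u x‖ ≤ 1 := by
      have h2 : ‖u x‖ ^ 2 ≤ 1 := by
        rw [← real_inner_self_eq_norm_sq, huK x (Set.mem_univ x) x (Set.mem_univ x)]
        exact hK.diag_le_one x
      exact (sq_le_one_iff₀ (norm_nonneg _)).1 h2
    rw [← hfu x]
    calc |⟪f, u x⟫| ≤ ‖f‖ * ‖u x‖ := abs_real_inner_le_norm _ _
      _ ≤ B * 1 := mul_le_mul hf h1 (norm_nonneg _) hB
      _ = B := mul_one B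
  · have hon : Orthonormal ℝ fun k : Fin D => newtonVec u K ξ k := by
      rw [orthonormal_iff_ite]
      intro i j
      rw [inner_newtonVec_newtonVec huK hξS hp i.isLt j.isLt]
      simp [Fin.ext_iff]
    have h1 := hon.sum_inner_products_le (x := f) (s := Finset.univ)
    refine le_trans (le_of_eq ?_) (h1.trans (pow_le_pow_left₀ (norm_nonneg _) hf 2))
    simp [dotProduct, pow_two]
  · have h1 : f x - dotProduct (fun k : Fin D => ⟪newtonVec u K ξ k, f⟫) (feature K ξ D x) =
        ⟪f, u x - ∑ k ∈ Finset.range D, newton K ξ k x • newtonVec u K ξ k⟫ := by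
      rw [inner_sub_right, hfu, inner_sum, Finset.sum_range, dotProduct]
      congr 1
      refine Finset.sum_congr rfl fun k _ => ?_
      rw [real_inner_smul_right, real_inner_comm, feature, mul_comm]
    rw [h1]
    refine (abs_real_inner_le_norm _ _).trans (mul_le_mul hf ?_ (norm_nonneg _) hB)
    refine le_of_lt (lt_of_pow_lt_pow_left₀ 2 he.le ?_)
    rw [← hps]
    exact hξ.finished x hx

end Approximation

/-! ### The regret for a misspecified linear bandit -/

section History

variable {Ψ X : Type*} {mΨ : MeasurableSpace Ψ} [MeasurableSpace X] {x : ℕ → Ψ → X}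
  {y : ℕ → Ψ → ℝ}

lemma measurable_arm_history {s t : ℕ} (h : s < t) : Measurable[history x y t] (x s) :=
  measurable_fst.comp ((measurable_pi_apply (⟨s, h⟩ : Fin t)).comp
    (comap_measurable fun ω (s : Fin t) => (x s ω, y s ω)))

lemma measurable_reward_history {s t : ℕ} (h : s < t) : Measurable[history x y t] (y s) :=
  measurable_snd.comp ((measurable_pi_apply (⟨s, h⟩ : Fin t)).comp
    (comap_measurable fun ω (s : Fin t) => (x s ω, y s ω)))

lemma history_mono (x : ℕ → Ψ → X) (y : ℕ → Ψ → ℝ) : Monotone (history x y) := by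
  intro s t h
  refine Measurable.comap_le (@measurable_pi_lambda Ψ (Fin s) _ (history x y t) _ _ fun i => ?_)
  exact (measurable_arm_history (i.isLt.trans_le h)).prodMk
    (measurable_reward_history (i.isLt.trans_le h))

/-- Only the rounds before `T` are assumed to be measurable. -/
lemma history_le {T t : ℕ} (hx : ∀ s < T, Measurable (x s)) (hy : ∀ s < T, Measurable (y s))
    (ht : t ≤ T) : history x y t ≤ mΨ :=
  Measurable.comap_le (measurable_pi_lambda _ fun i =>
    (hx i (i.isLt.trans_le ht)).prodMk (hy i (i.isLt.trans_le ht)))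

end History

section Regret

open Matrix

variable {Ψ X : Type*} {mΨ : MeasurableSpace Ψ} [MeasurableSpace X] [MeasurableSingletonClass X]
  {P : Measure Ψ} [IsProbabilityMeasure P]

lemma width_nonneg {R B lam δ ε : ℝ} (hR : 0 ≤ R) (hB : 0 ≤ B) (hε : 0 ≤ ε) {D : ℕ}
    (φ : ℕ → Fin D → ℝ) (t : ℕ) : 0 ≤ width R B lam δ ε φ t :=
  add_nonneg (add_nonneg (mul_nonneg hR (Real.sqrt_nonneg _))
    (mul_nonneg (Real.sqrt_nonneg _) hB)) (mul_nonneg hε (psi_nonneg lam φ t))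

/-- The regret of modified Thompson Sampling for a misspecified linear bandit. Outside of an event of
probability `δ`, split into `δ / 2` for the accuracy of all estimates and `δ / 4` each for the
deviations of the sums of widths and of gaps from their compensators, `condExp_gap_le` is summed over
all rounds. The concentration of the noise refers to the filtration `ℱ`, the sampling to the
filtration of past arms and rewards. -/
lemma measure_regret_gt_le {ℱ : Filtration ℕ mΨ} {g : X → ℝ} {R B lam ε δ : ℝ} {T D : ℕ}
    {x : ℕ → Ψ → X} {y : ℕ → Ψ → ℝ} {μ : ℕ → Ψ → EuclideanSpace ℝ (Fin D)} {φ : X → Fin D → ℝ}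
    {A : Finset X} (hA : A.Nonempty) (hR : 0 ≤ R) (hB : 0 < B) (hl : 1 ≤ lam) (hε : 0 ≤ ε)
    (hδ : 0 < δ) (hδ1 : δ < 1) (hT : 1 ≤ T) (hφ : ∀ a ∈ A, φ a ⬝ᵥ φ a ≤ 1)
    (hg : ∀ a ∈ A, |g a| ≤ B) {θ : Fin D → ℝ} (hθ : θ ⬝ᵥ θ ≤ B ^ 2)
    (hgθ : ∀ a ∈ A, |g a - θ ⬝ᵥ φ a| ≤ ε) (hband : IsBandit P ℱ g R T x y)
    (hTS : IsModifiedTS P A φ lam R B ε δ T x y μ) {κ : ℝ} (hκ : 0 ≤ κ)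
    (htail : A.card * tailProb κ ≤ upperProb / (2 * T)) :
    P {ω | (1 + κ) * (R * √(D * Real.log (1 + T) + 2 * Real.log (2 / δ)) + √lam * B
      + ε * √(T * (2 * (D * Real.log (1 + T))))) * (4 / upperProb + 1) *
      (√(T * (2 * (D * Real.log (1 + T)))) + √(2 * T * Real.log (1 / (δ / 4)))) + 4 * ε * T + B +
      2 * B * √(2 * T * Real.log (1 / (δ / 4))) < regret A hA g T (fun t => x t ω)} ≤
      ENNReal.ofReal δ := by
  have hl0 : 0 < lam := by linarith
  have hT0 : (0 : ℝ) < T := by exact_mod_cast hT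
  have hT1 : (1 : ℝ) ≤ T := by exact_mod_cast hT
  have hup := upperProb_pos
  set V := R * √(D * Real.log (1 + T) + 2 * Real.log (2 / δ)) + √lam * B
      + ε * √(T * (2 * (D * Real.log (1 + T)))) with hV
  have hxA : ∀ t < T, ∀ ω, x t ω ∈ A := fun t ht ω => (hTS.best t ht ω).1
  have hxm : ∀ t < T, Measurable (x t) := fun t ht =>
    (hband.measurable_arm t ht).mono (ℱ.le t) le_rfl
  have hym : ∀ t < T, Measurable (y t) := fun t ht =>
    (hband.measurable_reward t ht).mono (ℱ.le (t + 1)) le_rfl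
  have hHle : ∀ t ≤ T, history x y t ≤ mΨ := fun t ht => history_le hxm hym ht
  have hHmono := history_mono x y
  have hcomp : ∀ {β : Type} [MeasurableSpace β] (f : X → β) (m : MeasurableSpace Ψ), ∀ s < T,
      Measurable[m] (x s) → Measurable[m] fun ω => f (x s ω) := by
    intro β _ f m s hs h
    exact @measurable_comp_finite X β _ Ψ m A (x s) (hxA s hs)
      (fun a _ => h (measurableSet_singleton a)) (fun a _ => f a) fun a _ => measurable_const
  -- the best arm
  obtain ⟨a₀, ha₀, hmax⟩ := A.exists_max_image g hA
  set w : ℕ → X → Ψ → ℝ := fun t a ω => mahalanobis (gram lam (fun s => φ (x s ω)) t) (φ a) with hw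
  set z : ℕ → X → Ψ → ℝ := fun t a ω =>
    thetaHat lam (fun s => φ (x s ω)) (fun s => y s ω) t ⬝ᵥ φ a with hz
  set v : ℕ → Ψ → ℝ := fun t ω => width R B lam δ ε (fun s => φ (x s ω)) t with hv
  have hφx : ∀ t ≤ T, ∀ ω, ∀ s < t, φ (x s ω) ⬝ᵥ φ (x s ω) ≤ 1 := fun t ht ω s hs =>
    hφ _ (hxA s (by omega) ω)
  have hφH : ∀ t ≤ T, ∀ s < t, Measurable[history x y t] fun ω => φ (x s ω) := fun t ht s hs =>
    hcomp φ _ s (by omega) (measurable_arm_history hs)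
  have hgramH : ∀ t ≤ T, ∀ i j, Measurable[history x y t] fun ω =>
      gram lam (fun s => φ (x s ω)) t i j := fun t ht =>
    @measurable_gram_apply Ψ (history x y t) D lam (fun s ω => φ (x s ω)) t (hφH t ht)
  have hwH : ∀ t ≤ T, ∀ a, Measurable[history x y t] (w t a) := fun t ht a =>
    @measurable_mahalanobis Ψ (history x y t) D _ (hgramH t ht) _ measurable_const
  have hzH : ∀ t ≤ T, ∀ a, Measurable[history x y t] (z t a) := fun t ht a =>
    @measurable_dotProduct Ψ (history x y t) D _ _
      (@measurable_mulVec_inv Ψ (history x y t) D _ (hgramH t ht) _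
        (@measurable_sum_smul Ψ (history x y t) D y (fun s ω => φ (x s ω)) t
          (fun s hs => measurable_reward_history hs) (hφH t ht))) measurable_const
  have hvH : ∀ t ≤ T, Measurable[history x y t] (v t) := fun t ht =>
    @measurable_width Ψ (history x y t) D R B lam δ ε (fun s ω => φ (x s ω)) t (hφH t ht)
  have hw0 : ∀ t a ω, 0 ≤ w t a ω := fun t a ω => mahalanobis_nonneg _ _
  have hw1 : ∀ t, ∀ a ∈ A, ∀ ω, w t a ω ≤ 1 := fun t a ha ω =>
    mahalanobis_gram_le_one hl _ t (hφ a ha)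
  have hv0 : ∀ t ω, 0 ≤ v t ω := fun t ω => width_nonneg hR hB.le hε _ t
  have hvV : ∀ t ≤ T, ∀ ω, v t ω ≤ V := fun t ht ω =>
    width_le hR hε hl hδ ht (hφx t ht ω)
  have hV0 : 0 ≤ V := by
    obtain ⟨ω₀⟩ : Nonempty Ψ := P.nonempty_of_neZero
    exact (hv0 0 ω₀).trans (hvV 0 (Nat.zero_le T) ω₀)
  -- widths and gaps of the played arms
  set W : ℕ → Ψ → ℝ := fun t ω => w t (x t ω) ω with hW
  set Δ : ℕ → Ψ → ℝ := fun t ω => g a₀ - g (x t ω) with hΔ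
  have hWH : ∀ t < T, Measurable[history x y (t + 1)] (W t) := fun t ht =>
    @measurable_comp_finite X ℝ _ Ψ (history x y (t + 1)) A (x t) (hxA t ht)
      (fun a _ => measurable_arm_history (Nat.lt_succ_self t) (measurableSet_singleton a))
      (w t) fun a _ => (hwH t ht.le a).mono (hHmono (Nat.le_succ t)) le_rfl
  have hΔH : ∀ t < T, Measurable[history x y (t + 1)] (Δ t) := fun t ht =>
    hcomp (fun a => g a₀ - g a) _ t ht (measurable_arm_history (Nat.lt_succ_self t))
  have hW01 : ∀ t < T, ∀ ω, W t ω ∈ Set.Icc (0 : ℝ) 1 := fun t ht ω =>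
    ⟨hw0 t _ ω, hw1 t _ (hxA t ht ω) ω⟩
  have hΔ01 : ∀ t < T, ∀ ω, Δ t ω ∈ Set.Icc (0 : ℝ) (2 * B) := fun t ht ω => by
    have h1 := abs_le.1 (hg a₀ ha₀)
    have h2 := abs_le.1 (hg _ (hxA t ht ω))
    exact ⟨sub_nonneg.2 (hmax _ (hxA t ht ω)), by simp only [hΔ]; linarith⟩
  have hint : ∀ {f : Ψ → ℝ} {b : ℝ} {t : ℕ}, t < T → Measurable[history x y (t + 1)] f →
      (∀ ω, f ω ∈ Set.Icc (0 : ℝ) b) → Integrable f P := fun ht hf hb =>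
    integrable_of_measurable_of_abs_le (hf.mono (hHle _ ht) le_rfl) fun ω => by
      rw [abs_of_nonneg (hb ω).1]; exact (hb ω).2
  -- a bounded quantity deviates from its conditional expectation by at most its range
  have hdev : ∀ {f : Ψ → ℝ} {b : ℝ} {t : ℕ}, t < T → Measurable[history x y (t + 1)] f →
      (∀ ω, f ω ∈ Set.Icc (0 : ℝ) b) →
      ∀ᵐ ω ∂P, |f ω - (P[f | history x y t]) ω| ≤ b := by
    intro f b t ht hf hb
    have hi := hint ht hf hb
    have h1 := condExp_mono (m := history x y t) (integrable_const (0 : ℝ)) hi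
      (Filter.Eventually.of_forall fun ω => (hb ω).1)
    have h2 := condExp_mono (m := history x y t) hi (integrable_const b)
      (Filter.Eventually.of_forall fun ω => (hb ω).2)
    rw [condExp_const (hHle t ht.le)] at h1 h2
    filter_upwards [h1, h2] with ω h1 h2
    have := hb ω
    rw [abs_le]
    constructor <;> linarith [this.1, this.2]
  have hcentered : ∀ {f : Ψ → ℝ} {b : ℝ} {t : ℕ}, t < T → Measurable[history x y (t + 1)] f →
      (∀ ω, f ω ∈ Set.Icc (0 : ℝ) b) →
      P[f - P[f | history x y t] | history x y t] =ᵐ[P] 0 := by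
    intro f b t ht hf hb
    have hi := hint ht hf hb
    have h1 := condExp_sub hi integrable_condExp (m := history x y t)
      (g := P[f | history x y t])
    have h2 := condExp_of_stronglyMeasurable (μ := P) (hHle t ht.le)
      (stronglyMeasurable_condExp (f := f) (μ := P)) integrable_condExp
    rw [h2, sub_self] at h1
    exact h1
  have hceH : ∀ {f : Ψ → ℝ} {t : ℕ}, Measurable[history x y (t + 1)] (P[f | history x y t]) :=
    fun {f t} => stronglyMeasurable_condExp.measurable.mono (hHmono (Nat.le_succ t)) le_rfl
  -- the three exceptional events
  have hE1 := measure_selfNormalized (P := P) (m := ℱ) (n := T) (fun s t h => ℱ.mono h)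
    (fun t _ => ℱ.le t) (φ := fun t ω => φ (x t ω)) (η := fun t ω => y t ω - g (x t ω))
    (fun t ht => hcomp φ _ t ht (hband.measurable_arm t ht))
    (fun t ht => (hband.measurable_reward t ht).sub
      ((hcomp g _ t ht (hband.measurable_arm t ht)).mono (ℱ.mono (Nat.le_succ t)) le_rfl))
    hR (fun t ht s => condLeOne_exp_sub_of_condExp_le (ℱ.le t) (hband.integrable_noise t ht s)
      (hband.subGaussian_noise t ht s)) hl0 (half_pos hδ)
  have hE2 := measure_sum_gt_le (P := P) (n := T) hHmono hHle
    (ζ := fun t => P[W t | history x y t] - W t) (b := 1)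
    (fun t ht => hceH.sub (hWH t ht)) one_pos
    (fun t ht => by
      filter_upwards [hdev ht (hWH t ht) (hW01 t ht)] with ω h
      rw [Pi.sub_apply, abs_sub_comm]; exact h)
    (fun t ht => by
      have h1 := hcentered ht (hWH t ht) (hW01 t ht)
      have h2 := condExp_neg (μ := P) (W t - P[W t | history x y t]) (history x y t)
      rw [neg_sub] at h2
      filter_upwards [h1, h2] with ω h1 h2
      rw [h2, Pi.neg_apply, h1, Pi.zero_apply, neg_zero])
    hT (δ := δ / 4) (by linarith) (by linarith)
  have hE3 := measure_sum_gt_le (P := P) (n := T) hHmono hHle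
    (ζ := fun t => Δ t - P[Δ t | history x y t]) (b := 2 * B)
    (fun t ht => (hΔH t ht).sub hceH) (by linarith)
    (fun t ht => hdev ht (hΔH t ht) (hΔ01 t ht))
    (fun t ht => hcentered ht (hΔH t ht) (hΔ01 t ht)) hT (δ := δ / 4) (by linarith) (by linarith)
  set E1 := {ω | ∃ t ≤ T, R * √(Real.log ((lam⁻¹ • gram lam (fun s => φ (x s ω)) t).det /
    (δ / 2) ^ 2)) < mahalanobis (gram lam (fun s => φ (x s ω)) t)
      (∑ s ∈ Finset.range t, (y s ω - g (x s ω)) • φ (x s ω))} with hE1def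
  set E2 := {ω | 1 * √(2 * T * Real.log (1 / (δ / 4))) ≤
    ∑ t ∈ Finset.range T, (P[W t | history x y t] - W t) ω} with hE2def
  set E3 := {ω | 2 * B * √(2 * T * Real.log (1 / (δ / 4))) ≤
    ∑ t ∈ Finset.range T, (Δ t - P[Δ t | history x y t]) ω} with hE3def
  -- one round
  have hround : ∀ᵐ ω ∂P, ∀ t ∈ Finset.range T,
      (∀ a ∈ A, |z t a ω - g a| ≤ v t ω * w t a ω + ε) →
      (P[Δ t | history x y t]) ω ≤
        (1 + κ) * V * (4 / upperProb + 1) * (P[W t | history x y t]) ω + 4 * ε +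
          2 * B * (A.card * tailProb κ) := by
    rw [Filter.eventually_all_finset]
    intro t ht
    have ht := Finset.mem_range.1 ht
    have hdotm : ∀ a, Measurable fun μ : EuclideanSpace ℝ (Fin D) => WithLp.ofLp μ ⬝ᵥ φ a :=
      fun a => by unfold dotProduct; fun_prop
    refine condExp_gap_le (hHle t ht.le) (hxA t ht)
      (fun a _ => hxm t ht (measurableSet_singleton a)) hg (hv0 t) (hvV t ht.le) (hvH t ht.le)
      (fun a _ => hwH t ht.le a) (fun a _ => hw0 t a) (hw1 t) (fun a _ => hzH t ht.le a)
      (Z := fun a ω => WithLp.ofLp (μ t ω) ⬝ᵥ φ a)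
      (fun a _ => (hdotm a).comp (hTS.measurable_sample t ht)) ?_
      (fun ω a ha => (hTS.best t ht ω).2 a ha) hκ (htail.trans ?_) hup ha₀ hε
    · intro a _ S hS
      have h1 := hTS.law_sample t ht ((fun μ => WithLp.ofLp μ ⬝ᵥ φ a) ⁻¹' S) (hdotm a hS)
      refine h1.trans (Filter.Eventually.of_forall fun ω => ?_)
      beta_reduce
      rw [← map_measureReal_apply (hdotm a) hS,
        multivariateGaussian_map_dotProduct (gram_posDef hl0 _ t)]
    · exact div_le_div_of_nonneg_left hup.le two_pos (by linarith)
  set E4 := {ω | ¬ ∀ t ∈ Finset.range T,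
      (∀ a ∈ A, |z t a ω - g a| ≤ v t ω * w t a ω + ε) →
      (P[Δ t | history x y t]) ω ≤
        (1 + κ) * V * (4 / upperProb + 1) * (P[W t | history x y t]) ω + 4 * ε +
          2 * B * (A.card * tailProb κ)} with hE4def
  have hE4 : P E4 = 0 := hround
  have hmain : {ω | (1 + κ) * V * (4 / upperProb + 1) *
      (√(T * (2 * (D * Real.log (1 + T)))) + √(2 * T * Real.log (1 / (δ / 4)))) + 4 * ε * T + B +
      2 * B * √(2 * T * Real.log (1 / (δ / 4))) < regret A hA g T (fun t => x t ω)} ⊆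
      E1 ∪ E2 ∪ E3 ∪ E4 := by
    intro ω hω
    by_contra hne
    simp only [Set.mem_union, not_or] at hne
    obtain ⟨⟨⟨h1, h2⟩, h3⟩, h4⟩ := hne
    rw [Set.mem_ofPred_eq] at hω
    refine absurd hω (not_lt.2 ?_)
    simp only [hE4def, Set.mem_ofPred_eq, not_not] at h4
    simp only [hE1def, Set.mem_ofPred_eq, not_exists, not_and, not_lt] at h1
    simp only [hE2def, Set.mem_ofPred_eq, not_le, one_mul, Pi.sub_apply,
      Finset.sum_sub_distrib] at h2
    simp only [hE3def, Set.mem_ofPred_eq, not_le, Pi.sub_apply, Finset.sum_sub_distrib] at h3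
    have hgood : ∀ t ∈ Finset.range T, ∀ a ∈ A, |z t a ω - g a| ≤ v t ω * w t a ω + ε := by
      intro t ht a ha
      have ht := Finset.mem_range.1 ht
      have h5 := abs_thetaHat_sub_le hl0 (φ := fun s => φ (x s ω)) (y := fun s => y s ω)
        (η := fun s => y s ω - g (x s ω)) (θ := θ) (ε := ε) (δ := δ) hB.le hε (fun s hs => by
          rw [sub_sub_cancel]; exact hgθ _ (hxA s (by omega) ω)) hθ (h1 t ht.le) (φ a)
      have h6 := hgθ a ha
      rw [abs_sub_comm] at h6
      calc |z t a ω - g a| = |(z t a ω - θ ⬝ᵥ φ a) + (θ ⬝ᵥ φ a - g a)| := by congr 1; ring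
        _ ≤ _ := abs_add_le _ _
        _ ≤ _ := add_le_add h5 h6
    have h5 : ∑ t ∈ Finset.range T, (P[Δ t | history x y t]) ω ≤ ∑ t ∈ Finset.range T,
        ((1 + κ) * V * (4 / upperProb + 1) * (P[W t | history x y t]) ω + 4 * ε +
          2 * B * (A.card * tailProb κ)) :=
      Finset.sum_le_sum fun t ht => h4 t ht (hgood t ht)
    simp only [Finset.sum_add_distrib, ← Finset.mul_sum, Finset.sum_const, Finset.card_range,
      nsmul_eq_mul] at h5
    have h6 : ∑ t ∈ Finset.range T, W t ω ≤ √(T * (2 * (D * Real.log (1 + T)))) :=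
      psi_le hl (hφx T le_rfl ω)
    have h7 : (T : ℝ) * (2 * B * (A.card * tailProb κ)) ≤ B := by
      have h8 := mul_le_mul_of_nonneg_left htail (by positivity : 0 ≤ T * (2 * B))
      have h9 : T * (2 * B) * (upperProb / (2 * T)) = B * upperProb := by field_simp
      have h10 := mul_le_mul_of_nonneg_left upperProb_le_one hB.le
      linarith
    have h8 : 0 ≤ (1 + κ) * V * (4 / upperProb + 1) := by positivity
    have h9 := mul_le_mul_of_nonneg_left (show ∑ t ∈ Finset.range T,
      (P[W t | history x y t]) ω ≤ √(T * (2 * (D * Real.log (1 + T)))) +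
        √(2 * T * Real.log (1 / (δ / 4))) by linarith) h8
    have h10 : regret A hA g T (fun t => x t ω) ≤ ∑ t ∈ Finset.range T, Δ t ω :=
      Finset.sup'_le hA _ fun a ha => Finset.sum_le_sum fun t _ =>
        sub_le_sub_right (hmax a ha) _
    linarith
  refine (measure_mono hmain).trans ?_
  calc P (E1 ∪ E2 ∪ E3 ∪ E4) ≤ P E1 + P E2 + P E3 + P E4 :=
        (measure_union_le _ _).trans (add_le_add_left ((measure_union_le _ _).trans
          (add_le_add_left (measure_union_le _ _) _)) _)
    _ ≤ ENNReal.ofReal (δ / 2) + ENNReal.ofReal (δ / 4) + ENNReal.ofReal (δ / 4) + 0 :=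
        add_le_add (add_le_add (add_le_add hE1 hE2) hE3) hE4.le
    _ = ENNReal.ofReal δ := by
        rw [add_zero, ← ENNReal.ofReal_add (by positivity) (by positivity),
          ← ENNReal.ofReal_add (by positivity) (by positivity)]
        congr 1; ring

end Regret

/-! ### The regret bound -/

section FinalBound

/-- The constant of the regret bound. The first summand belongs to the leading term, where
`√(2 log (4 / upperProb))` comes from the union bound over arms and rounds; the term `5 B α` bounds
the accumulated misspecification `4 ε T`, and `10 B` the deviations of the gaps. -/
def regretConst (B R lam α : ℝ) : ℝ :=
  (5 * (1 + √(2 * Real.log (4 / upperProb))) + 18) * (2 * R + √lam * B + 2 * B * α) *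
    (4 / upperProb + 1) * 8 + 5 * B * α + 10 * B

lemma regretConst_nonneg {B R lam α : ℝ} (hB : 0 ≤ B) (hR : 0 ≤ R) (hα : 0 ≤ α) :
    0 ≤ regretConst B R lam α := by
  have := upperProb_pos
  unfold regretConst
  positivity

/-- Since `√(log N) ≥ √(log 2)` for `N ≥ 2`, constants can be absorbed into `√(log N)`. -/
lemma four_fifths_le_sqrt_log {N : ℕ} (hN : 2 ≤ N) : 4 / 5 ≤ √(Real.log N) := by
  refine Real.le_sqrt_of_sq_le ?_
  have h1 : Real.log 2 ≤ Real.log N :=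
    Real.log_le_log two_pos (by exact_mod_cast hN)
  have := Real.log_two_gt_d9
  norm_num at this ⊢
  linarith

set_option maxHeartbeats 1000000 in
/-- The explicit bound of `measure_regret_gt_le` for `κ = √(2 log (4 N T / upperProb))` and
`ε = B α / T ^ q`. Each factor of the leading term is linear in one of `√(log N)`, `√D + √(log 1/δ)`
and `√T (√D + √(log 1/δ))`, up to a factor `1 + log T`, and since `q ≥ 1/2` the misspecification is
at most `B α / √T`. -/
lemma bound_le_regretConst {B R lam α q δ : ℝ} {N D T : ℕ} (hB : 0 ≤ B) (hR : 0 ≤ R)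
    (hα : 0 < α) (hN : 2 ≤ N) (hD : 1 ≤ D) (hT : 1 ≤ T) (hq : 1 / 2 ≤ q) (hδ : 0 < δ)
    (hδ1 : δ < 1) :
    (1 + √(2 * Real.log (4 * N * T / upperProb))) *
      (R * √(D * Real.log (1 + T) + 2 * Real.log (2 / δ)) + √lam * B
      + (B * (α / (T : ℝ) ^ q)) * √(T * (2 * (D * Real.log (1 + T))))) * (4 / upperProb + 1) *
      (√(T * (2 * (D * Real.log (1 + T)))) + √(2 * T * Real.log (1 / (δ / 4)))) +
      4 * (B * (α / (T : ℝ) ^ q)) * T + B + 2 * B * √(2 * T * Real.log (1 / (δ / 4))) ≤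
    regretConst B R lam α * (1 + Real.log T) ^ 3 * (√(Real.log N) *
      (D * √T + √(D * T * Real.log (1 / δ)) + Real.log (1 / δ) * √T)) := by
  have hp := upperProb_pos
  have hp1 := upperProb_le_one
  have hT1 : (1 : ℝ) ≤ T := by exact_mod_cast hT
  have hT0 : (0 : ℝ) < T := by linarith
  have hD1 : (1 : ℝ) ≤ D := by exact_mod_cast hD
  have hN2 : (2 : ℝ) ≤ N := by exact_mod_cast hN
  have hν := four_fifths_le_sqrt_log hN
  have hνsq : √(Real.log N) ^ 2 = Real.log N := Real.sq_sqrt (Real.log_nonneg (by linarith))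
  have hlogT : 0 ≤ Real.log T := Real.log_nonneg hT1
  have hΛ : 0 ≤ Real.log (1 / δ) := Real.log_nonneg (by rw [le_div_iff₀ hδ]; linarith)
  have hrsq : √(Real.log (1 / δ)) ^ 2 = Real.log (1 / δ) := Real.sq_sqrt hΛ
  have hdsq : √(D : ℝ) ^ 2 = D := Real.sq_sqrt (by linarith)
  have hτsq : √(T : ℝ) ^ 2 = T := Real.sq_sqrt hT0.le
  have hd1 : 1 ≤ √(D : ℝ) := Real.one_le_sqrt.2 hD1
  have hτ1 : 1 ≤ √(T : ℝ) := Real.one_le_sqrt.2 hT1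
  have hlog2 : Real.log 2 ≤ 1 := by have := Real.log_two_lt_d9; linarith
  have hlog1T : Real.log (1 + T) ≤ 1 + Real.log T := by
    calc Real.log (1 + T) ≤ Real.log (2 * T) := Real.log_le_log (by linarith) (by linarith)
      _ = Real.log 2 + Real.log T := Real.log_mul two_ne_zero hT0.ne'
      _ ≤ _ := by linarith
  have hlog1T0 : 0 ≤ Real.log (1 + T) := Real.log_nonneg (by linarith)
  have hlog2δ : Real.log (2 / δ) ≤ 1 + Real.log (1 / δ) := by
    rw [show 2 / δ = 2 * (1 / δ) by ring, Real.log_mul two_ne_zero (by positivity)]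
    linarith
  have hlog4δ : Real.log (1 / (δ / 4)) ≤ 2 + Real.log (1 / δ) := by
    rw [show 1 / (δ / 4) = 2 * (2 * (1 / δ)) by field_simp; norm_num,
      Real.log_mul two_ne_zero (by positivity), Real.log_mul two_ne_zero (by positivity)]
    linarith
  have hlogκ : Real.log (4 * N * T / upperProb) =
      Real.log (4 / upperProb) + Real.log N + Real.log T := by
    rw [show 4 * (N : ℝ) * T / upperProb = 4 / upperProb * N * T by ring,
      Real.log_mul (by positivity) hT0.ne', Real.log_mul (by positivity) (by positivity)]
  have hlog4p : 0 ≤ Real.log (4 / upperProb) := Real.log_nonneg (by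
    rw [le_div_iff₀ hp]; linarith)
  -- this is where `q ≥ 1 / 2` enters
  have hεT : α / (T : ℝ) ^ q * √T ≤ α := by
    rw [div_mul_eq_mul_div, div_le_iff₀ (by positivity)]
    refine mul_le_mul_of_nonneg_left ?_ hα.le
    rw [Real.sqrt_eq_rpow]
    exact Real.rpow_le_rpow_of_exponent_le hT1 hq
  have hsplit : √(D * T * Real.log (1 / δ)) = √D * √T * √(Real.log (1 / δ)) := by
    rw [Real.sqrt_mul (by positivity), Real.sqrt_mul (by positivity)]
  have ha0 : 0 ≤ √(2 * Real.log (4 / upperProb)) := Real.sqrt_nonneg _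
  have hasq : √(2 * Real.log (4 / upperProb)) ^ 2 = 2 * Real.log (4 / upperProb) :=
    Real.sq_sqrt (by positivity)
  have hr0 : 0 ≤ √(Real.log (1 / δ)) := Real.sqrt_nonneg _
  have he0 : 0 ≤ α / (T : ℝ) ^ q := by positivity
  unfold regretConst
  rw [hsplit, hlogκ]
  set ℓ := 1 + Real.log T with hℓ
  have hℓ1 : 1 ≤ ℓ := by linarith
  set ν := √(Real.log N)
  set r := √(Real.log (1 / δ))
  set d := √(D : ℝ)
  set τ := √(T : ℝ)
  set a := √(2 * Real.log (4 / upperProb))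
  set e := α / (T : ℝ) ^ q
  have hlam := Real.sqrt_nonneg lam
  set m := √lam
  clear_value ℓ ν r d τ a e m
  -- the factors of the leading term
  have h1 : √(2 * (Real.log (4 / upperProb) + Real.log N + Real.log T)) ≤ a + 2 * ν + 2 * ℓ := by
    refine Real.sqrt_le_iff.2 ⟨by positivity, ?_⟩
    have k1 : 0 ≤ a * ν := by positivity
    have k2 : 0 ≤ a * ℓ := by positivity
    have k3 : 0 ≤ ν * ℓ := by positivity
    have k4 : ℓ ≤ ℓ ^ 2 := le_self_pow₀ hℓ1 two_ne_zero
    have k5 : 0 ≤ ν ^ 2 := sq_nonneg ν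
    linarith [show (a + 2 * ν + 2 * ℓ) ^ 2 =
      a ^ 2 + 4 * ν ^ 2 + 4 * ℓ ^ 2 + 4 * (a * ν) + 4 * (a * ℓ) + 8 * (ν * ℓ) by ring]
  have h1' : 1 + √(2 * (Real.log (4 / upperProb) + Real.log N + Real.log T)) ≤
      (5 * (1 + a) + 18) / 4 * (ℓ * ν) := by
    have hν0 : 0 ≤ ν := by linarith
    have k1 : ν ≤ ℓ * ν := le_mul_of_one_le_left hν0 hℓ1
    have k2 : 4 / 5 * ℓ ≤ ℓ * ν := by rw [mul_comm ℓ]; gcongr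
    have k3 : 4 / 5 ≤ ℓ * ν := by linarith
    have k4 : (1 + a) * (4 / 5) ≤ (1 + a) * (ℓ * ν) := by gcongr
    linarith
  have h2 : √(D * Real.log (1 + T) + 2 * Real.log (2 / δ)) ≤ 2 * (ℓ * (d + r)) := by
    refine Real.sqrt_le_iff.2 ⟨by positivity, ?_⟩
    have k1 : D * Real.log (1 + T) ≤ d ^ 2 * ℓ := by rw [hdsq]; gcongr
    have k2 : d ^ 2 * ℓ ≤ d ^ 2 * ℓ ^ 2 := by gcongr; exact le_self_pow₀ hℓ1 two_ne_zero
    have k3 : 1 ≤ d ^ 2 * ℓ ^ 2 := one_le_mul_of_one_le_of_one_le (one_le_pow₀ hd1) (one_le_pow₀ hℓ1)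
    have k4 : r ^ 2 ≤ ℓ ^ 2 * r ^ 2 := le_mul_of_one_le_left (sq_nonneg _) (one_le_pow₀ hℓ1)
    have k5 : 0 ≤ ℓ ^ 2 * (d * r) := by positivity
    linarith [show (2 * (ℓ * (d + r))) ^ 2 =
      4 * (d ^ 2 * ℓ ^ 2) + 8 * (ℓ ^ 2 * (d * r)) + 4 * (ℓ ^ 2 * r ^ 2) by ring,
      show 0 ≤ ℓ ^ 2 * r ^ 2 by positivity]
  have h3 : √(T * (2 * (D * Real.log (1 + T)))) ≤ 2 * (τ * ℓ * d) := by
    refine Real.sqrt_le_iff.2 ⟨by positivity, ?_⟩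
    have k1 : D * Real.log (1 + T) ≤ d ^ 2 * ℓ := by rw [hdsq]; gcongr
    have k2 : d ^ 2 * ℓ ≤ d ^ 2 * ℓ ^ 2 := by gcongr; exact le_self_pow₀ hℓ1 two_ne_zero
    calc T * (2 * (D * Real.log (1 + T))) ≤ τ ^ 2 * (2 * (d ^ 2 * ℓ ^ 2)) := by
          rw [hτsq]; gcongr T * (2 * ?_); exact k1.trans k2
      _ ≤ (2 * (τ * ℓ * d)) ^ 2 := by
          linarith [sq_nonneg (τ * ℓ * d), show τ ^ 2 * (2 * (d ^ 2 * ℓ ^ 2)) =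
            2 * (τ * ℓ * d) ^ 2 by ring, show (2 * (τ * ℓ * d)) ^ 2 = 4 * (τ * ℓ * d) ^ 2 by ring]
  have h4 : √(2 * T * Real.log (1 / (δ / 4))) ≤ 2 * (τ * (d + r)) := by
    refine Real.sqrt_le_iff.2 ⟨by positivity, ?_⟩
    calc 2 * T * Real.log (1 / (δ / 4)) ≤ 2 * τ ^ 2 * (2 * d ^ 2 + r ^ 2) := by
          rw [hτsq, hdsq, hrsq]; gcongr; linarith
      _ ≤ (2 * (τ * (d + r))) ^ 2 := by
          have : 0 ≤ τ ^ 2 * (d * r) := by positivity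
          linarith [show (2 * (τ * (d + r))) ^ 2 =
            4 * (τ ^ 2 * d ^ 2) + 8 * (τ ^ 2 * (d * r)) + 4 * (τ * r) ^ 2 by ring,
            show 2 * τ ^ 2 * (2 * d ^ 2 + r ^ 2) = 4 * (τ ^ 2 * d ^ 2) + 2 * (τ * r) ^ 2 by ring,
            sq_nonneg (τ * r)]
  have hν0 : 0 ≤ ν := by linarith
  have h5 : R * √(D * Real.log (1 + T) + 2 * Real.log (2 / δ)) + m * B +
      B * e * √(T * (2 * (D * Real.log (1 + T)))) ≤
      (2 * R + m * B + 2 * B * α) * (ℓ * (d + r)) := by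
    have k0 : 1 ≤ ℓ * (d + r) := one_le_mul_of_one_le_of_one_le hℓ1 (by linarith)
    have k1 : R * √(D * Real.log (1 + T) + 2 * Real.log (2 / δ)) ≤ R * (2 * (ℓ * (d + r))) := by
      gcongr
    have k2 : m * B ≤ m * B * (ℓ * (d + r)) := le_mul_of_one_le_right (by positivity) k0
    have k3 : B * e * √(T * (2 * (D * Real.log (1 + T)))) ≤ 2 * B * α * (ℓ * (d + r)) :=
      calc B * e * √(T * (2 * (D * Real.log (1 + T)))) ≤ B * e * (2 * (τ * ℓ * d)) := by gcongr
        _ = 2 * B * (e * τ) * (ℓ * d) := by ring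
        _ ≤ 2 * B * α * (ℓ * (d + r)) := by gcongr; linarith
    linarith
  have h6 : √(T * (2 * (D * Real.log (1 + T)))) + √(2 * T * Real.log (1 / (δ / 4))) ≤
      4 * (τ * ℓ * (d + r)) := by
    have k1 : τ * ℓ * d ≤ τ * ℓ * (d + r) := by gcongr; linarith
    have k2 : τ * (d + r) ≤ τ * ℓ * (d + r) := by
      gcongr; exact le_mul_of_one_le_right (by positivity) hℓ1
    linarith
  set Y := D * τ + d * τ * r + Real.log (1 / δ) * τ with hY
  have hYeq : Y = τ * (d ^ 2 + d * r + r ^ 2) := by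
    rw [hY, ← hdsq, ← hrsq]; ring
  clear_value Y
  have hdr : (d + r) ^ 2 ≤ 2 * (d ^ 2 + d * r + r ^ 2) := by
    linarith [sq_nonneg d, sq_nonneg r, show (d + r) ^ 2 = d ^ 2 + 2 * (d * r) + r ^ 2 by ring]
  have hm0 : 0 ≤ 2 * R + m * B + 2 * B * α := by positivity
  -- the remaining terms
  have hℓ3 : 1 ≤ ℓ ^ 3 := one_le_pow₀ hℓ1
  have hY0 : 0 ≤ Y := by rw [hYeq]; positivity
  have hZ : Y * (4 / 5) ≤ ℓ ^ 3 * (ν * Y) := by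
    have k1 : ν * Y ≤ ℓ ^ 3 * (ν * Y) := le_mul_of_one_le_left (by positivity) hℓ3
    linarith [mul_le_mul_of_nonneg_right hν hY0]
  have hYτ : τ ≤ Y := by
    rw [hYeq]
    refine le_mul_of_one_le_right (by positivity) ?_
    linarith [mul_nonneg (show 0 ≤ d by linarith) hr0, sq_nonneg r, one_le_pow₀ hd1 (n := 2)]
  have hYdr : τ * (d + r) ≤ Y := by
    rw [hYeq]
    refine mul_le_mul_of_nonneg_left ?_ (by positivity)
    linarith [sq_nonneg r, le_self_pow₀ hd1 two_ne_zero, le_mul_of_one_le_left hr0 hd1]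
  have h7 : 4 * (B * e) * T ≤ 4 * B * α * Y := by
    calc 4 * (B * e) * T = 4 * B * (e * τ) * τ := by rw [← hτsq]; ring
      _ ≤ 4 * B * α * Y := by gcongr
  have h8 : B + 2 * B * √(2 * T * Real.log (1 / (δ / 4))) ≤ 5 * B * Y := by
    have k1 : B ≤ B * Y := le_mul_of_one_le_right hB (hτ1.trans hYτ)
    have k2 : 2 * B * √(2 * T * Real.log (1 / (δ / 4))) ≤ 2 * B * (2 * Y) := by
      gcongr; linarith
    linarith
  have h9 : (1 + √(2 * (Real.log (4 / upperProb) + Real.log N + Real.log T))) *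
      (R * √(D * Real.log (1 + T) + 2 * Real.log (2 / δ)) + m * B +
      B * e * √(T * (2 * (D * Real.log (1 + T))))) * (4 / upperProb + 1) *
      (√(T * (2 * (D * Real.log (1 + T)))) + √(2 * T * Real.log (1 / (δ / 4)))) ≤
      (5 * (1 + a) + 18) * (2 * R + m * B + 2 * B * α) * (4 / upperProb + 1) * 8 *
      (ℓ ^ 3 * (ν * Y)) := by
    calc _ ≤ ((5 * (1 + a) + 18) / 4 * (ℓ * ν)) *
          ((2 * R + m * B + 2 * B * α) * (ℓ * (d + r))) * (4 / upperProb + 1) *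
          (4 * (τ * ℓ * (d + r))) := by gcongr
      _ = (5 * (1 + a) + 18) * (2 * R + m * B + 2 * B * α) * (4 / upperProb + 1) *
          (ℓ ^ 3 * (ν * (τ * (d + r) ^ 2))) := by ring
      _ ≤ (5 * (1 + a) + 18) * (2 * R + m * B + 2 * B * α) * (4 / upperProb + 1) *
          (ℓ ^ 3 * (ν * (8 * Y))) := by
          refine mul_le_mul_of_nonneg_left (mul_le_mul_of_nonneg_left
            (mul_le_mul_of_nonneg_left ?_ hν0) (by positivity)) (by positivity)
          rw [hYeq]
          have k1 : τ * (d + r) ^ 2 ≤ τ * (2 * (d ^ 2 + d * r + r ^ 2)) := by gcongr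
          have k2 : 0 ≤ τ * (d ^ 2 + d * r + r ^ 2) := by positivity
          linarith
      _ = _ := by ring
  have hBα : 0 ≤ B * α := by positivity
  have h10 := mul_le_mul_of_nonneg_left hZ hBα
  have h11 := mul_le_mul_of_nonneg_left hZ hB
  have h12 := mul_nonneg hB hY0
  rw [mul_assoc _ (ℓ ^ 3), add_mul, add_mul]
  linarith

variable {Ψ X : Type*} {mΨ : MeasurableSpace Ψ} [MeasurableSpace X] [MeasurableSingletonClass X]
  {P : Measure Ψ} [IsProbabilityMeasure P]

/-- The features of the P-greedy algorithm make the kernel bandit a linear bandit with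
misspecification `B α / T ^ q`, to which `measure_regret_gt_le` is applied. With a single arm or for
`f = 0` the regret vanishes. -/
theorem one_sub_le_measureReal_regret_le {K : X → X → ℝ} (hK : IsKernel K) {H : Type*}
    [NormedAddCommGroup H] [InnerProductSpace ℝ H] [CompleteSpace H] [RKHS ℝ H X ℝ]
    (hker : ∀ x y, RKHS.kernel H x y 1 = K x y) {f : H} {B R lam α q δ : ℝ} (hB : 0 ≤ B)
    (hR : 0 ≤ R) (hl : 1 ≤ lam) (hα : 0 < α) (hf : ‖f‖ ≤ B) {A : Finset X} (hA : A.Nonempty)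
    {T : ℕ} (hT : 1 ≤ T) (hq : 1 / 2 ≤ q) (hδ : 0 < δ) (hδ1 : δ < 1) {D : ℕ} {ξ : ℕ → X}
    (hξ : IsPGreedy K A (α / (T : ℝ) ^ q) D ξ) {ℱ : Filtration ℕ mΨ} {x : ℕ → Ψ → X}
    {y : ℕ → Ψ → ℝ} {μ : ℕ → Ψ → EuclideanSpace ℝ (Fin D)}
    (hband : IsBandit P ℱ (fun a => f a) R T x y)
    (hTS : IsModifiedTS P A (feature K ξ D) lam R B (B * (α / (T : ℝ) ^ q)) δ T x y μ) :
    1 - δ ≤ P.real {ω | regret A hA (fun a => f a) T (fun t => x t ω) ≤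
      regretConst B R lam α * (1 + Real.log T) ^ 3 * (√(Real.log A.card) *
        (D * √T + √(D * T * Real.log (1 / δ)) + Real.log (1 / δ) * √T))} := by
  have hT0 : (0 : ℝ) < T := by exact_mod_cast hT
  have he : 0 < α / (T : ℝ) ^ q := by positivity
  obtain ⟨hφ, hfB, θ, hθ, hfθ⟩ := exists_approx hK hker hf he hξ
  have hlogT : 0 ≤ Real.log T := Real.log_nonneg (by exact_mod_cast hT)
  have hΛ : 0 ≤ Real.log (1 / δ) := Real.log_nonneg (by rw [le_div_iff₀ hδ]; linarith)
  have hxA : ∀ t < T, ∀ ω, x t ω ∈ A := fun t ht ω => (hTS.best t ht ω).1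
  have hC := regretConst_nonneg (lam := lam) hB hR hα.le
  -- without a choice between different values of `f` there is no regret
  have htriv : (∀ a ∈ A, ∀ b ∈ A, f a = f b) → 1 - δ ≤
      P.real {ω | regret A hA (fun a => f a) T (fun t => x t ω) ≤
        regretConst B R lam α * (1 + Real.log T) ^ 3 * (√(Real.log A.card) *
        (D * √T + √(D * T * Real.log (1 / δ)) + Real.log (1 / δ) * √T))} := by
    intro h
    have : {ω | regret A hA (fun a => f a) T (fun t => x t ω) ≤
        regretConst B R lam α * (1 + Real.log T) ^ 3 * (√(Real.log A.card) *
        (D * √T + √(D * T * Real.log (1 / δ)) + Real.log (1 / δ) * √T))} = Set.univ := by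
      refine Set.eq_univ_of_forall fun ω => ?_
      have h0 : regret A hA (fun a => f a) T (fun t => x t ω) ≤ 0 :=
        Finset.sup'_le _ _ fun a ha => (Finset.sum_eq_zero fun t ht => by
          beta_reduce
          rw [h a ha _ (hxA t (Finset.mem_range.1 ht) ω), sub_self]).le
      exact h0.trans (by positivity)
    rw [this, probReal_univ]
    linarith
  rcases hB.eq_or_lt with rfl | hB0
  · refine htriv fun a _ b _ => ?_
    rw [abs_nonpos_iff.1 (hfB a), abs_nonpos_iff.1 (hfB b)]
  rcases Nat.lt_or_ge A.card 2 with hN | hN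
  · exact htriv fun a ha b hb => by
      rw [Finset.card_le_one.1 (Nat.lt_succ_iff.1 hN) a ha b hb]
  have hp := upperProb_pos
  have hN0 : (0 : ℝ) < A.card := by exact_mod_cast (show 0 < A.card by omega)
  have hN1 : (1 : ℝ) ≤ A.card := by exact_mod_cast (show 1 ≤ A.card by omega)
  have hT1 : (1 : ℝ) ≤ T := by exact_mod_cast hT
  -- this value of `κ` makes the union bound over the arms and rounds work
  set κ := √(2 * Real.log (4 * A.card * T / upperProb)) with hκ
  have hlog : 0 ≤ Real.log (4 * A.card * T / upperProb) := Real.log_nonneg (by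
    rw [le_div_iff₀ hp]
    have := upperProb_le_one
    nlinarith)
  have htail : A.card * tailProb κ ≤ upperProb / (2 * T) := by
    calc A.card * tailProb κ ≤ A.card * (2 * Real.exp (-κ ^ 2 / 2)) := by
          gcongr; exact tailProb_le (Real.sqrt_nonneg _)
      _ = upperProb / (2 * T) := by
          rw [hκ, Real.sq_sqrt (by positivity), neg_div, mul_div_cancel_left₀ _ two_ne_zero,
            Real.exp_neg, Real.exp_log (by positivity)]
          field_simp
          norm_num
  have hmain := measure_regret_gt_le hA hR hB0 hl (ε := B * (α / (T : ℝ) ^ q)) (by positivity)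
    hδ hδ1 hT (fun a _ => hφ a) (fun a _ => hfB a) hθ hfθ hband hTS (Real.sqrt_nonneg _) htail
  have hbound := bound_le_regretConst (lam := lam) hB hR hα hN hξ.pos hT hq hδ hδ1
  rw [← hκ] at hbound
  set S := {ω | regret A hA (fun a => f a) T (fun t => x t ω) ≤
        regretConst B R lam α * (1 + Real.log T) ^ 3 * (√(Real.log A.card) *
        (D * √T + √(D * T * Real.log (1 / δ)) + Real.log (1 / δ) * √T))} with hS
  have hSc : P Sᶜ ≤ ENNReal.ofReal δ := by
    refine (measure_mono fun ω hω => ?_).trans hmain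
    rw [hS, Set.mem_compl_iff, Set.mem_ofPred_eq, not_le] at hω
    rw [Set.mem_ofPred_eq]
    exact hbound.trans_lt hω
  have h1 : P.real Sᶜ ≤ δ := ENNReal.toReal_le_of_le_ofReal hδ.le hSc
  have h2 : P.real Set.univ ≤ P.real S + P.real Sᶜ := by
    rw [← Set.union_compl_self S]
    exact measureReal_union_le _ _
  rw [probReal_univ] at h2
  linarith

end FinalBound

/-! ### Reasoning about programs -/

namespace State

variable (σ : State) (r : Ref) (a : ℝ) (v k : ℕ)

@[simp] lemma tick_ints : σ.tick.ints = σ.ints := rfl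
@[simp] lemma tick_reals : σ.tick.reals = σ.reals := rfl
@[simp] lemma tick_draws : σ.tick.draws = σ.draws := rfl
@[simp] lemma tick_rounds : σ.tick.rounds = σ.rounds := rfl
@[simp] lemma tick_played : σ.tick.played = σ.played := rfl
@[simp] lemma tick_steps : σ.tick.steps = σ.steps + 1 := rfl
@[simp] lemma get_tick : σ.tick.get r = σ.get r := rfl

@[simp] lemma set_ints : (σ.set r a).ints = σ.ints := rfl
@[simp] lemma set_draws : (σ.set r a).draws = σ.draws := rfl
@[simp] lemma set_rounds : (σ.set r a).rounds = σ.rounds := rfl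
@[simp] lemma set_played : (σ.set r a).played = σ.played := rfl
@[simp] lemma set_steps : (σ.set r a).steps = σ.steps := rfl

lemma set_reals (n i j : ℕ) : (σ.set r a).reals n i j =
    if n = r.arr ∧ i = σ.ints r.row ∧ j = σ.ints r.col then a else σ.reals n i j := rfl

lemma set_reals_of_ne {n : ℕ} (h : n ≠ r.arr) : (σ.set r a).reals n = σ.reals n := by
  funext i j
  rw [set_reals, if_neg fun h' => h h'.1]

lemma get_set_of_ne {s : Ref} (h : s.arr ≠ r.arr) : (σ.set r a).get s = σ.get s := by
  rw [get, set_reals_of_ne _ _ _ h]; rfl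

@[simp] lemma get_set_self : (σ.set r a).get r = a := if_pos ⟨rfl, rfl, rfl⟩

lemma setInt_ints (u : ℕ) : (σ.setInt v k).ints u = if u = v then k else σ.ints u := by
  simp [setInt, Function.update_apply]

@[simp] lemma setInt_reals : (σ.setInt v k).reals = σ.reals := rfl
@[simp] lemma setInt_draws : (σ.setInt v k).draws = σ.draws := rfl
@[simp] lemma setInt_rounds : (σ.setInt v k).rounds = σ.rounds := rfl
@[simp] lemma setInt_played : (σ.setInt v k).played = σ.played := rfl
@[simp] lemma setInt_steps : (σ.setInt v k).steps = σ.steps := rfl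

/-- The rule for loops: `I i` is an invariant that holds before iteration `i`. -/
lemma iter_induction {f : ℕ → State → State} {n : ℕ} {σ : State} (I : ℕ → State → Prop)
    (h0 : I 0 σ) (hs : ∀ i < n, ∀ τ, I i τ → I (i + 1) (f i τ)) : I n (iter f n σ) := by
  suffices h : ∀ m ≤ n, I m (iter f m σ) from h n le_rfl
  intro m hm
  induction m with
  | zero => exact h0
  | succ m ih => exact hs m hm _ (ih (by omega))

end State

namespace Cmd

/-- The integer variables to which a program may assign. -/
def intVars : Cmd → List ℕ
  | skip => []
  | seq c₁ c₂ => c₁.intVars ++ c₂.intVars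
  | intConst v _ => [v]
  | intAdd v _ _ => [v]
  | intSub v _ _ => [v]
  | realConst _ _ => []
  | unary _ _ _ => []
  | binary _ _ _ _ => []
  | kernel _ _ _ => []
  | normal _ => []
  | pull _ _ => []
  | ifIntLt _ _ c₁ c₂ => c₁.intVars ++ c₂.intVars
  | ifRealLe _ _ c₁ c₂ => c₁.intVars ++ c₂.intVars
  | loop v _ c => v :: c.intVars

/-- The real arrays to which a program may assign. -/
def arrays : Cmd → List ℕ
  | skip => []
  | seq c₁ c₂ => c₁.arrays ++ c₂.arrays
  | intConst _ _ => []
  | intAdd _ _ _ => []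
  | intSub _ _ _ => []
  | realConst r _ => [r.arr]
  | unary _ r _ => [r.arr]
  | binary _ r _ _ => [r.arr]
  | kernel r _ _ => [r.arr]
  | normal r => [r.arr]
  | pull r _ => [r.arr]
  | ifIntLt _ _ c₁ c₂ => c₁.arrays ++ c₂.arrays
  | ifRealLe _ _ c₁ c₂ => c₁.arrays ++ c₂.arrays
  | loop _ _ c => c.arrays

/-- The program neither draws normal variables nor pulls arms. -/
def isOffline : Cmd → Bool
  | seq c₁ c₂ => c₁.isOffline && c₂.isOffline
  | ifIntLt _ _ c₁ c₂ => c₁.isOffline && c₂.isOffline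
  | ifRealLe _ _ c₁ c₂ => c₁.isOffline && c₂.isOffline
  | loop _ _ c => c.isOffline
  | normal _ => false
  | pull _ _ => false
  | _ => true

/-- An upper bound for the number of steps of a program, if `β v` is an upper bound for the value
of the integer variable `v` during its execution. -/
def cost (β : ℕ → ℕ) : Cmd → ℕ
  | skip => 0
  | seq c₁ c₂ => c₁.cost β + c₂.cost β
  | ifIntLt _ _ c₁ c₂ => 1 + (c₁.cost β + c₂.cost β)
  | ifRealLe _ _ c₁ c₂ => 1 + (c₁.cost β + c₂.cost β)
  | loop _ w c => 1 + β w * (1 + c.cost β)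
  | _ => 1

/-- All assignments to integer variables respect the upper bounds `β`. -/
def IsBounded (β : ℕ → ℕ) : Cmd → Prop
  | seq c₁ c₂ => c₁.IsBounded β ∧ c₂.IsBounded β
  | intConst v k => k ≤ β v
  | intAdd v u w => β u + β w ≤ β v
  | intSub v u _ => β u ≤ β v
  | ifIntLt _ _ c₁ c₂ => c₁.IsBounded β ∧ c₂.IsBounded β
  | ifRealLe _ _ c₁ c₂ => c₁.IsBounded β ∧ c₂.IsBounded β
  | loop v w c => β w ≤ β v ∧ c.IsBounded β
  | _ => True

variable {W W' : World}

/-- A program only changes the integer variables in `intVars`. -/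
lemma exec_ints_of_notMem {v : ℕ} (c : Cmd) (h : v ∉ c.intVars) (σ : State) :
    (c.exec W σ).ints v = σ.ints v := by
  induction c generalizing σ with
  | seq c₁ c₂ h₁ h₂ =>
    simp only [intVars, List.mem_append, not_or] at h
    rw [exec, h₂ h.2, h₁ h.1]
  | ifIntLt u w c₁ c₂ h₁ h₂ =>
    simp only [intVars, List.mem_append, not_or] at h
    rw [exec]
    split_ifs
    · rw [h₁ h.1, State.tick_ints]
    · rw [h₂ h.2, State.tick_ints]
  | ifRealLe u w c₁ c₂ h₁ h₂ =>
    simp only [intVars, List.mem_append, not_or] at h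
    rw [exec]
    split_ifs
    · rw [h₁ h.1, State.tick_ints]
    · rw [h₂ h.2, State.tick_ints]
  | loop u w c ih =>
    simp only [intVars, List.mem_cons, not_or] at h
    rw [exec]
    refine State.iter_induction (fun _ τ => τ.ints v = σ.ints v) rfl fun i _ τ hτ => ?_
    rw [ih h.2, State.tick_ints, State.setInt_ints, if_neg h.1, hτ]
  | intConst u k => simp_all [exec, intVars, State.setInt_ints]
  | intAdd u k l => simp_all [exec, intVars, State.setInt_ints]
  | intSub u k l => simp_all [exec, intVars, State.setInt_ints]
  | _ => simp [exec]

lemma exec_reals_of_notMem {k : ℕ} (c : Cmd) (h : k ∉ c.arrays) (σ : State) :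
    (c.exec W σ).reals k = σ.reals k := by
  induction c generalizing σ with
  | seq c₁ c₂ h₁ h₂ =>
    simp only [arrays, List.mem_append, not_or] at h
    rw [exec, h₂ h.2, h₁ h.1]
  | ifIntLt u w c₁ c₂ h₁ h₂ =>
    simp only [arrays, List.mem_append, not_or] at h
    rw [exec]
    split_ifs
    · rw [h₁ h.1, State.tick_reals]
    · rw [h₂ h.2, State.tick_reals]
  | ifRealLe u w c₁ c₂ h₁ h₂ =>
    simp only [arrays, List.mem_append, not_or] at h
    rw [exec]
    split_ifs
    · rw [h₁ h.1, State.tick_reals]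
    · rw [h₂ h.2, State.tick_reals]
  | loop u w c ih =>
    rw [exec]
    refine State.iter_induction (fun _ τ => τ.reals k = σ.reals k) rfl fun i _ τ hτ => ?_
    rw [ih h, State.tick_reals, State.setInt_reals, hτ]
  | skip => rfl
  | intConst => rfl
  | intAdd => rfl
  | intSub => rfl
  | _ =>
    simp only [arrays, List.mem_singleton] at h
    exact State.set_reals_of_ne _ _ _ h

/-- An offline program uses no draws and plays no rounds. -/
lemma exec_world_of_isOffline (c : Cmd) (h : c.isOffline) (σ : State) :
    (c.exec W σ).draws = σ.draws ∧ (c.exec W σ).rounds = σ.rounds ∧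
      (c.exec W σ).played = σ.played := by
  induction c generalizing σ with
  | seq c₁ c₂ h₁ h₂ =>
    simp only [isOffline, Bool.and_eq_true] at h
    rw [exec, (h₂ h.2 _).1, (h₂ h.2 _).2.1, (h₂ h.2 _).2.2]
    exact h₁ h.1 σ
  | ifIntLt u w c₁ c₂ h₁ h₂ =>
    simp only [isOffline, Bool.and_eq_true] at h
    rw [exec]
    split_ifs
    exacts [h₁ h.1 _, h₂ h.2 _]
  | ifRealLe u w c₁ c₂ h₁ h₂ =>
    simp only [isOffline, Bool.and_eq_true] at h
    rw [exec]
    split_ifs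
    exacts [h₁ h.1 _, h₂ h.2 _]
  | loop u w c ih =>
    rw [exec]
    refine State.iter_induction (fun _ τ => τ.draws = σ.draws ∧ τ.rounds = σ.rounds ∧
      τ.played = σ.played) ⟨rfl, rfl, rfl⟩ fun i _ τ hτ => ?_
    have := ih h (τ.setInt u i).tick
    exact ⟨this.1.trans hτ.1, this.2.1.trans hτ.2.1, this.2.2.trans hτ.2.2⟩
  | normal => simp [isOffline] at h
  | pull => simp [isOffline] at h
  | _ => exact ⟨rfl, rfl, rfl⟩

/-- Without draws and pulls, a program depends on the world only through the kernel. -/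
lemma exec_congr_of_isOffline (hW : W.kernel = W'.kernel) (c : Cmd) (h : c.isOffline) (σ : State) :
    c.exec W σ = c.exec W' σ := by
  induction c generalizing σ with
  | seq c₁ c₂ h₁ h₂ =>
    simp only [isOffline, Bool.and_eq_true] at h
    rw [exec, exec, h₁ h.1, h₂ h.2]
  | ifIntLt u w c₁ c₂ h₁ h₂ =>
    simp only [isOffline, Bool.and_eq_true] at h
    rw [exec, exec, h₁ h.1, h₂ h.2]
  | ifRealLe u w c₁ c₂ h₁ h₂ =>
    simp only [isOffline, Bool.and_eq_true] at h
    rw [exec, exec, h₁ h.1, h₂ h.2]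
  | loop u w c ih =>
    rw [exec, exec]
    congr 1
    funext i τ
    exact ih h _
  | kernel r u w => rw [exec, exec, hW]
  | normal => simp [isOffline] at h
  | pull => simp [isOffline] at h
  | _ => rfl

/-- The cost is a bound for the number of steps, and the bounds for the integer variables persist. -/
lemma exec_steps_le {β : ℕ → ℕ} (c : Cmd) (h : c.IsBounded β) {σ : State}
    (hσ : ∀ v, σ.ints v ≤ β v) :
    (∀ v, (c.exec W σ).ints v ≤ β v) ∧ (c.exec W σ).steps ≤ σ.steps + c.cost β := by
  have hset : ∀ {τ : State} (_ : ∀ v, τ.ints v ≤ β v) {u k : ℕ}, k ≤ β u →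
      ∀ v, (τ.setInt u k).ints v ≤ β v := by
    intro τ hτ u k hk v
    rw [State.setInt_ints]
    split_ifs with h
    · rw [h]; exact hk
    · exact hτ v
  induction c generalizing σ with
  | skip => exact ⟨hσ, le_rfl⟩
  | seq c₁ c₂ h₁ h₂ =>
    obtain ⟨k₁, k₂⟩ := h₁ h.1 hσ
    obtain ⟨k₃, k₄⟩ := h₂ h.2 k₁
    refine ⟨k₃, ?_⟩
    rw [exec, cost]
    omega
  | intConst v k => exact ⟨hset hσ h, le_rfl⟩
  | intAdd v u w => exact ⟨hset hσ ((Nat.add_le_add (hσ u) (hσ w)).trans h), le_rfl⟩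
  | intSub v u w => exact ⟨hset hσ (((Nat.sub_le _ _).trans (hσ u)).trans h), le_rfl⟩
  | ifIntLt u w c₁ c₂ h₁ h₂ =>
    have k₁ := h₁ h.1 (σ := σ.tick) hσ
    have k₂ := h₂ h.2 (σ := σ.tick) hσ
    rw [exec, cost]
    rw [State.tick_steps] at k₁ k₂
    split_ifs
    · exact ⟨k₁.1, by omega⟩
    · exact ⟨k₂.1, by omega⟩
  | ifRealLe u w c₁ c₂ h₁ h₂ =>
    have k₁ := h₁ h.1 (σ := σ.tick) hσ
    have k₂ := h₂ h.2 (σ := σ.tick) hσ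
    rw [exec, cost]
    rw [State.tick_steps] at k₁ k₂
    split_ifs
    · exact ⟨k₁.1, by omega⟩
    · exact ⟨k₂.1, by omega⟩
  | loop u w c ih =>
    rw [exec, cost]
    have := State.iter_induction (σ := σ.tick)
      (f := fun i τ => c.exec W (τ.setInt u i).tick) (n := σ.ints w)
      (fun i τ => (∀ v, τ.ints v ≤ β v) ∧ τ.steps ≤ σ.steps + (1 + i * (1 + c.cost β)))
      ⟨hσ, by rw [State.tick_steps]; omega⟩ fun i hi τ hτ => by
        have h1 := ih h.2 (σ := (τ.setInt u i).tick)
          (hset hτ.1 (hi.le.trans ((hσ w).trans h.1)))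
        refine ⟨h1.1, h1.2.trans ?_⟩
        have h2 := hτ.2
        rw [State.tick_steps, State.setInt_steps, add_mul, one_mul]
        omega
    refine ⟨this.1, this.2.trans ?_⟩
    gcongr
    exact hσ w
  | _ => exact ⟨hσ, le_rfl⟩

end Cmd

/-! ### Subroutines -/

/-! Integer variables: `0` holds the number `n` of arms, `1` the number `T` of rounds, `2` and `3` the
constants zero and one, `4` the number `D` of selected points, `5` the number of rows of the current
table, and `9` the position found by `argmax`. Variables `6`, `7`, `8` are the counters of nested
loops, `10` is a column, `11` a row (often the row of the pivot), and `12` is auxiliary.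

Real arrays: `0` is the input, `1` the table of features (see below for its further rows), `2` its
image under the inverse Cholesky factor, `3` holds kernel values, `4` the function to be maximized,
`14` the vector `Lᵀ μ_t` for the sample `μ_t`. The other arrays are single registers, in position `(0, 0)`: `6`, `7`, `8`, `15` are
auxiliary, `10` is `ψ_t`, `11` the reward, `12` the determinant, `13` the scale of the sampling
distribution, `16` and `17` the thresholds of the P-greedy algorithm, and `20, …, 24` hold
`λ, R, B, δ, e`. -/

/-- The real array `k`, used as a single register. The integer variable `2` is always `0`. -/
abbrev reg (k : ℕ) : Ref := ⟨k, 2, 2⟩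

namespace Cmd

/-- Store the inner product of the first `w` entries of row `i₁` of array `a₁` and of row `i₂` of
array `a₂` in register `6`. -/
def dot (a₁ i₁ a₂ i₂ w : ℕ) : Cmd :=
  .seq (.realConst (reg 6) 0) (.loop 8 w
    (.seq (.binary .mul (reg 7) ⟨a₁, i₁, 8⟩ ⟨a₂, i₂, 8⟩) (.binary .add (reg 6) (reg 6) (reg 7))))

/-- With `p` and `c` the variables `11` and `10`, store `s[i][c] - ∑_{k<c} d[p][k] d[i][k]` in
register `6`. -/
def reduce (s d i : ℕ) : Cmd :=
  .seq (dot d 11 d i 10) (.binary .sub (reg 6) ⟨s, i, 10⟩ (reg 6))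

/-- With `p` and `c` the variables `11` and `10`, compute the column `c` of array `d` by
`d[i][c] := (s[i][c] - ∑_{k<c} d[p][k] d[i][k]) / √(s[p][c] - ∑_{k<c} d[p][k]²)`. -/
def colStep (s d : ℕ) : Cmd :=
  .seq (reduce s d 11) (.seq (.unary .sqrt (reg 8) (reg 6))
    (.loop 7 5 (.seq (reduce s d 7) (.binary .div ⟨d, 7, 10⟩ (reg 6) (reg 8)))))

/-- Put the position of a maximal entry among the first `n` entries of the first column of array
`4` into variable `9`. -/
def argmax : Cmd :=
  .seq (.intConst 9 0) (.loop 7 0 (.ifRealLe ⟨4, 9, 2⟩ ⟨4, 7, 2⟩ (.intAdd 9 7 2) .skip))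

variable {W : World} {σ : State}

lemma dot_ints {a₁ i₁ a₂ i₂ w v : ℕ} (hv : v ≠ 8) :
    ((dot a₁ i₁ a₂ i₂ w).exec W σ).ints v = σ.ints v :=
  exec_ints_of_notMem _ (by simpa [dot, intVars] using hv) σ

lemma dot_reals {a₁ i₁ a₂ i₂ w k : ℕ} (h : k ≠ 6) (h' : k ≠ 7) :
    ((dot a₁ i₁ a₂ i₂ w).exec W σ).reals k = σ.reals k :=
  exec_reals_of_notMem _ (by simp [dot, arrays, h, h']) σ

lemma dot_get {a₁ i₁ a₂ i₂ w : ℕ} (h₁ : a₁ ≠ 6 ∧ a₁ ≠ 7) (h₂ : a₂ ≠ 6 ∧ a₂ ≠ 7)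
    (hi₁ : i₁ ≠ 8) (hi₂ : i₂ ≠ 8) :
    ((dot a₁ i₁ a₂ i₂ w).exec W σ).get (reg 6) = ∑ k ∈ Finset.range (σ.ints w),
      σ.reals a₁ (σ.ints i₁) k * σ.reals a₂ (σ.ints i₂) k := by
  have h := State.iter_induction (σ := (σ.set (reg 6) (0 : ℕ)).tick.tick)
    (f := fun i τ => (seq (.binary .mul (reg 7) ⟨a₁, i₁, 8⟩ ⟨a₂, i₂, 8⟩)
      (.binary .add (reg 6) (reg 6) (reg 7))).exec W (τ.setInt 8 i).tick) (n := σ.ints w)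
    (fun m τ => (∀ v ≠ 8, τ.ints v = σ.ints v) ∧ (∀ k, k ≠ 6 ∧ k ≠ 7 → τ.reals k = σ.reals k) ∧
      τ.get (reg 6) = ∑ k ∈ Finset.range m,
        σ.reals a₁ (σ.ints i₁) k * σ.reals a₂ (σ.ints i₂) k)
    ⟨fun _ _ => rfl, fun k hk => State.set_reals_of_ne _ _ _ hk.1,
      by simp [State.get, State.set_reals]⟩
    fun m _ τ ⟨k₁, k₂, k₃⟩ => ⟨fun v hv => by simp [exec, State.setInt_ints, hv, k₁ v hv],
      fun k hk => ?_, ?_⟩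
  · exact h.2.2
  · simp only [exec, State.tick_reals]
    rw [State.set_reals_of_ne _ _ _ hk.1, State.tick_reals, State.set_reals_of_ne _ _ _ hk.2,
      State.tick_reals, State.setInt_reals, k₂ k hk]
  · rw [Finset.sum_range_succ, ← k₃, ← k₂ a₁ h₁, ← k₂ a₂ h₂, ← k₁ i₁ hi₁, ← k₁ i₂ hi₂]
    simp [exec, State.get, State.set_reals, State.setInt_ints, BinOp.eval, hi₁, hi₂]

lemma reduce_ints {s d i v : ℕ} (hv : v ≠ 8) :
    ((reduce s d i).exec W σ).ints v = σ.ints v :=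
  exec_ints_of_notMem _ (by simpa [reduce, dot, intVars] using hv) σ

lemma reduce_reals {s d i k : ℕ} (h : k ≠ 6) (h' : k ≠ 7) :
    ((reduce s d i).exec W σ).reals k = σ.reals k :=
  exec_reals_of_notMem _ (by simp [reduce, dot, arrays, h, h']) σ

lemma reduce_get {s d i : ℕ} (hs : s ≠ 6 ∧ s ≠ 7) (hd : d ≠ 6 ∧ d ≠ 7) (hi : i ≠ 8) :
    ((reduce s d i).exec W σ).get (reg 6) = σ.reals s (σ.ints i) (σ.ints 10) -
      ∑ k ∈ Finset.range (σ.ints 10), σ.reals d (σ.ints 11) k * σ.reals d (σ.ints i) k := by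
  have h := dot_get (W := W) (σ := σ) (w := 10) hd hd (show 11 ≠ 8 by decide) hi
  rw [← h]
  simp only [reduce, exec, State.get_tick, BinOp.eval]
  rw [State.get_set_self, State.get, dot_ints hi,
      dot_ints (show 10 ≠ 8 by decide), dot_reals hs.1 hs.2]

lemma colStep_ints {s d v : ℕ} (hv : v ≠ 8) (hv' : v ≠ 7) :
    ((colStep s d).exec W σ).ints v = σ.ints v :=
  exec_ints_of_notMem _ (by simp [colStep, reduce, dot, intVars, hv, hv']) σ

lemma colStep_reals_of_ne {s d k : ℕ} (h : k ≠ 6) (h' : k ≠ 7) (h'' : k ≠ 8) (hd : k ≠ d) :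
    ((colStep s d).exec W σ).reals k = σ.reals k :=
  exec_reals_of_notMem _ (by simp [colStep, reduce, dot, arrays, h, h', h'', hd]) σ

/-- `colStep` evaluates the next Newton function at all rows, if column `c` of array `s` holds the
kernel values `G · (ξ c)` and the first `c` columns of array `d` hold the earlier Newton functions. -/
lemma colStep_reals {s d c : ℕ} (hs : s ≠ 6 ∧ s ≠ 7 ∧ s ≠ 8) (hd : d ≠ 6 ∧ d ≠ 7 ∧ d ≠ 8)
    (hsd : s ≠ d) {G : ℕ → ℕ → ℝ} {ξ : ℕ → ℕ} (hp : σ.ints 11 = ξ c) (hc : σ.ints 10 = c)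
    (hξ : ξ c < σ.ints 5) (hS : ∀ i < σ.ints 5, σ.reals s i c = G i (ξ c))
    (hX : ∀ i < σ.ints 5, ∀ k < c, σ.reals d i k = newton G ξ k i) (i j : ℕ) :
    ((colStep s d).exec W σ).reals d i j =
      if i < σ.ints 5 ∧ j = c then newton G ξ c i else σ.reals d i j := by
  set τ₀ := ((reduce s d 11).exec W σ).set (reg 8) √(((reduce s d 11).exec W σ).get (reg 6))
    with hτ₀
  have hn : ∀ i, newton G ξ c i = (G i (ξ c) - ∑ k ∈ Finset.range c,
      newton G ξ k (ξ c) * newton G ξ k i) /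
        √(G (ξ c) (ξ c) - ∑ k ∈ Finset.range c, newton G ξ k (ξ c) ^ 2) := by
    intro i
    rw [newton_eq, powerSq]
  have hroot : τ₀.get (reg 8) =
      √(G (ξ c) (ξ c) - ∑ k ∈ Finset.range c, newton G ξ k (ξ c) ^ 2) := by
    rw [hτ₀, State.get_set_self,
      reduce_get ⟨hs.1, hs.2.1⟩ ⟨hd.1, hd.2.1⟩ (by decide), hp, hc, hS _ hξ]
    congr 2
    refine Finset.sum_congr rfl fun k hk => ?_
    rw [hX _ hξ k (Finset.mem_range.1 hk), pow_two]
  have hints : ∀ v ≠ 8, τ₀.ints v = σ.ints v := fun v hv => by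
    rw [hτ₀, State.set_ints, reduce_ints hv]
  have h := State.iter_induction (σ := τ₀.tick.tick)
    (f := fun i τ => (seq (reduce s d 7) (.binary .div ⟨d, 7, 10⟩ (reg 6) (reg 8))).exec W
      (τ.setInt 7 i).tick) (n := τ₀.ints 5)
    (fun m τ => (∀ v, v ≠ 8 ∧ v ≠ 7 → τ.ints v = σ.ints v) ∧ τ.reals s = σ.reals s ∧
      τ.get (reg 8) = τ₀.get (reg 8) ∧ ∀ i j, τ.reals d i j =
        if i < m ∧ j = c then newton G ξ c i else σ.reals d i j)
    ⟨fun v hv => hints v hv.1, ?_, rfl, fun i j => ?_⟩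
    fun m hm τ ⟨k₁, k₂, k₃, k₄⟩ => ⟨fun v hv => ?_, ?_, ?_, fun i j => ?_⟩
  · exact (h.2.2.2 i j).trans (by rw [hints 5 (by decide)])
  · simp only [State.tick_reals, hτ₀]
    rw [State.set_reals_of_ne _ _ _ hs.2.2, reduce_reals hs.1 hs.2.1]
  · simp only [State.tick_reals, hτ₀, Nat.not_lt_zero, false_and, if_false]
    rw [State.set_reals_of_ne _ _ _ hd.2.2, reduce_reals hd.1 hd.2.1]
  · simp only [exec, State.tick_ints, State.set_ints]
    rw [reduce_ints hv.1, State.tick_ints, State.setInt_ints, if_neg hv.2, k₁ v hv]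
  · simp only [exec, State.tick_reals]
    rw [State.set_reals_of_ne _ _ _ hsd, reduce_reals hs.1 hs.2.1, State.tick_reals,
      State.setInt_reals, k₂]
  · rw [← k₃]
    simp only [exec, State.get_tick]
    rw [State.get_set_of_ne _ _ _ hd.2.2.symm, State.get, reduce_reals (by decide) (by decide),
      reduce_ints (by decide)]
    rfl
  · rw [hints 5 (by decide)] at hm
    have hX' : ∀ i < σ.ints 5, ∀ k < c, τ.reals d i k = newton G ξ k i := fun i hi k hk => by
      rw [k₄, if_neg fun h => hk.ne h.2, hX i hi k hk]
    have hval : ((reduce s d 7).exec W (τ.setInt 7 m).tick).get (reg 6) =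
        G m (ξ c) - ∑ k ∈ Finset.range c, newton G ξ k (ξ c) * newton G ξ k m := by
      rw [reduce_get ⟨hs.1, hs.2.1⟩ ⟨hd.1, hd.2.1⟩ (by decide)]
      simp only [State.tick_ints, State.tick_reals, State.setInt_ints, State.setInt_reals,
        k₁ 10 (by decide), k₁ 11 (by decide), hp, hc, k₂]
      simp only [if_true, show ¬ (10 = 7) by decide, show ¬ (11 = 7) by decide, if_false, hS m hm]
      congr 1
      refine Finset.sum_congr rfl fun k hk => ?_
      rw [hX' _ hξ k (Finset.mem_range.1 hk), hX' _ hm k (Finset.mem_range.1 hk)]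
    have hroot' : ((reduce s d 7).exec W (τ.setInt 7 m).tick).get (reg 8) =
        √(G (ξ c) (ξ c) - ∑ k ∈ Finset.range c, newton G ξ k (ξ c) ^ 2) := by
      rw [← hroot, ← k₃, State.get, reduce_reals (by decide) (by decide), reduce_ints (by decide)]
      rfl
    simp only [exec, State.tick_reals, BinOp.eval]
    rw [State.set_reals, hval, hroot', ← hn, reduce_reals hd.1 hd.2.1, State.tick_reals,
      State.setInt_reals, k₄, reduce_ints (show 7 ≠ 8 by decide),
      reduce_ints (show 10 ≠ 8 by decide)]
    simp only [true_and, State.tick_ints, State.setInt_ints, k₁ 10 (by decide), hc, if_true,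
      show ¬ (10 = 7) by decide, if_false]
    by_cases hj : j = c
    · rcases lt_trichotomy i m with h | rfl | h
      · simp [hj, h, h.ne, h.trans (Nat.lt_succ_self m)]
      · simp [hj]
      · simp [hj, h.ne', h.not_gt, show ¬ i < m + 1 by omega]
    · simp [hj]

lemma argmax_ints {v : ℕ} (hv : v ≠ 9) (hv' : v ≠ 7) : (argmax.exec W σ).ints v = σ.ints v :=
  exec_ints_of_notMem _ (by simp [argmax, intVars, hv, hv']) σ

lemma argmax_reals {k : ℕ} : (argmax.exec W σ).reals k = σ.reals k :=
  exec_reals_of_notMem _ (by simp [argmax, arrays]) σ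

lemma argmax_spec (h0 : 0 < σ.ints 0) (h2 : σ.ints 2 = 0) :
    (argmax.exec W σ).ints 9 < σ.ints 0 ∧ ∀ i < σ.ints 0,
      σ.reals 4 i 0 ≤ σ.reals 4 ((argmax.exec W σ).ints 9) 0 := by
  have h := State.iter_induction (σ := (σ.setInt 9 0).tick.tick)
    (f := fun i τ => (ifRealLe ⟨4, 9, 2⟩ ⟨4, 7, 2⟩ (.intAdd 9 7 2) .skip).exec W
      (τ.setInt 7 i).tick) (n := σ.ints 0)
    (fun m τ => τ.ints 2 = 0 ∧ τ.reals = σ.reals ∧ τ.ints 9 < σ.ints 0 ∧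
      ∀ i < m, σ.reals 4 i 0 ≤ σ.reals 4 (τ.ints 9) 0)
    ⟨h2, rfl, h0, fun i hi => absurd hi (Nat.not_lt_zero i)⟩ fun m hm τ ⟨k₁, k₂, k₃, k₄⟩ => ?_
  · exact h.2.2
  · rw [exec]
    split_ifs with hle
    · simp only [State.get, State.tick_ints, State.tick_reals, State.setInt_reals,
        State.setInt_ints, k₁, k₂] at hle
      norm_num at hle
      refine ⟨by simp [exec, State.setInt_ints, k₁], by simpa [exec] using k₂,
        by simpa [exec, State.setInt_ints, k₁] using hm, fun i hi => ?_⟩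
      simp only [exec, State.setInt_ints, State.tick_ints]
      norm_num [k₁]
      rcases Nat.lt_succ_iff_lt_or_eq.1 hi with h | rfl
      · exact (k₄ i h).trans hle
      · exact le_rfl
    · simp only [State.get, State.tick_ints, State.tick_reals, State.setInt_reals,
        State.setInt_ints, k₁, k₂] at hle
      norm_num at hle
      refine ⟨by simpa [exec, State.setInt_ints] using k₁, by simpa [exec] using k₂,
        by simpa [exec, State.setInt_ints] using k₃, fun i hi => ?_⟩
      simp only [exec, State.setInt_ints, State.tick_ints]
      norm_num
      rcases Nat.lt_succ_iff_lt_or_eq.1 hi with h | rfl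
      · exact k₄ i h
      · exact hle.le

end Cmd

namespace Cmd

variable {W : World} {σ : State}

open scoped Classical in
/-- A loop whose iteration `m` assigns the values `val` to the entries of array `d` at the
positions `P m`. -/
lemma exec_loop_reals {c : Cmd} {v w d : ℕ} (P : ℕ → ℕ → ℕ → Prop) (val : ℕ → ℕ → ℝ)
    (hb : ∀ m < σ.ints w, ∀ τ : State, (∀ u, u ≠ v → u ∉ c.intVars → τ.ints u = σ.ints u) →
      τ.ints v = m → (∀ k, k ∉ c.arrays → τ.reals k = σ.reals k) →
      (∀ i j, (∀ m' < m, ¬ P m' i j) → τ.reals d i j = σ.reals d i j) →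
      ∀ i j, (c.exec W τ).reals d i j = if P m i j then val i j else τ.reals d i j) (i j : ℕ) :
    ((loop v w c).exec W σ).reals d i j =
      if ∃ m < σ.ints w, P m i j then val i j else σ.reals d i j := by
  have h := State.iter_induction (σ := σ.tick)
    (f := fun i τ => c.exec W (τ.setInt v i).tick) (n := σ.ints w)
    (fun m τ => (∀ u, u ≠ v → u ∉ c.intVars → τ.ints u = σ.ints u) ∧
      (∀ k, k ∉ c.arrays → τ.reals k = σ.reals k) ∧
      ∀ i j, τ.reals d i j = if ∃ m' < m, P m' i j then val i j else σ.reals d i j)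
    ⟨fun _ _ _ => rfl, fun _ _ => rfl, fun i j => by simp⟩
    fun m hm τ ⟨k₁, k₂, k₃⟩ => ⟨fun u hu hu' => ?_, fun k hk => ?_, fun i j => ?_⟩
  · exact h.2.2 i j
  · rw [exec_ints_of_notMem _ hu', State.tick_ints, State.setInt_ints, if_neg hu, k₁ u hu hu']
  · rw [exec_reals_of_notMem _ hk, State.tick_reals, State.setInt_reals, k₂ k hk]
  · rw [hb m hm (τ.setInt v m).tick (fun u hu hu' => by
      rw [State.tick_ints, State.setInt_ints, if_neg hu, k₁ u hu hu'])
      (by rw [State.tick_ints, State.setInt_ints, if_pos rfl]) k₂ (fun i j hij => by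
        rw [State.tick_reals, State.setInt_reals, k₃, if_neg]
        rintro ⟨m', h1, h2⟩
        exact hij m' h1 h2), State.tick_reals, State.setInt_reals, k₃]
    by_cases hP : P m i j
    · rw [if_pos hP, if_pos ⟨m, Nat.lt_succ_self m, hP⟩]
    · rw [if_neg hP]
      congr 1
      rw [eq_iff_iff]
      constructor
      · rintro ⟨m', h1, h2⟩
        exact ⟨m', h1.trans (Nat.lt_succ_self m), h2⟩
      · rintro ⟨m', h1, h2⟩
        rcases Nat.lt_succ_iff_lt_or_eq.1 h1 with h3 | rfl
        · exact ⟨m', h3, h2⟩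
        · exact absurd h2 hP

/-- Upper bounds for the integer variables. Variable `5` takes the values `2, 3, 4` during `setup`,
which explains the summand `4`. -/
def bnd (n T D : ℕ) : ℕ → ℕ
  | 0 => n
  | 1 => T
  | 3 => 1
  | 4 => D
  | 5 => n + D + 4
  | 6 => n + T
  | 7 => n + D + 4
  | 8 => D
  | 9 => n + D + 4
  | 10 => D
  | 11 => n + D + 4
  | 12 => n + D
  | _ => 0

lemma bnd_mono {n T D D' : ℕ} (h : D ≤ D') (v : ℕ) : bnd n T D v ≤ bnd n T D' v := by
  unfold bnd
  split <;> omega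

/-- The state of the integer variables and registers that the main part of the program only
reads. -/
structure HasInput (n T : ℕ) (lam R B δ e : ℝ) (σ : State) : Prop where
  ints0 : σ.ints 0 = n
  ints1 : σ.ints 1 = T
  ints2 : σ.ints 2 = 0
  ints3 : σ.ints 3 = 1
  reals17 : σ.reals 17 0 0 = e ^ 2
  reals20 : σ.reals 20 0 0 = lam
  reals21 : σ.reals 21 0 0 = R
  reals22 : σ.reals 22 0 0 = B
  reals23 : σ.reals 23 0 0 = δ
  reals24 : σ.reals 24 0 0 = e

variable {n T : ℕ} {lam R B δ e : ℝ}

lemma HasInput.exec (h : HasInput n T lam R B δ e σ) (c : Cmd)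
    (hc : (∀ v ∈ c.intVars, 4 ≤ v) ∧ ∀ k ∈ c.arrays, k < 17) :
    HasInput n T lam R B δ e (c.exec W σ) := by
  have h1 : ∀ v < 4, (c.exec W σ).ints v = σ.ints v := fun v hv =>
    exec_ints_of_notMem c (fun h => by have := hc.1 v h; omega) σ
  have h2 : ∀ k, 17 ≤ k → (c.exec W σ).reals k = σ.reals k := fun k hk =>
    exec_reals_of_notMem c (fun h => by have := hc.2 k h; omega) σ
  constructor
  · rw [h1 0 (by decide), h.ints0]
  · rw [h1 1 (by decide), h.ints1]
  · rw [h1 2 (by decide), h.ints2]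
  · rw [h1 3 (by decide), h.ints3]
  · rw [h2 17 (by decide), h.reals17]
  · rw [h2 20 (by decide), h.reals20]
  · rw [h2 21 (by decide), h.reals21]
  · rw [h2 22 (by decide), h.reals22]
  · rw [h2 23 (by decide), h.reals23]
  · rw [h2 24 (by decide), h.reals24]

lemma HasInput.setInt (h : HasInput n T lam R B δ e σ) {v : ℕ} (hv : 4 ≤ v) (k : ℕ) :
    HasInput n T lam R B δ e (σ.setInt v k) := by
  have h1 : ∀ u < 4, (σ.setInt v k).ints u = σ.ints u := fun u hu => by
    rw [State.setInt_ints, if_neg (by omega)]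
  exact ⟨(h1 0 (by decide)).trans h.ints0, (h1 1 (by decide)).trans h.ints1,
    (h1 2 (by decide)).trans h.ints2, (h1 3 (by decide)).trans h.ints3, h.reals17, h.reals20,
    h.reals21, h.reals22, h.reals23, h.reals24⟩

lemma HasInput.tick (h : HasInput n T lam R B δ e σ) : HasInput n T lam R B δ e σ.tick :=
  ⟨h.ints0, h.ints1, h.ints2, h.ints3, h.reals17, h.reals20, h.reals21, h.reals22, h.reals23,
    h.reals24⟩

/-! ### The P-greedy algorithm as a program -/

/-- Copy the parameters to the registers `20, …, 24` and the square of the admissible error to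
register `17`. The number of arms is stored in variable `5`. -/
def setup : Cmd :=
  .seq (.unary .copy (reg 20) ⟨0, 2, 2⟩) <| .seq (.intConst 3 1) <|
  .seq (.unary .copy (reg 21) ⟨0, 2, 3⟩) <| .seq (.intConst 5 2) <|
  .seq (.unary .copy (reg 22) ⟨0, 2, 5⟩) <| .seq (.intConst 5 3) <|
  .seq (.unary .copy (reg 23) ⟨0, 2, 5⟩) <| .seq (.intConst 5 4) <|
  .seq (.unary .copy (reg 24) ⟨0, 2, 5⟩) <| .seq (.binary .mul (reg 17) (reg 24) (reg 24))
  (.intAdd 5 0 2)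

/-- Store the diagonal of the kernel in array `4`. -/
def diagonal : Cmd := .loop 7 0 (.kernel ⟨4, 7, 2⟩ 7 7)

/-- Store the values of the kernel at all arms and the arm in variable `11` in column `10` of
array `3`. -/
def kernelColumn : Cmd := .loop 7 0 (.kernel ⟨3, 7, 10⟩ 7 11)

/-- Subtract the squares of column `10` of array `1` from array `4`. -/
def subtractSquares : Cmd :=
  .loop 7 0 (.seq (.binary .mul (reg 7) ⟨1, 7, 10⟩ ⟨1, 7, 10⟩)
    (.binary .sub ⟨4, 7, 2⟩ ⟨4, 7, 2⟩ (reg 7)))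

/-- Select the point in variable `9`: compute the next Newton function, update the power function,
and find a maximizer. The threshold in register `16` is initially `0`, so that at least one point is
selected, and `e²` from then on. -/
def newPoint : Cmd :=
  .seq (.intAdd 10 4 2) <| .seq (.intAdd 11 9 2) <| .seq kernelColumn <| .seq (colStep 3 1) <|
  .seq subtractSquares <| .seq (.unary .copy (reg 16) (reg 17)) argmax

/-- One iteration of the P-greedy algorithm. Nothing happens once it has finished. -/
def greedyStep : Cmd :=
  .ifRealLe (reg 16) ⟨4, 9, 2⟩ (.seq newPoint (.intAdd 4 4 3)) .skip

/-- The P-greedy algorithm. After at most `n` iterations all arms are selected. -/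
def pGreedy : Cmd := .seq setup (.seq diagonal (.seq argmax (.loop 6 0 greedyStep)))

lemma kernelColumn_reals (i j : ℕ) : (kernelColumn.exec W σ).reals 3 i j =
    if i < σ.ints 0 ∧ j = σ.ints 10 then W.kernel i (σ.ints 11) else σ.reals 3 i j := by
  have h := exec_loop_reals (W := W) (σ := σ) (c := .kernel ⟨3, 7, 10⟩ 7 11) (v := 7) (w := 0)
    (d := 3) (fun m i j => i = m ∧ j = σ.ints 10) (fun i _ => W.kernel i (σ.ints 11))
    (fun m _ τ h1 h2 _ _ i j => by
      simp only [exec, State.tick_reals, State.set_reals, h2, true_and,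
        h1 10 (by decide) (by simp [intVars]), h1 11 (by decide) (by simp [intVars])]
      by_cases h : i = m <;> simp [h]) i j
  rw [kernelColumn, h]
  simp

lemma diagonal_reals (h2 : σ.ints 2 = 0) (i : ℕ) (hi : i < σ.ints 0) :
    (diagonal.exec W σ).reals 4 i 0 = W.kernel i i := by
  have h := exec_loop_reals (W := W) (σ := σ) (c := .kernel ⟨4, 7, 2⟩ 7 7) (v := 7) (w := 0)
    (d := 4) (fun m i j => i = m ∧ j = 0) (fun i _ => W.kernel i i)
    (fun m _ τ h1 h3 _ _ i j => by
      simp only [exec, State.tick_reals, State.set_reals, h3, true_and,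
        h1 2 (by decide) (by simp [intVars]), h2]
      by_cases h : i = m <;> simp [h]) i 0
  rw [diagonal, h, if_pos ⟨i, hi, rfl, rfl⟩]

lemma subtractSquares_reals (h2 : σ.ints 2 = 0) (i : ℕ) (hi : i < σ.ints 0) :
    (subtractSquares.exec W σ).reals 4 i 0 =
      σ.reals 4 i 0 - σ.reals 1 i (σ.ints 10) ^ 2 := by
  have h := exec_loop_reals (W := W) (σ := σ)
    (c := (.seq (.binary .mul (reg 7) ⟨1, 7, 10⟩ ⟨1, 7, 10⟩)
      (.binary .sub ⟨4, 7, 2⟩ ⟨4, 7, 2⟩ (reg 7)))) (v := 7) (w := 0)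
    (d := 4) (fun m i j => i = m ∧ j = 0)
    (fun i _ => σ.reals 4 i 0 - σ.reals 1 i (σ.ints 10) ^ 2)
    (fun m _ τ h1 h3 h4 h5 i j => by
      have e1 := h1 2 (by decide) (by simp [intVars])
      have e2 := h1 10 (by decide) (by simp [intVars])
      have e3 := h4 1 (by simp [arrays])
      have e4 := h5 m 0 (fun m' hm' h => by omega)
      by_cases h : i = m ∧ j = 0
      · rw [if_pos h, h.1, h.2]
        simp [exec, State.set_reals, State.get, BinOp.eval, e1, e2, e3, e4, h2, h3, pow_two]
      · rw [if_neg h]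
        simp [exec, State.set_reals, BinOp.eval, e1, h2, h3, h]) i 0
  rw [subtractSquares, h, if_pos ⟨i, hi, rfl, rfl⟩]

lemma newPoint_ints {v : ℕ} (hv : v < 7) : (newPoint.exec W σ).ints v = σ.ints v :=
  exec_ints_of_notMem _ (by
    have h : ∀ u ∈ newPoint.intVars, 7 ≤ u := by decide
    exact fun h' => by have := h v h'; omega) σ

/-- The effect of selecting the point `p` as the point with number `D`. -/
lemma newPoint_spec {D : ℕ} {ξ : ℕ → ℕ} (h0 : σ.ints 0 = n) (h2 : σ.ints 2 = 0)
    (h4 : σ.ints 4 = D) (h5 : σ.ints 5 = n) (h9 : σ.ints 9 = ξ D) (hp : ξ D < n)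
    (hbasis : ∀ i < n, ∀ k < D, σ.reals 1 i k = newton W.kernel ξ k i)
    (hpower : ∀ i < n, σ.reals 4 i 0 = powerSq W.kernel ξ D i) :
    (∀ i j, (newPoint.exec W σ).reals 1 i j =
      if i < n ∧ j = D then newton W.kernel ξ D i else σ.reals 1 i j) ∧
    (∀ i < n, (newPoint.exec W σ).reals 4 i 0 = powerSq W.kernel ξ (D + 1) i) ∧
    (newPoint.exec W σ).reals 16 0 0 = σ.reals 17 0 0 ∧
    (newPoint.exec W σ).ints 9 < n ∧ ∀ i < n, powerSq W.kernel ξ (D + 1) i ≤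
      powerSq W.kernel ξ (D + 1) ((newPoint.exec W σ).ints 9) := by
  set σ₁ := (intAdd 11 9 2).exec W ((intAdd 10 4 2).exec W σ) with hσ₁
  have a1 : ∀ v, v ≠ 10 ∧ v ≠ 11 → σ₁.ints v = σ.ints v := fun v hv => by
    simp [hσ₁, exec, State.setInt_ints, hv]
  have a2 : σ₁.ints 10 = D := by simp [hσ₁, exec, State.setInt_ints, h4, h2]
  have a3 : σ₁.ints 11 = ξ D := by simp [hσ₁, exec, State.setInt_ints, h9, h2]
  have a4 : σ₁.reals = σ.reals := rfl
  set σ₂ := kernelColumn.exec W σ₁ with hσ₂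
  have b1 : ∀ v, v ≠ 7 → σ₂.ints v = σ₁.ints v := fun v hv =>
    exec_ints_of_notMem _ (by simp [kernelColumn, intVars, hv]) _
  have b2 : ∀ k, k ≠ 3 → σ₂.reals k = σ.reals k := fun k hk =>
    exec_reals_of_notMem _ (by simp [kernelColumn, arrays, hk]) _
  have b3 : ∀ i < n, σ₂.reals 3 i D = W.kernel i (ξ D) := fun i hi => by
    rw [hσ₂, kernelColumn_reals, if_pos ⟨by rw [a1 0 (by decide), h0]; exact hi, a2.symm⟩, a3]
  set σ₃ := (colStep 3 1).exec W σ₂ with hσ₃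
  have c0 : σ₂.ints 5 = n := by rw [b1 5 (by decide), a1 5 (by decide), h5]
  have c1 : ∀ v, v ≠ 7 ∧ v ≠ 8 → σ₃.ints v = σ₁.ints v := fun v hv => by
    rw [hσ₃, colStep_ints hv.2 hv.1, b1 v hv.1]
  have c2 : ∀ i j, σ₃.reals 1 i j =
      if i < n ∧ j = D then newton W.kernel ξ D i else σ.reals 1 i j := fun i j => by
    rw [hσ₃, colStep_reals (G := W.kernel) (ξ := ξ) (c := D) (by decide) (by decide) (by decide)
      (by rw [b1 11 (by decide), a3]) (by rw [b1 10 (by decide), a2]) (by rw [c0]; exact hp)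
      (by rw [c0]; exact b3) (by rw [c0, b2 1 (by decide)]; exact hbasis), c0, b2 1 (by decide)]
  have c3 : ∀ k, k = 4 ∨ k = 17 → σ₃.reals k = σ.reals k := fun k hk => by
    rw [hσ₃, colStep_reals_of_ne (by omega) (by omega) (by omega) (by omega), b2 k (by omega)]
  set σ₄ := subtractSquares.exec W σ₃ with hσ₄
  have d1 : ∀ v, v ≠ 7 → σ₄.ints v = σ₃.ints v := fun v hv =>
    exec_ints_of_notMem _ (by simp [subtractSquares, intVars, hv]) _
  have d2 : ∀ k, k ≠ 4 ∧ k ≠ 7 → σ₄.reals k = σ₃.reals k := fun k hk =>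
    exec_reals_of_notMem _ (by simp [subtractSquares, arrays, hk]) _
  have d3 : ∀ i < n, σ₄.reals 4 i 0 = powerSq W.kernel ξ (D + 1) i := fun i hi => by
    have e0 : σ₃.ints 0 = n := by rw [c1 0 (by decide), a1 0 (by decide), h0]
    have e2 : σ₃.ints 2 = 0 := by rw [c1 2 (by decide), a1 2 (by decide), h2]
    rw [hσ₄, subtractSquares_reals e2 i (by rw [e0]; exact hi), c3 4 (by decide), hpower i hi,
      c1 10 (by decide), a2, c2, if_pos ⟨hi, rfl⟩, powerSq_succ]
  set σ₅ := (unary .copy (reg 16) (reg 17)).exec W σ₄ with hσ₅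
  have f2 : σ₄.ints 2 = 0 := by
    rw [d1 2 (by decide), c1 2 (by decide), a1 2 (by decide), h2]
  have f0 : σ₅.ints 0 = n := by
    change σ₄.ints 0 = n
    rw [d1 0 (by decide), c1 0 (by decide), a1 0 (by decide), h0]
  have f3 : ∀ k ≠ 16, σ₅.reals k = σ₄.reals k := fun k hk => State.set_reals_of_ne _ _ _ hk
  have hfin : newPoint.exec W σ = argmax.exec W σ₅ := rfl
  have hbest := argmax_spec (W := W) (σ := σ₅) (by rw [f0]; omega) f2
  simp only [hfin, argmax_reals]
  refine ⟨fun i j => ?_, fun i hi => ?_, ?_, ?_, fun i hi => ?_⟩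
  · rw [f3 1 (by decide), d2 1 (by decide), c2]
  · rw [f3 4 (by decide), d3 i hi]
  · rw [← c3 17 (by decide), ← d2 17 (by decide)]
    simp [hσ₅, exec, State.set_reals, State.get, UnOp.eval, f2]
  · rw [← f0]; exact hbest.1
  · have h1 := hbest.2 i (by rw [f0]; exact hi)
    rw [f3 4 (by decide), d3 i hi, d3 _ (by rw [← f0]; exact hbest.1)] at h1
    exact h1

/-- The state after `i` iterations of the P-greedy algorithm, in which the points
`ξ_0, …, ξ_{D-1}` have been selected. -/
structure GreedyInv (W : World) (n T : ℕ) (lam R B δ e : ℝ) (i D : ℕ) (ξ : ℕ → ℕ) (σ : State) :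
    Prop where
  input : HasInput n T lam R B δ e σ
  ints4 : σ.ints 4 = D
  ints5 : σ.ints 5 = n
  threshold : σ.reals 16 0 0 = if D = 0 then 0 else e ^ 2
  mem : ∀ m < D, ξ m < n
  greedy : ∀ m < D, ∀ x < n, powerSq W.kernel ξ m x ≤ powerSq W.kernel ξ m (ξ m)
  not_before : ∀ m, 0 < m → m < D → e ^ 2 ≤ powerSq W.kernel ξ m (ξ m)
  basis : ∀ i < n, ∀ k < D, σ.reals 1 i k = newton W.kernel ξ k i
  zero : ∀ i, n ≤ i → ∀ j, σ.reals 1 i j = 0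
  power : ∀ i < n, σ.reals 4 i 0 = powerSq W.kernel ξ D i
  best_lt : σ.ints 9 < n
  best : ∀ i < n, powerSq W.kernel ξ D i ≤ powerSq W.kernel ξ D (σ.ints 9)
  finished : D = i ∨ (0 < D ∧ powerSq W.kernel ξ D (σ.ints 9) < e ^ 2)
  bound : ∀ v, σ.ints v ≤ bnd n T D v
  steps : σ.steps ≤ 20 + 10 * n + 2 * i + D * (61 * ((n + D + 1) * (D + 1)))

lemma newPoint_cost (n T D : ℕ) :
    newPoint.IsBounded (bnd n T D) ∧ newPoint.cost (bnd n T D) ≤ 60 * ((n + D + 1) * (D + 1)) := by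
  constructor
  · simp [newPoint, IsBounded, kernelColumn, colStep, reduce, dot, subtractSquares, argmax, bnd]
    omega
  · simp only [newPoint, cost, kernelColumn, colStep, reduce, dot, subtractSquares, argmax, bnd]
    nlinarith [Nat.zero_le (n * D), Nat.zero_le (D * D)]

/-- As the power function is positive on the diagonal, the comparison with the threshold fails only
if at least one point has been selected and the P-greedy algorithm has finished. -/
lemma GreedyInv.step (hdiag : ∀ i < n, 0 < W.kernel i i) {i D : ℕ} {ξ : ℕ → ℕ}
    (h : GreedyInv W n T lam R B δ e i D ξ σ) (hi : i < n) :
    ∃ D' ξ', GreedyInv W n T lam R B δ e (i + 1) D' ξ'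
      (greedyStep.exec W (σ.setInt 6 i).tick) := by
  set τ := (σ.setInt 6 i).tick.tick with hτ
  have hτi : ∀ v ≠ 6, τ.ints v = σ.ints v := fun v hv => by
    simp [hτ, State.setInt_ints, hv]
  have hτr : τ.reals = σ.reals := rfl
  have hinp : HasInput n T lam R B δ e τ := (h.input.setInt (by decide) i).tick.tick
  have hbd : ∀ v, τ.ints v ≤ bnd n T D v := fun v => by
    by_cases hv : v = 6
    · subst hv
      simp only [hτ, State.tick_ints, State.setInt_ints, if_true, bnd]
      omega
    · rw [hτi v hv]; exact h.bound v
  have hst : τ.steps = σ.steps + 2 := rfl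
  have hguard : (σ.setInt 6 i).tick.get (reg 16) ≤ (σ.setInt 6 i).tick.get ⟨4, 9, 2⟩ ↔
      (if D = 0 then 0 else e ^ 2) ≤ powerSq W.kernel ξ D (σ.ints 9) := by
    rw [← h.power _ h.best_lt, ← h.threshold]
    simp [State.get, State.setInt_ints, h.input.ints2]
  rw [greedyStep, exec]
  split_ifs with hg <;> rw [hguard] at hg
  · -- a new point is selected
    set ξ' := Function.update ξ D (σ.ints 9) with hξ'
    have hξD : ξ' D = σ.ints 9 := Function.update_self ..
    have hξlt : ∀ m < D, ξ' m = ξ m := fun m hm => Function.update_of_ne hm.ne _ _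
    have hN : ∀ m < D, ∀ x, newton W.kernel ξ' m x = newton W.kernel ξ m x := fun m hm x =>
      newton_congr (fun k hk => hξlt k (hk.trans_lt hm)) x
    have hP : ∀ m ≤ D, ∀ x, powerSq W.kernel ξ' m x = powerSq W.kernel ξ m x := fun m hm x =>
      powerSq_congr (fun k hk => hξlt k (hk.trans_le hm)) x
    have hi5 : τ.ints 5 = n := by rw [hτi 5 (by decide), h.ints5]
    obtain ⟨k₁, k₂, k₃, k₄, k₅⟩ := newPoint_spec (W := W) (σ := τ) (D := D) (ξ := ξ')
      hinp.ints0 hinp.ints2 (by rw [hτi 4 (by decide), h.ints4]) hi5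
      (by rw [hτi 9 (by decide), hξD]) (by rw [hξD]; exact h.best_lt)
      (fun i hi k hk => by rw [hτr, h.basis i hi k hk, hN k hk])
      (fun i hi => by rw [hτr, h.power i hi, hP D le_rfl])
    obtain ⟨c₁, c₂⟩ := exec_steps_le (W := W) newPoint (newPoint_cost n T D).1 hbd
    have c₃ := (newPoint_cost n T D).2
    set ρ := newPoint.exec W τ with hρ
    have hρin : HasInput n T lam R B δ e ρ := hinp.exec newPoint (by decide)
    have hρ4 : ρ.ints 4 = D := by
      rw [hρ, newPoint_ints (by decide), hτi 4 (by decide), h.ints4]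
    have hfin : (newPoint.seq (intAdd 4 4 3)).exec W τ = (ρ.setInt 4 (D + 1)).tick := by
      rw [exec, exec, ← hρ, hρ4, hρin.ints3]
    have hfi : ∀ v ≠ 4, (ρ.setInt 4 (D + 1)).tick.ints v = ρ.ints v := fun v hv => by
      simp [State.setInt_ints, hv]
    rw [show (σ.setInt 6 i).tick.tick = τ from rfl, hfin]
    have hlast : e ^ 2 ≤ powerSq W.kernel ξ D (σ.ints 9) ∨ D = 0 := by
      by_cases hD : D = 0
      · exact Or.inr hD
      · rw [if_neg hD] at hg; exact Or.inl hg
    refine ⟨D + 1, ξ', (hρin.setInt (by decide) _).tick, by simp [State.setInt_ints], ?_, ?_, ?_,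
      ?_, ?_, ?_, ?_, ?_, ?_, ?_, ?_, ?_, ?_⟩
    · rw [hfi 5 (by decide), hρ, newPoint_ints (by decide), hi5]
    · rw [if_neg (Nat.succ_ne_zero D), State.tick_reals, State.setInt_reals, k₃, hinp.reals17]
    · intro m hm
      rcases Nat.lt_succ_iff_lt_or_eq.1 hm with hm | rfl
      · rw [hξlt m hm]; exact h.mem m hm
      · rw [hξD]; exact h.best_lt
    · intro m hm x hx
      rcases Nat.lt_succ_iff_lt_or_eq.1 hm with hm | rfl
      · rw [hP m hm.le, hP m hm.le, hξlt m hm]; exact h.greedy m hm x hx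
      · rw [hP m le_rfl, hP m le_rfl, hξD]; exact h.best x hx
    · intro m hm0 hm
      rcases Nat.lt_succ_iff_lt_or_eq.1 hm with hm | rfl
      · rw [hP m hm.le, hξlt m hm]; exact h.not_before m hm0 hm
      · rw [hP m le_rfl, hξD]; exact hlast.resolve_right hm0.ne'
    · intro x hx k hk
      rw [State.tick_reals, State.setInt_reals, k₁]
      rcases Nat.lt_succ_iff_lt_or_eq.1 hk with hk | rfl
      · rw [if_neg fun h => hk.ne h.2, hN k hk, hτr, h.basis x hx k hk]
      · rw [if_pos ⟨hx, rfl⟩]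
    · intro x hx j
      rw [State.tick_reals, State.setInt_reals, k₁, if_neg fun h => hx.not_gt h.1]
      exact h.zero x hx j
    · exact k₂
    · rw [hfi 9 (by decide)]; exact k₄
    · rw [hfi 9 (by decide)]; exact k₅
    · rcases h.finished with hD | hD
      · exact Or.inl (by rw [hD])
      · exact absurd hD.2 (not_lt.2 (hlast.resolve_right hD.1.ne'))
    · intro v
      by_cases hv : v = 4
      · subst hv; simp [State.setInt_ints, bnd]
      · rw [hfi v hv]; exact (c₁ v).trans (bnd_mono (Nat.le_succ D) v)
    · have hs := h.steps
      change ρ.steps + 1 ≤ _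
      nlinarith [Nat.zero_le (n * D), Nat.zero_le (D * D), Nat.zero_le (D * D * n),
        Nat.zero_le (D * D * D)]
  · -- the algorithm has finished
    have hD : D ≠ 0 := by
      rintro rfl
      refine hg ?_
      rw [if_pos rfl]
      simpa [powerSq] using (hdiag _ h.best_lt).le
    rw [if_neg hD, not_le] at hg
    refine ⟨D, ξ, hinp, by rw [exec, hτi 4 (by decide), h.ints4],
      by rw [exec, hτi 5 (by decide), h.ints5], h.threshold, h.mem, h.greedy, h.not_before,
      h.basis, h.zero, h.power, h.best_lt, h.best, Or.inr ⟨Nat.pos_of_ne_zero hD, hg⟩, hbd, ?_⟩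
    have hs := h.steps
    rw [exec, hst]
    omega

end Cmd

namespace Cmd

variable {W : World} {σ : State} {n T : ℕ} {lam R B δ e : ℝ}

lemma setup_input : HasInput n T lam R B δ e (setup.exec W (startState n T lam R B δ e)) := by
  constructor <;>
  simp [setup, exec, State.setInt_ints, State.set_reals, State.get, UnOp.eval, BinOp.eval,
    startState, pow_two]

lemma setup_ints (v : ℕ) : (setup.exec W (startState n T lam R B δ e)).ints v =
    if v = 5 then n else if v = 3 then 1 else if v = 0 then n else if v = 1 then T else 0 := by
  simp only [setup, exec, State.setInt_ints, State.set_ints, State.tick_ints, startState]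
  by_cases h5 : v = 5
  · simp [h5]
  · simp [h5]

/-- The program carries out the P-greedy algorithm: either it has met the stopping criterion, or `n`
different points have been selected, and then the power function vanishes at all arms. -/
lemma pGreedy_spec (hn : 0 < n) (he : 0 < e) (hsymm : ∀ i j, W.kernel i j = W.kernel j i)
    (hdiag : ∀ i < n, 0 < W.kernel i i) :
    ∃ D ξ, GreedyInv W n T lam R B δ e n D ξ (pGreedy.exec W (startState n T lam R B δ e)) ∧
      IsPGreedy W.kernel (Finset.range n) e D ξ := by
  set σ₁ := setup.exec W (startState n T lam R B δ e) with hσ₁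
  have hin₁ : HasInput n T lam R B δ e σ₁ := setup_input
  have hbd₁ : ∀ v, σ₁.ints v ≤ bnd n T 0 v := fun v => by
    rw [hσ₁, setup_ints]
    split_ifs with h5 h3 h0 h1
    · subst h5; simp only [bnd]; omega
    · subst h3; simp [bnd]
    · subst h0; simp [bnd]
    · subst h1; simp [bnd]
    · exact Nat.zero_le _
  set σ₂ := diagonal.exec W σ₁ with hσ₂
  have hin₂ : HasInput n T lam R B δ e σ₂ := hin₁.exec _ (by decide)
  set σ₃ := argmax.exec W σ₂ with hσ₃
  have hin₃ : HasInput n T lam R B δ e σ₃ := hin₂.exec _ (by decide)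
  have hdiag₃ : ∀ i < n, σ₃.reals 4 i 0 = powerSq W.kernel (fun _ => 0) 0 i := fun i hi => by
    rw [hσ₃, argmax_reals, hσ₂, diagonal_reals hin₁.ints2 i (by rw [hin₁.ints0]; exact hi)]
    simp [powerSq]
  have hbest := argmax_spec (W := W) (σ := σ₂) (by rw [hin₂.ints0]; exact hn) hin₂.ints2
  rw [← hσ₃, hin₂.ints0] at hbest
  have hreals : ∀ k, k = 1 ∨ k = 16 → σ₃.reals k = fun _ _ => 0 := fun k hk => by
    rw [hσ₃, argmax_reals, hσ₂, exec_reals_of_notMem _ (by simp [diagonal, arrays]; omega), hσ₁,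
      exec_reals_of_notMem _ (by simp [setup, arrays]; omega)]
    funext i j
    simp only [startState]
    rw [if_neg (by omega)]
  have hints : ∀ v, v = 4 ∨ v = 5 → σ₃.ints v = σ₁.ints v := fun v hv => by
    rw [hσ₃, argmax_ints (by omega) (by omega), hσ₂,
      exec_ints_of_notMem _ (by simp [diagonal, intVars]; omega)]
  obtain ⟨b₂, s₂⟩ := exec_steps_le (W := W) diagonal (β := bnd n T 0)
    (by simp only [diagonal, IsBounded, bnd, and_true]; omega) hbd₁
  obtain ⟨b₃, s₃⟩ := exec_steps_le (W := W) argmax (β := bnd n T 0)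
    (by simp only [argmax, IsBounded, bnd, and_true]; omega) b₂
  rw [← hσ₂] at s₂ s₃
  rw [← hσ₃] at s₃ b₃
  have s₁ : σ₁.steps = 11 := rfl
  have hinv₀ : GreedyInv W n T lam R B δ e 0 0 (fun _ => 0) σ₃.tick := by
    refine ⟨hin₃.tick, ?_, ?_, ?_, fun m hm => absurd hm (Nat.not_lt_zero m),
      fun m hm => absurd hm (Nat.not_lt_zero m), fun m _ hm => absurd hm (Nat.not_lt_zero m),
      fun i _ k hk => absurd hk (Nat.not_lt_zero k), ?_, hdiag₃, hbest.1, ?_, Or.inl rfl, b₃, ?_⟩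
    · rw [State.tick_ints, hints 4 (by decide), hσ₁, setup_ints]; rfl
    · rw [State.tick_ints, hints 5 (by decide), hσ₁, setup_ints]; rfl
    · rw [State.tick_reals, hreals 16 (by decide)]; rfl
    · intro i _ j
      rw [State.tick_reals, hreals 1 (by decide)]
    · intro i hi
      have := hbest.2 i hi
      rw [← argmax_reals (W := W) (σ := σ₂) (k := 4), ← hσ₃, hdiag₃ i hi, hdiag₃ _ hbest.1] at this
      exact this
    · rw [State.tick_steps]
      simp only [diagonal, argmax, cost, bnd] at s₂ s₃
      omega
  have hfin := State.iter_induction (σ := σ₃.tick)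
    (f := fun i τ => greedyStep.exec W (τ.setInt 6 i).tick) (n := n)
    (fun i τ => ∃ D ξ, GreedyInv W n T lam R B δ e i D ξ τ) ⟨0, _, hinv₀⟩
    fun i hi τ ⟨D, ξ, h⟩ => h.step hdiag hi
  obtain ⟨D, ξ, h⟩ := hfin
  have hexec : pGreedy.exec W (startState n T lam R B δ e) = State.iter
      (fun i τ => greedyStep.exec W (τ.setInt 6 i).tick) n σ₃.tick := by
    rw [pGreedy, exec, exec, exec, exec, ← hσ₁, ← hσ₂, ← hσ₃, hin₃.ints0]
  have hD0 : 0 < D := by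
    rcases h.finished with rfl | h
    exacts [hn, h.1]
  have hpos : ∀ m < D, 0 < powerSq W.kernel ξ m (ξ m) := by
    intro m hm
    rcases Nat.eq_zero_or_pos m with rfl | h0
    · simpa [powerSq] using hdiag _ (h.mem 0 hm)
    · exact (pow_pos he 2).trans_le (h.not_before m h0 hm)
  refine ⟨D, ξ, hexec ▸ h, hD0, fun m hm => Finset.mem_range.2 (h.mem m hm),
    fun m hm x hx => h.greedy m hm x (Finset.mem_range.1 hx), fun x hx => ?_,
    fun m hm0 hm => ⟨ξ m, Finset.mem_range.2 (h.mem m hm), h.not_before m hm0 hm⟩⟩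
  have hx := Finset.mem_range.1 hx
  rcases h.finished with hD | hD
  · -- all points are selected, and the power function vanishes there
    have hinj := injOn_of_powerSq_pos (fun j _ k _ => hsymm (ξ j) (ξ k)) hpos
    have himg : (Finset.range D).image ξ = Finset.range n := by
      refine Finset.eq_of_subset_of_card_le (fun y hy => ?_) ?_
      · obtain ⟨m, hm, rfl⟩ := Finset.mem_image.1 hy
        exact Finset.mem_range.2 (h.mem m (Finset.mem_range.1 hm))
      · rw [Finset.card_image_of_injOn (fun a ha b hb => hinj (by simpa using ha) (by simpa using hb)),
          Finset.card_range, Finset.card_range, hD]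
    obtain ⟨m, hm, rfl⟩ := Finset.mem_image.1 (himg ▸ Finset.mem_range.2 hx)
    rw [powerSq_self_eq_zero (fun j _ k _ => hsymm (ξ j) (ξ k)) hpos (Finset.mem_range.1 hm)
      le_rfl]
    positivity
  · exact (h.best x hx).trans_lt hD.2

/-- A run of the P-greedy algorithm on the numbers of the arms is a run on the arms. -/
lemma IsPGreedy_comp {X : Type*} {K : X → X → ℝ} {A : Finset X} {a : ℕ → X} {D : ℕ} {ξ : ℕ → ℕ}
    (ha : Set.BijOn a (Set.Iio A.card) A)
    (h : IsPGreedy (fun i j => K (a i) (a j)) (Finset.range A.card) e D ξ) :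
    IsPGreedy K A e D fun m => a (ξ m) := by
  have hA : ∀ x ∈ A, ∃ i ∈ Finset.range A.card, a i = x := fun x hx => by
    obtain ⟨i, hi, rfl⟩ := ha.surjOn hx
    exact ⟨i, Finset.mem_range.2 hi, rfl⟩
  refine ⟨h.pos, fun m hm => ha.mapsTo (Finset.mem_range.1 (h.mem m hm)), fun m hm x hx => ?_,
    fun x hx => ?_, fun m h0 hm => ?_⟩
  · obtain ⟨i, hi, rfl⟩ := hA x hx
    rw [powerSq_comp, powerSq_comp]
    exact h.greedy m hm i hi
  · obtain ⟨i, hi, rfl⟩ := hA x hx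
    rw [powerSq_comp]
    exact h.finished i hi
  · obtain ⟨i, hi, hle⟩ := h.not_before m h0 hm
    exact ⟨a i, ha.mapsTo (Finset.mem_range.1 hi), by rw [powerSq_comp]; exact hle⟩

end Cmd

/-! ### The Cholesky decomposition by Newton functions -/

section Cholesky

open Matrix

open scoped MatrixOrder Matrix.Norms.L2Operator in
/-- A square root of `M` serves as `Q`. -/
lemma exists_isUnit_transpose_mul_self {D : ℕ} {M : Matrix (Fin D) (Fin D) ℝ} (hM : M.PosDef) :
    ∃ Q : Matrix (Fin D) (Fin D) ℝ, IsUnit Q ∧ M = Qᵀ * Q := by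
  obtain ⟨Q, hQ, h⟩ := CStarAlgebra.isStrictlyPositive_iff_eq_star_mul_self.mp
    hM.isStrictlyPositive
  exact ⟨Q, hQ, by rw [h, star_eq_conjTranspose, conjTranspose_eq_transpose_of_trivial]⟩

variable {D n : ℕ} {M : Matrix (Fin D) (Fin D) ℝ} {tab : ℕ → ℕ → ℝ}

/-- If the rows `n, …, n + D - 1` of a table with `D` columns form the matrix `M`, then the table
is regarded as a kernel with values `K(i, n + c) = tab i c`; this is the matrix of its Newton
functions at the points `n, n + 1, …`. -/
abbrev tableNewton (n : ℕ) (tab : ℕ → ℕ → ℝ) (c i : ℕ) : ℝ :=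
  newton (fun i j => tab i (j - n)) (fun m => n + m) c i

/-- The lower triangular factor of the Cholesky decomposition. -/
def choleskyFactor (D n : ℕ) (tab : ℕ → ℕ → ℝ) : Matrix (Fin D) (Fin D) ℝ :=
  Matrix.of fun i j => tableNewton n tab j (n + i)

lemma table_symm (hM : M.PosDef) (htab : ∀ r c : Fin D, tab (n + r) c = M r c) :
    ∀ j < D, ∀ k < D, tab (n + j) (n + k - n) = tab (n + k) (n + j - n) := by
  intro j hj k hk
  have h1 := htab ⟨j, hj⟩ ⟨k, hk⟩
  have h2 := htab ⟨k, hk⟩ ⟨j, hj⟩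
  have h3 : M ⟨k, hk⟩ ⟨j, hj⟩ = M ⟨j, hj⟩ ⟨k, hk⟩ := by
    simpa using hM.isHermitian.apply ⟨j, hj⟩ ⟨k, hk⟩
  simp only [Nat.add_sub_cancel_left]
  exact h1.trans (h3.symm.trans h2.symm)

/-- With `M = Qᵀ Q` the kernel values are inner products of columns of `Q`, and these are linearly
independent. -/
lemma table_powerSq_pos (hM : M.PosDef) (htab : ∀ r c : Fin D, tab (n + r) c = M r c) :
    ∀ m < D, 0 < powerSq (fun i j => tab i (j - n)) (fun m => n + m) m (n + m) := by
  obtain ⟨Q, hQ, hMQ⟩ := exists_isUnit_transpose_mul_self hM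
  set u : ℕ → EuclideanSpace ℝ (Fin D) := fun x =>
    if h : x - n < D then WithLp.toLp 2 (Q.col ⟨x - n, h⟩) else 0 with hu
  have hun : ∀ m (h : m < D), u (n + m) = WithLp.toLp 2 (Q.col ⟨m, h⟩) := fun m h => by
    simp [hu, h]
  refine powerSq_pos (u := u) (S := (fun m => n + m) '' Set.Iio D) ?_
    (fun m hm => ⟨m, hm, rfl⟩) fun m hm => ?_
  · rintro _ ⟨r, hr, rfl⟩ _ ⟨c, hc, rfl⟩
    have h := htab ⟨r, hr⟩ ⟨c, hc⟩
    simp only [Nat.add_sub_cancel_left]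
    rw [hun r hr, hun c hc, h, hMQ, Matrix.mul_apply, EuclideanSpace.inner_eq_star_dotProduct]
    simp [dotProduct, Matrix.col, mul_comm]
  · have hli : LinearIndependent ℝ fun i : Fin D => u (n + i) := by
      have h1 := linearIndependent_cols_iff_isUnit.2 hQ
      have h2 := h1.map' (WithLp.linearEquiv 2 ℝ (Fin D → ℝ)).symm.toLinearMap
        (LinearEquiv.ker _)
      have h3 : (fun i : Fin D => u (n + i)) =
          (WithLp.linearEquiv 2 ℝ (Fin D → ℝ)).symm.toLinearMap ∘ Q.col :=
        funext fun i => hun i i.isLt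
      rw [h3]
      exact h2
    have h3 := hli.notMem_span_image (s := {i | (i : ℕ) < m}) (x := ⟨m, hm⟩) (by simp)
    have h4 : (fun k => u (n + k)) '' Set.Iio m =
        (fun i : Fin D => u (n + i)) '' {i | (i : ℕ) < m} := by
      ext z
      constructor
      · rintro ⟨k, hk, rfl⟩
        exact ⟨⟨k, lt_trans hk hm⟩, hk, rfl⟩
      · rintro ⟨k, hk, rfl⟩
        exact ⟨k, hk, rfl⟩
    rw [h4]
    exact h3

lemma choleskyFactor_eq_zero (hM : M.PosDef) (htab : ∀ r c : Fin D, tab (n + r) c = M r c)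
    (i j : Fin D) (hij : i < j) : choleskyFactor D n tab i j = 0 :=
  newton_eq_zero (K := fun i j => tab i (j - n)) (ξ := fun m => n + m) (table_symm hM htab)
    (table_powerSq_pos hM htab) hij j.isLt

lemma choleskyFactor_diag_pos (hM : M.PosDef) (htab : ∀ r c : Fin D, tab (n + r) c = M r c)
    (i : Fin D) : 0 < choleskyFactor D n tab i i := by
  have h := newton_self (K := fun i j => tab i (j - n)) (ξ := fun m => n + m) (m := i)
  rw [choleskyFactor, Matrix.of_apply, tableNewton, h]
  exact Real.sqrt_pos.2 (table_powerSq_pos hM htab i i.isLt)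

/-- The Newton functions at a row of the table solve the triangular system whose right hand side
is that row. -/
lemma choleskyFactor_mulVec (hM : M.PosDef) (htab : ∀ r c : Fin D, tab (n + r) c = M r c) (x : ℕ) :
    choleskyFactor D n tab *ᵥ (fun k : Fin D => tableNewton n tab k x) =
      fun c : Fin D => tab x c := by
  funext c
  have h := kernel_eq_sum_newton (table_powerSq_pos hM htab c c.isLt) x
  simp only [Nat.add_sub_cancel_left] at h
  rw [h, mulVec, dotProduct]
  simp only [choleskyFactor, Matrix.of_apply]
  rw [Fin.sum_univ_eq_sum_range (fun k => tableNewton n tab k (n + c) * tableNewton n tab k x) D]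
  symm
  refine Finset.sum_subset (fun k hk => ?_) fun k hk hk' => ?_
  · have := c.isLt
    rw [Finset.mem_range] at hk ⊢
    omega
  · rw [Finset.mem_range] at hk hk'
    have := choleskyFactor_eq_zero hM htab c ⟨k, hk⟩ (by
      rw [Fin.lt_def]; show (c : ℕ) < k; omega)
    rw [choleskyFactor, Matrix.of_apply] at this
    change tableNewton n tab k (n + c) * tableNewton n tab k x = 0
    rw [this, zero_mul]

lemma choleskyFactor_mul_transpose (hM : M.PosDef)
    (htab : ∀ r c : Fin D, tab (n + r) c = M r c) :
    choleskyFactor D n tab * (choleskyFactor D n tab)ᵀ = M := by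
  ext c r
  have h := congrFun (choleskyFactor_mulVec hM htab (n + r)) c
  rw [htab r c] at h
  have h3 : M r c = M c r := by simpa using hM.isHermitian.apply c r
  rw [← h3, ← h]
  rfl

lemma choleskyFactor_det (hM : M.PosDef) (htab : ∀ r c : Fin D, tab (n + r) c = M r c) :
    (choleskyFactor D n tab).det = ∏ i : Fin D, choleskyFactor D n tab i i :=
  Matrix.det_of_isLowerTriangular (M := choleskyFactor D n tab) fun i j hij =>
    choleskyFactor_eq_zero hM htab i j hij

lemma choleskyFactor_isUnit_det (hM : M.PosDef)
    (htab : ∀ r c : Fin D, tab (n + r) c = M r c) : IsUnit (choleskyFactor D n tab).det := by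
  rw [choleskyFactor_det hM htab]
  exact (Finset.prod_pos fun i _ => choleskyFactor_diag_pos hM htab i).ne'.isUnit

lemma tableNewton_eq_inv_mulVec (hM : M.PosDef)
    (htab : ∀ r c : Fin D, tab (n + r) c = M r c) (x : ℕ) :
    (fun k : Fin D => tableNewton n tab k x) =
      (choleskyFactor D n tab)⁻¹ *ᵥ fun c : Fin D => tab x c := by
  rw [← choleskyFactor_mulVec hM htab x, mulVec_mulVec,
    nonsing_inv_mul _ (choleskyFactor_isUnit_det hM htab), one_mulVec]

/-- The inverse of `M = L Lᵀ` as a bilinear form. -/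
lemma inv_mulVec_dotProduct_eq (hM : M.PosDef)
    (htab : ∀ r c : Fin D, tab (n + r) c = M r c) (u v : Fin D → ℝ) :
    (M⁻¹ *ᵥ u) ⬝ᵥ v =
      ((choleskyFactor D n tab)⁻¹ *ᵥ u) ⬝ᵥ ((choleskyFactor D n tab)⁻¹ *ᵥ v) := by
  rw [← choleskyFactor_mul_transpose hM htab, Matrix.mul_inv_rev, ← transpose_nonsing_inv,
    ← mulVec_mulVec, mulVec_transpose, dotProduct_mulVec]

/-- The objective of an arm in terms of solutions of triangular systems: row `x` of the table holds
the features of the arm and row `y` the right hand side `b` of the ridge regression. So the sample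
need not be computed itself, and the cost per arm is `O(D)`. -/
lemma sample_dotProduct_eq (hM : M.PosDef)
    (htab : ∀ r c : Fin D, tab (n + r) c = M r c) {b θ φ : Fin D → ℝ} (hθ : θ = M⁻¹ *ᵥ b) {x y : ℕ}
    (hx : ∀ c : Fin D, tab x c = φ c) (hy : ∀ c : Fin D, tab y c = b c) (v : ℝ) (ζ : Fin D → ℝ) :
    (θ + v • (choleskyFactor D n tab)⁻¹ᵀ *ᵥ ζ) ⬝ᵥ φ =
      ∑ k : Fin D, tableNewton n tab k x * (tableNewton n tab k y + v * ζ k) := by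
  have h1 := tableNewton_eq_inv_mulVec hM htab x
  have h2 := tableNewton_eq_inv_mulVec hM htab y
  rw [show (fun c : Fin D => tab x c) = φ from funext hx] at h1
  rw [show (fun c : Fin D => tab y c) = b from funext hy] at h2
  rw [add_dotProduct, hθ, inv_mulVec_dotProduct_eq hM htab, ← h1, ← h2, smul_dotProduct,
    mulVec_transpose, ← dotProduct_mulVec, ← h1]
  simp only [dotProduct, smul_eq_mul, Finset.mul_sum, ← Finset.sum_add_distrib]
  refine Finset.sum_congr rfl fun k _ => by ring

lemma mahalanobis_eq_sqrt_sum (hM : M.PosDef)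
    (htab : ∀ r c : Fin D, tab (n + r) c = M r c) {φ : Fin D → ℝ} {x : ℕ}
    (hx : ∀ c : Fin D, tab x c = φ c) :
    mahalanobis M φ = √(∑ k ∈ Finset.range D, tableNewton n tab k x * tableNewton n tab k x) := by
  have h1 := tableNewton_eq_inv_mulVec hM htab x
  rw [show (fun c : Fin D => tab x c) = φ from funext hx] at h1
  rw [mahalanobis, dotProduct_comm, inv_mulVec_dotProduct_eq hM htab, ← h1, Finset.sum_range]
  rfl

lemma det_inv_smul_eq_prod (hM : M.PosDef)
    (htab : ∀ r c : Fin D, tab (n + r) c = M r c) (lam : ℝ) :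
    (lam⁻¹ • M).det = ∏ k ∈ Finset.range D,
      (tableNewton n tab k (n + k) * tableNewton n tab k (n + k) / lam) := by
  rw [det_smul, ← choleskyFactor_mul_transpose hM htab, det_mul, det_transpose,
    choleskyFactor_det hM htab, Finset.prod_range, ← Finset.card_univ, ← Finset.prod_const,
    ← Finset.prod_mul_distrib, ← Finset.prod_mul_distrib]
  refine Finset.prod_congr rfl fun k _ => ?_
  rw [choleskyFactor, Matrix.of_apply, div_eq_inv_mul]

end Cholesky

namespace Cmd

/-! ### One round of Thompson Sampling as a program -/

/-! The rows `0, …, n - 1` of array `1` hold the features of the arms, the rows `n, …, n + D - 1` the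
matrix `A_t`, and row `n + D` the vector `∑ y_s φ_s`. Register `10` holds `ψ_t`. -/

/-- Initialize the matrix `A_0 = λ 1` and the number `n + D + 1` of rows. -/
def initRounds : Cmd :=
  .seq (.intAdd 12 0 4) <| .seq (.intAdd 5 12 3) <|
  .loop 10 4 (.seq (.intAdd 11 0 10) (.unary .copy ⟨1, 11, 10⟩ (reg 20)))

/-- Apply `L⁻¹` to all rows of array `1`, where `A_t = L Lᵀ`; in particular, the rows
`n, …, n + D - 1` of the result form `L`. -/
def cholesky : Cmd := .loop 10 4 (.seq (.intAdd 11 0 10) (colStep 1 2))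

/-- Compute `det (λ⁻¹ A_t)`. -/
def determinant : Cmd :=
  .seq (.realConst (reg 12) 1) <| .loop 10 4 <| .seq (.intAdd 11 0 10) <|
  .seq (.binary .mul (reg 7) ⟨2, 11, 10⟩ ⟨2, 11, 10⟩) <|
  .seq (.binary .div (reg 7) (reg 7) (reg 20)) (.binary .mul (reg 12) (reg 12) (reg 7))

/-- Compute the scale `R √(log (det (λ⁻¹ A_t) / (δ / 2)²)) + √λ B + B e ψ_t` of the sampling
distribution. -/
def scale : Cmd :=
  .seq (.realConst (reg 15) 2) <| .seq (.binary .div (reg 15) (reg 23) (reg 15)) <|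
  .seq (.binary .mul (reg 15) (reg 15) (reg 15)) <|
  .seq (.binary .div (reg 13) (reg 12) (reg 15)) <| .seq (.unary .log (reg 13) (reg 13)) <|
  .seq (.unary .sqrt (reg 13) (reg 13)) <| .seq (.binary .mul (reg 13) (reg 21) (reg 13)) <|
  .seq (.unary .sqrt (reg 15) (reg 20)) <| .seq (.binary .mul (reg 15) (reg 15) (reg 22)) <|
  .seq (.binary .add (reg 13) (reg 13) (reg 15)) <| .seq (.binary .mul (reg 15) (reg 22) (reg 24)) <|
  .seq (.binary .mul (reg 15) (reg 15) (reg 10)) (.binary .add (reg 13) (reg 13) (reg 15))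

/-- Draw `D` normal variables `ζ` and compute `Lᵀ μ_t = L⁻¹ ∑ y_s φ_s + v ζ`, with `v` in register
`13`. -/
def sample : Cmd :=
  .seq (.intAdd 11 0 4) <| .loop 10 4 <| .seq (.normal (reg 7)) <|
  .seq (.binary .mul (reg 7) (reg 13) (reg 7)) (.binary .add ⟨14, 2, 10⟩ ⟨2, 11, 10⟩ (reg 7))

/-- Compute the inner products `⟨L⁻¹ φ, Lᵀ μ_t⟩` of the features of the arms and `μ_t`. -/
def objective : Cmd := .loop 7 0 (.seq (dot 2 7 14 2 4) (.unary .copy ⟨4, 7, 2⟩ (reg 6)))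

/-- Add the norm of the feature vector of the selected arm to `ψ_t`. -/
def updatePsi : Cmd :=
  .seq (dot 2 9 2 9 4) <| .seq (.unary .sqrt (reg 6) (reg 6))
  (.binary .add (reg 10) (reg 10) (reg 6))

/-- With `p`, `c` and `r` the variables `9`, `10` and `11`, add `φ_c φ` to row `r` of array `1`, where
`φ` is row `p`. -/
def updateGramRow : Cmd :=
  .loop 8 4 (.seq (.binary .mul (reg 7) ⟨1, 9, 10⟩ ⟨1, 9, 8⟩)
    (.binary .add ⟨1, 11, 8⟩ ⟨1, 11, 8⟩ (reg 7)))

/-- Add `φ φᵀ` to the matrix `A_t`, where `φ` are the features of the selected arm. -/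
def updateGram : Cmd := .loop 10 4 (.seq (.intAdd 11 0 10) updateGramRow)

/-- Add `y φ` to the vector `∑ y_s φ_s`, where `y` is the reward in register `11`. -/
def updateVector : Cmd :=
  .seq (.intAdd 11 0 4) <| .loop 8 4 (.seq (.binary .mul (reg 7) (reg 11) ⟨1, 9, 8⟩)
    (.binary .add ⟨1, 11, 8⟩ ⟨1, 11, 8⟩ (reg 7)))

/-- One round of Thompson Sampling. -/
def round : Cmd :=
  .seq cholesky <| .seq determinant <| .seq scale <| .seq sample <| .seq objective <|
  .seq argmax <| .seq updatePsi <| .seq (.pull (reg 11) 9) <| .seq updateGram updateVector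

variable {W : World} {σ : State} {n T D : ℕ} {lam R B δ e : ℝ}

/-- The part of the state that is not changed by the rounds. -/
structure HasRoundInput (n T D : ℕ) (lam R B δ e : ℝ) (σ : State) : Prop extends
    HasInput n T lam R B δ e σ where
  ints4 : σ.ints 4 = D
  ints5 : σ.ints 5 = n + D + 1

lemma HasRoundInput.exec (h : HasRoundInput n T D lam R B δ e σ) (c : Cmd)
    (hc : (∀ v ∈ c.intVars, 6 ≤ v) ∧ ∀ k ∈ c.arrays, k < 17) :
    HasRoundInput n T D lam R B δ e (c.exec W σ) := by
  refine ⟨h.toHasInput.exec c ⟨fun v hv => by have := hc.1 v hv; omega, hc.2⟩, ?_, ?_⟩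
  · rw [exec_ints_of_notMem c (fun h => by have := hc.1 4 h; omega), h.ints4]
  · rw [exec_ints_of_notMem c (fun h => by have := hc.1 5 h; omega), h.ints5]

lemma cholesky_reals (h : HasRoundInput n T D lam R B δ e σ) :
    ∀ i < n + D + 1, ∀ k < D, (cholesky.exec W σ).reals 2 i k =
      tableNewton n (σ.reals 1) k i := by
  have hind := State.iter_induction (σ := σ.tick)
    (f := fun i τ => (seq (.intAdd 11 0 10) (colStep 1 2)).exec W (τ.setInt 10 i).tick) (n := D)
    (fun m τ => (∀ v < 6, τ.ints v = σ.ints v) ∧ τ.reals 1 = σ.reals 1 ∧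
      ∀ i < n + D + 1, ∀ k < m, τ.reals 2 i k = tableNewton n (σ.reals 1) k i)
    ⟨fun _ _ => rfl, rfl, fun _ _ k hk => absurd hk (Nat.not_lt_zero k)⟩
    fun m hm τ ⟨k₁, k₂, k₃⟩ => ?_
  · rw [cholesky, exec, h.ints4]
    exact hind.2.2
  · set ρ := (intAdd 11 0 10).exec W (τ.setInt 10 m).tick with hρ
    have r1 : ∀ v, v ≠ 10 ∧ v ≠ 11 → ρ.ints v = τ.ints v := fun v hv => by
      simp [hρ, exec, State.setInt_ints, hv]
    have r2 : ρ.ints 10 = m := by simp [hρ, exec, State.setInt_ints]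
    have r3 : ρ.ints 11 = n + m := by
      simp [hρ, exec, State.setInt_ints, k₁ 0 (by decide), h.ints0]
    have r4 : ρ.reals = τ.reals := rfl
    have r5 : ρ.ints 5 = n + D + 1 := by rw [r1 5 (by decide), k₁ 5 (by decide), h.ints5]
    have hexec : (seq (.intAdd 11 0 10) (colStep 1 2)).exec W (τ.setInt 10 m).tick =
      (colStep 1 2).exec W ρ := rfl
    rw [hexec]
    refine ⟨fun v hv => ?_, ?_, fun i hi k hk => ?_⟩
    · rw [colStep_ints (by omega) (by omega), r1 v (by omega), k₁ v hv]
    · rw [colStep_reals_of_ne (by decide) (by decide) (by decide) (by decide), r4, k₂]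
    · rw [colStep_reals (G := fun i j => σ.reals 1 i (j - n)) (ξ := fun m => n + m) (c := m)
        (by decide) (by decide) (by decide) r3 r2 (by rw [r5]; show n + m < _; omega)
        (fun i hi => by
          show ρ.reals 1 i m = σ.reals 1 i (n + m - n)
          rw [r4, k₂, Nat.add_sub_cancel_left])
        (fun i hi k hk => by rw [r5] at hi; rw [r4]; exact k₃ i hi k hk), r5, r4]
      rcases Nat.lt_succ_iff_lt_or_eq.1 hk with hk | rfl
      · rw [if_neg fun h => hk.ne h.2, k₃ i hi k hk]
      · rw [if_pos ⟨hi, rfl⟩]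

lemma determinant_reals (h : HasRoundInput n T D lam R B δ e σ) :
    (determinant.exec W σ).reals 12 0 0 =
      ∏ k ∈ Finset.range D, (σ.reals 2 (n + k) k * σ.reals 2 (n + k) k / lam) := by
  have hind := State.iter_induction (σ := (σ.set (reg 12) (1 : ℕ)).tick.tick)
    (f := fun i τ => (seq (.intAdd 11 0 10) <|
      .seq (.binary .mul (reg 7) ⟨2, 11, 10⟩ ⟨2, 11, 10⟩) <|
      .seq (.binary .div (reg 7) (reg 7) (reg 20))
        (.binary .mul (reg 12) (reg 12) (reg 7))).exec W (τ.setInt 10 i).tick) (n := D)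
    (fun m τ => (τ.ints 0 = n ∧ τ.ints 2 = 0) ∧ τ.reals 2 = σ.reals 2 ∧ τ.reals 20 0 0 = lam ∧
      τ.reals 12 0 0 = ∏ k ∈ Finset.range m,
        (σ.reals 2 (n + k) k * σ.reals 2 (n + k) k / lam))
    ⟨⟨h.ints0, h.ints2⟩, by funext i j; simp [State.set_reals], ?_, ?_⟩
    fun m hm τ ⟨⟨k₀, k₁⟩, k₂, k₃, k₄⟩ => ⟨⟨?_, ?_⟩, ?_, ?_, ?_⟩
  · rw [determinant, exec, exec, exec, State.tick_ints, State.set_ints, h.ints4]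
    exact hind.2.2.2
  · simp [State.set_reals, h.reals20]
  · simp [State.set_reals, h.ints2]
  · simp [exec, State.setInt_ints, k₀]
  · simp [exec, State.setInt_ints, k₁]
  · funext i j
    simp [exec, State.set_reals, k₂]
  · simp [exec, State.set_reals, k₃]
  · rw [Finset.prod_range_succ, ← k₄]
    simp [exec, State.set_reals, State.setInt_ints, State.get, BinOp.eval, k₀, k₁, k₂, k₃]

lemma scale_reals (h : HasRoundInput n T D lam R B δ e σ) :
    (scale.exec W σ).reals 13 0 0 =
      R * √(Real.log (σ.reals 12 0 0 / (δ / 2) ^ 2)) + √lam * B + B * e * σ.reals 10 0 0 := by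
  simp [scale, exec, State.set_reals, State.get, BinOp.eval, UnOp.eval, h.ints2, h.reals20,
    h.reals21, h.reals22, h.reals23, h.reals24, pow_two]

lemma sample_spec (h : HasRoundInput n T D lam R B δ e σ) :
    (sample.exec W σ).draws = σ.draws + D ∧ (sample.exec W σ).rounds = σ.rounds ∧
    (sample.exec W σ).played = σ.played ∧ ∀ k < D, (sample.exec W σ).reals 14 0 k =
      σ.reals 2 (n + D) k + σ.reals 13 0 0 * W.normal (σ.draws + k) := by
  have hind := State.iter_induction (σ := (σ.setInt 11 (n + D)).tick.tick)
    (f := fun i τ => (seq (.normal (reg 7)) <| .seq (.binary .mul (reg 7) (reg 13) (reg 7))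
      (.binary .add ⟨14, 2, 10⟩ ⟨2, 11, 10⟩ (reg 7))).exec W (τ.setInt 10 i).tick) (n := D)
    (fun m τ => (τ.ints 11 = n + D ∧ τ.ints 2 = 0) ∧ (τ.reals 2 = σ.reals 2 ∧
      τ.reals 13 = σ.reals 13) ∧ (τ.draws = σ.draws + m ∧ τ.rounds = σ.rounds ∧
      τ.played = σ.played) ∧ ∀ k < m, τ.reals 14 0 k =
      σ.reals 2 (n + D) k + σ.reals 13 0 0 * W.normal (σ.draws + k))
    ⟨⟨by simp [State.setInt_ints], by simp [State.setInt_ints, h.ints2]⟩, ⟨rfl, rfl⟩,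
      ⟨rfl, rfl, rfl⟩, fun k hk => absurd hk (Nat.not_lt_zero k)⟩
    fun m hm τ ⟨⟨k₀, k₁⟩, ⟨k₂, k₃⟩, ⟨k₄, k₅, k₆⟩, k₇⟩ =>
      ⟨⟨?_, ?_⟩, ⟨?_, ?_⟩, ⟨?_, ?_, ?_⟩, fun k hk => ?_⟩
  · have hexec : sample.exec W σ = State.iter (fun i τ => (seq (.normal (reg 7)) <|
        .seq (.binary .mul (reg 7) (reg 13) (reg 7))
        (.binary .add ⟨14, 2, 10⟩ ⟨2, 11, 10⟩ (reg 7))).exec W (τ.setInt 10 i).tick) D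
        (σ.setInt 11 (n + D)).tick.tick := by
      rw [sample, exec, exec, exec, State.tick_ints, State.setInt_ints, if_neg (by decide),
        h.ints4, h.ints0]
    rw [hexec]
    exact ⟨hind.2.2.1.1, hind.2.2.1.2.1, hind.2.2.1.2.2, hind.2.2.2⟩
  · simp [exec, State.setInt_ints, k₀]
  · simp [exec, State.setInt_ints, k₁]
  · funext i j
    simp [exec, State.set_reals, k₂]
  · funext i j
    simp [exec, State.set_reals, k₃]
  · simp [exec, k₄, add_assoc]
  · simp [exec, k₅]
  · simp [exec, k₆]
  · rcases Nat.lt_succ_iff_lt_or_eq.1 hk with hk | rfl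
    · rw [← k₇ k hk]
      simp [exec, State.set_reals, State.setInt_ints, k₁, hk.ne]
    · simp [exec, State.set_reals, State.setInt_ints, State.get, BinOp.eval, k₀, k₁, k₂, k₃, k₄]

lemma objective_reals (h : HasRoundInput n T D lam R B δ e σ) (i : ℕ) (hi : i < n) :
    (objective.exec W σ).reals 4 i 0 =
      ∑ k ∈ Finset.range D, σ.reals 2 i k * σ.reals 14 0 k := by
  have hl := exec_loop_reals (W := W) (σ := σ)
    (c := .seq (dot 2 7 14 2 4) (.unary .copy ⟨4, 7, 2⟩ (reg 6))) (v := 7) (w := 0) (d := 4)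
    (fun m i j => i = m ∧ j = 0)
    (fun i _ => ∑ k ∈ Finset.range D, σ.reals 2 i k * σ.reals 14 0 k)
    (fun m _ τ h1 h2 h3 h4 i j => by
      have e1 : τ.ints 2 = 0 := by rw [h1 2 (by decide) (by decide), h.ints2]
      have e2 : τ.ints 4 = D := by rw [h1 4 (by decide) (by decide), h.ints4]
      have e3 := dot_get (W := W) (σ := τ) (a₁ := 2) (i₁ := 7) (a₂ := 14) (i₂ := 2) (w := 4)
        (by decide) (by decide) (by decide) (by decide)
      rw [e1, e2, h2, h3 2 (by decide), h3 14 (by decide)] at e3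
      simp only [exec, State.tick_reals, UnOp.eval]
      rw [State.set_reals, e3, dot_reals (by decide) (by decide), dot_ints (by decide),
        dot_ints (by decide)]
      simp only [true_and, h2, e1]
      by_cases h : i = m ∧ j = 0
      · rw [if_pos h, if_pos h, h.1]
      · rw [if_neg h, if_neg h]) i 0
  rw [objective, hl, if_pos ⟨i, by rw [h.ints0]; exact hi, rfl, rfl⟩]

lemma updatePsi_reals (h : HasRoundInput n T D lam R B δ e σ) :
    (updatePsi.exec W σ).reals 10 0 0 = σ.reals 10 0 0 +
      √(∑ k ∈ Finset.range D, σ.reals 2 (σ.ints 9) k * σ.reals 2 (σ.ints 9) k) := by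
  have e3 := dot_get (W := W) (σ := σ) (a₁ := 2) (i₁ := 9) (a₂ := 2) (i₂ := 9) (w := 4)
    (by decide) (by decide) (by decide) (by decide)
  rw [h.ints4] at e3
  rw [← e3]
  simp [updatePsi, exec, State.set_reals, State.get, BinOp.eval, UnOp.eval, dot_ints, dot_reals,
    h.ints2]

lemma updateGramRow_reals (h4 : σ.ints 4 = D) (h9 : σ.ints 9 < n)
    (h11 : n ≤ σ.ints 11) (i j : ℕ) :
    (updateGramRow.exec W σ).reals 1 i j = if i = σ.ints 11 ∧ j < D then
      σ.reals 1 i j + σ.reals 1 (σ.ints 9) (σ.ints 10) * σ.reals 1 (σ.ints 9) j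
      else σ.reals 1 i j := by
  have hl := exec_loop_reals (W := W) (σ := σ)
    (c := .seq (.binary .mul (reg 7) ⟨1, 9, 10⟩ ⟨1, 9, 8⟩)
      (.binary .add ⟨1, 11, 8⟩ ⟨1, 11, 8⟩ (reg 7))) (v := 8) (w := 4) (d := 1)
    (fun m i j => i = σ.ints 11 ∧ j = m)
    (fun i j => σ.reals 1 i j + σ.reals 1 (σ.ints 9) (σ.ints 10) * σ.reals 1 (σ.ints 9) j)
    (fun m _ τ k₁ k₂ k₃ k₄ i j => by
      have e1 := k₁ 2 (by decide) (by decide)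
      have e2 := k₁ 9 (by decide) (by decide)
      have e3 := k₁ 10 (by decide) (by decide)
      have e4 := k₁ 11 (by decide) (by decide)
      have e5 : ∀ j, τ.reals 1 (σ.ints 9) j = σ.reals 1 (σ.ints 9) j := fun j =>
        k₄ _ _ fun m' _ h => by omega
      have e6 : τ.reals 1 (σ.ints 11) m = σ.reals 1 (σ.ints 11) m :=
        k₄ _ _ fun m' hm' h => by omega
      by_cases h : i = σ.ints 11 ∧ j = m
      · rw [if_pos h, h.1, h.2]
        simp [exec, State.set_reals, State.get, BinOp.eval, e1, e2, e3, e4, e5, e6, k₂]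
      · rw [if_neg h]
        simp [exec, State.set_reals, BinOp.eval, e4, k₂, h]) i j
  rw [updateGramRow, hl, h4]
  simp [and_comm]

lemma updateGram_reals (h : HasRoundInput n T D lam R B δ e σ) (h9 : σ.ints 9 < n) (i j : ℕ) :
    (updateGram.exec W σ).reals 1 i j = if n ≤ i ∧ i < n + D ∧ j < D then
      σ.reals 1 i j + σ.reals 1 (σ.ints 9) (i - n) * σ.reals 1 (σ.ints 9) j
      else σ.reals 1 i j := by
  have hl := exec_loop_reals (W := W) (σ := σ)
    (c := .seq (.intAdd 11 0 10) updateGramRow) (v := 10) (w := 4) (d := 1)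
    (fun m i j => i = n + m ∧ j < D)
    (fun i j => σ.reals 1 i j + σ.reals 1 (σ.ints 9) (i - n) * σ.reals 1 (σ.ints 9) j)
    (fun m _ τ k₁ k₂ k₃ k₄ i j => by
      set ρ := (intAdd 11 0 10).exec W τ with hρ
      have e0 := k₁ 0 (by decide) (by decide)
      have e2 : ρ.ints 9 = σ.ints 9 := by
        simp [hρ, exec, State.setInt_ints, k₁ 9 (by decide) (by decide)]
      have e3 : ρ.ints 10 = m := by simp [hρ, exec, State.setInt_ints, k₂]
      have e4 : ρ.ints 11 = n + m := by simp [hρ, exec, State.setInt_ints, k₂, e0, h.ints0]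
      have e5 : ρ.ints 4 = D := by
        simp [hρ, exec, State.setInt_ints, k₁ 4 (by decide) (by decide), h.ints4]
      have e6 : ∀ j, ρ.reals 1 (σ.ints 9) j = σ.reals 1 (σ.ints 9) j := fun j =>
        k₄ _ _ fun m' _ h => by omega
      have e7 : ρ.reals 1 (n + m) = σ.reals 1 (n + m) := funext fun j =>
        k₄ _ _ fun m' hm' h => by omega
      have e8 : ρ.reals = τ.reals := rfl
      rw [exec, ← hρ, updateGramRow_reals e5 (by rw [e2]; exact h9) (by rw [e4]; omega), e4, e3,
        e2, e6, e6, ← e8]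
      by_cases hc : i = n + m ∧ j < D
      · rw [if_pos hc, if_pos hc, hc.1, e7, Nat.add_sub_cancel_left]
      · rw [if_neg hc, if_neg hc]) i j
  rw [updateGram, hl, h.ints4]
  by_cases hc : n ≤ i ∧ i < n + D ∧ j < D
  · rw [if_pos hc, if_pos ⟨i - n, by omega, by omega, hc.2.2⟩]
  · rw [if_neg hc, if_neg]
    rintro ⟨m, hm, h1, h2⟩
    exact hc ⟨by omega, by omega, h2⟩

lemma updateVector_reals (h : HasRoundInput n T D lam R B δ e σ) (i j : ℕ) :
    (updateVector.exec W σ).reals 1 i j = if i = n + D ∧ j < D then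
      σ.reals 1 i j + σ.reals 11 0 0 * σ.reals 1 (σ.ints 9) j else σ.reals 1 i j := by
  set ρ := (intAdd 11 0 4).exec W σ with hρ
  have e1 : ∀ v ≠ 11, ρ.ints v = σ.ints v := fun v hv => by
    simp [hρ, exec, State.setInt_ints, hv]
  have e2 : ρ.ints 11 = n + D := by simp [hρ, exec, State.setInt_ints, h.ints0, h.ints4]
  have e3 : ρ.reals = σ.reals := rfl
  have hl := exec_loop_reals (W := W) (σ := ρ)
    (c := .seq (.binary .mul (reg 7) (reg 11) ⟨1, 9, 8⟩)
      (.binary .add ⟨1, 11, 8⟩ ⟨1, 11, 8⟩ (reg 7))) (v := 8) (w := 4) (d := 1)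
    (fun m i j => i = n + D ∧ j = m)
    (fun i j => σ.reals 1 i j + σ.reals 11 0 0 * σ.reals 1 (σ.ints 9) j)
    (fun m _ τ k₁ k₂ k₃ k₄ i j => by
      have f1 : τ.ints 2 = 0 := by
        rw [k₁ 2 (by decide) (by decide), e1 2 (by decide), h.ints2]
      have f2 : τ.ints 9 = σ.ints 9 := by rw [k₁ 9 (by decide) (by decide), e1 9 (by decide)]
      have f3 : τ.ints 11 = n + D := by rw [k₁ 11 (by decide) (by decide), e2]
      have f4 : τ.reals 1 (σ.ints 9) m = σ.reals 1 (σ.ints 9) m :=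
        k₄ _ _ fun m' hm' h => by omega
      have f5 : τ.reals 1 (n + D) m = σ.reals 1 (n + D) m := k₄ _ _ fun m' hm' h => by omega
      have f6 : τ.reals 11 = σ.reals 11 := k₃ 11 (by decide)
      by_cases h : i = n + D ∧ j = m
      · rw [if_pos h, h.1, h.2]
        simp [exec, State.set_reals, State.get, BinOp.eval, f1, f2, f3, f4, f5, f6, k₂]
      · rw [if_neg h]
        simp [exec, State.set_reals, BinOp.eval, f3, k₂, h]) i j
  rw [updateVector, exec, ← hρ, hl, e1 4 (by decide), h.ints4, e3]
  simp [and_comm]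

end Cmd

/-! ### Correctness of a round -/

open Matrix

section Congr

variable {D : ℕ} {lam : ℝ} {φ φ' : ℕ → Fin D → ℝ} {y y' : ℕ → ℝ} {t : ℕ}

lemma gram_congr (h : ∀ s < t, φ s = φ' s) : gram lam φ t = gram lam φ' t := by
  rw [gram, gram]
  congr 1
  exact Finset.sum_congr rfl fun s hs => by rw [h s (Finset.mem_range.1 hs)]

lemma thetaHat_congr (h : ∀ s < t, φ s = φ' s) (hy : ∀ s < t, y s = y' s) :
    thetaHat lam φ y t = thetaHat lam φ' y' t := by
  rw [thetaHat, thetaHat, gram_congr h]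
  congr 1
  exact Finset.sum_congr rfl fun s hs => by
    rw [h s (Finset.mem_range.1 hs), hy s (Finset.mem_range.1 hs)]

lemma psi_congr (h : ∀ s < t, φ s = φ' s) : psi lam φ t = psi lam φ' t :=
  Finset.sum_congr rfl fun s hs => by
    rw [gram_congr fun r hr => h r (hr.trans (Finset.mem_range.1 hs)),
      h s (Finset.mem_range.1 hs)]

lemma width_congr {R B δ ε : ℝ} (h : ∀ s < t, φ s = φ' s) :
    width R B lam δ ε φ t = width R B lam δ ε φ' t := by
  rw [width, width, gram_congr h, psi_congr h]

end Congr

/-- If `p s` is the number of the arm played in round `s`, then the arm of round `t` maximizes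
`⟨μ, ·⟩` for a sample `μ` of modified Thompson Sampling that is obtained from the draws with
numbers `t D, …, t D + D - 1`. -/
def IsSampledRound {D : ℕ} (W : World) (n : ℕ) (lam R B δ ε : ℝ) (φ : ℕ → Fin D → ℝ)
    (p : ℕ → ℕ) (t : ℕ) : Prop :=
  p t < n ∧ ∃ μ : Fin D → ℝ,
    IsCholeskySample (gram lam (fun s => φ (p s)) t)
      (thetaHat lam (fun s => φ (p s)) (fun s => W.reward s (p s)) t)
      (width R B lam δ ε (fun s => φ (p s)) t) (fun i => W.normal (t * D + i)) μ ∧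
    ∀ j < n, μ ⬝ᵥ φ j ≤ μ ⬝ᵥ φ (p t)

/-- Later rounds do not invalidate earlier ones. -/
lemma IsSampledRound.congr {D : ℕ} {W : World} {n : ℕ} {lam R B δ ε : ℝ} {φ : ℕ → Fin D → ℝ}
    {p p' : ℕ → ℕ} {t : ℕ} (h : IsSampledRound W n lam R B δ ε φ p t)
    (hp : ∀ s ≤ t, p s = p' s) : IsSampledRound W n lam R B δ ε φ p' t := by
  obtain ⟨h1, μ, h2, h3⟩ := h
  have hφ : ∀ s < t, φ (p s) = φ (p' s) := fun s hs => by rw [hp s hs.le]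
  have hy : ∀ s < t, W.reward s (p s) = W.reward s (p' s) := fun s hs => by rw [hp s hs.le]
  refine ⟨hp t le_rfl ▸ h1, μ, ?_, by rw [← hp t le_rfl]; exact h3⟩
  rw [gram_congr hφ, thetaHat_congr hφ hy, width_congr hφ] at h2
  exact h2

namespace Cmd

variable {W : World} {σ : State} {n T D : ℕ} {lam R B δ e : ℝ} {φ : ℕ → Fin D → ℝ}

/-- The state before round `t`: the table holds the features of the arms, the Gram matrix and the right
hand side of the ridge regression, and all earlier rounds were sampled correctly. -/
structure RoundInv (W : World) (n T : ℕ) (lam R B δ e : ℝ) (φ : ℕ → Fin D → ℝ) (t : ℕ)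
    (σ : State) : Prop where
  input : HasRoundInput n T D lam R B δ e σ
  features : ∀ j < n, ∀ k : Fin D, σ.reals 1 j k = φ j k
  gram : ∀ r c : Fin D, σ.reals 1 (n + r) c = gram lam (fun s => φ (σ.played s)) t r c
  vector : ∀ c : Fin D, σ.reals 1 (n + D) c =
    (∑ s ∈ Finset.range t, W.reward s (σ.played s) • φ (σ.played s)) c
  psi : σ.reals 10 0 0 = psi lam (fun s => φ (σ.played s)) t
  draws : σ.draws = t * D
  rounds : σ.rounds = t
  sampled : ∀ s < t, IsSampledRound W n lam R B δ (B * e) φ σ.played s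

lemma RoundInv.of_eq {t : ℕ} {τ : State} (h : RoundInv W n T lam R B δ e φ t σ)
    (hin : HasRoundInput n T D lam R B δ e τ) (h1 : τ.reals 1 = σ.reals 1)
    (h10 : τ.reals 10 = σ.reals 10) (hd : τ.draws = σ.draws) (hr : τ.rounds = σ.rounds)
    (hp : τ.played = σ.played) : RoundInv W n T lam R B δ e φ t τ :=
  ⟨hin, by rw [h1]; exact h.features, by rw [h1, hp]; exact h.gram,
    by rw [h1, hp]; exact h.vector, by rw [h10, hp]; exact h.psi, hd.trans h.draws,
    hr.trans h.rounds, by rw [hp]; exact h.sampled⟩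

/-- One round of the program, traced through its subroutines. -/
lemma RoundInv.step (hl : 0 < lam) (hn : 0 < n) {t : ℕ} (h : RoundInv W n T lam R B δ e φ t σ) :
    RoundInv W n T lam R B δ e φ (t + 1) (round.exec W σ) := by
  set M := APG.gram lam (fun s => φ (σ.played s)) t with hM
  have hMpos : M.PosDef := gram_posDef hl _ t
  have htab : ∀ r c : Fin D, σ.reals 1 (n + r) c = M r c := h.gram
  set tab := σ.reals 1 with htabdef
  set b := ∑ s ∈ Finset.range t, W.reward s (σ.played s) • φ (σ.played s) with hb
  obtain ⟨v, hv⟩ : ∃ v, v = width R B lam δ (B * e) (fun s => φ (σ.played s)) t := ⟨_, rfl⟩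
  have hfeat : ∀ j < n, ∀ k : Fin D, tab j k = φ j k := h.features
  have hvec : ∀ c : Fin D, tab (n + D) c = b c := h.vector
  -- the Cholesky decomposition
  obtain ⟨σ₁, hσ₁⟩ : ∃ τ, τ = cholesky.exec W σ := ⟨_, rfl⟩
  have in₁ : HasRoundInput n T D lam R B δ e σ₁ := by
    rw [hσ₁]; exact h.input.exec _ (by decide)
  have L₁ : ∀ i < n + D + 1, ∀ k < D, σ₁.reals 2 i k = tableNewton n tab k i :=
    hσ₁ ▸ cholesky_reals h.input
  have k₁ : ∀ k, k ∉ cholesky.arrays → σ₁.reals k = σ.reals k := fun k hk => by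
    rw [hσ₁]; exact exec_reals_of_notMem _ hk σ
  obtain ⟨w₁, w₁', w₁''⟩ := exec_world_of_isOffline (W := W) cholesky rfl σ
  rw [← hσ₁] at w₁ w₁' w₁''
  -- the determinant
  obtain ⟨σ₂, hσ₂⟩ : ∃ τ, τ = determinant.exec W σ₁ := ⟨_, rfl⟩
  have in₂ : HasRoundInput n T D lam R B δ e σ₂ := by
    rw [hσ₂]; exact in₁.exec _ (by decide)
  have k₂ : ∀ k, k ∉ determinant.arrays → σ₂.reals k = σ₁.reals k := fun k hk => by
    rw [hσ₂]; exact exec_reals_of_notMem _ hk σ₁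
  obtain ⟨w₂, w₂', w₂''⟩ := exec_world_of_isOffline (W := W) determinant rfl σ₁
  rw [← hσ₂] at w₂ w₂' w₂''
  have det₂ : σ₂.reals 12 0 0 = (lam⁻¹ • M).det := by
    rw [hσ₂, determinant_reals in₁, det_inv_smul_eq_prod hMpos htab]
    refine Finset.prod_congr rfl fun k hk => ?_
    have hk := Finset.mem_range.1 hk
    rw [L₁ (n + k) (by omega) k hk]
  -- the scale
  obtain ⟨σ₃, hσ₃⟩ : ∃ τ, τ = scale.exec W σ₂ := ⟨_, rfl⟩
  have in₃ : HasRoundInput n T D lam R B δ e σ₃ := by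
    rw [hσ₃]; exact in₂.exec _ (by decide)
  have k₃ : ∀ k, k ∉ scale.arrays → σ₃.reals k = σ₂.reals k := fun k hk => by
    rw [hσ₃]; exact exec_reals_of_notMem _ hk σ₂
  obtain ⟨w₃, w₃', w₃''⟩ := exec_world_of_isOffline (W := W) scale rfl σ₂
  rw [← hσ₃] at w₃ w₃' w₃''
  have v₃ : σ₃.reals 13 0 0 = v := by
    rw [hσ₃, scale_reals in₂, det₂, k₂ 10 (by decide), k₁ 10 (by decide), h.psi, hv, width, beta]
  -- the sample
  obtain ⟨σ₄, hσ₄⟩ : ∃ τ, τ = sample.exec W σ₃ := ⟨_, rfl⟩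
  have in₄ : HasRoundInput n T D lam R B δ e σ₄ := by
    rw [hσ₄]; exact in₃.exec _ (by decide)
  have k₄ : ∀ k, k ∉ sample.arrays → σ₄.reals k = σ₃.reals k := fun k hk => by
    rw [hσ₄]; exact exec_reals_of_notMem _ hk σ₃
  obtain ⟨w₄, w₄', w₄'', g₄⟩ := sample_spec (W := W) in₃
  rw [← hσ₄] at w₄ w₄' w₄'' g₄
  have L₃ : σ₃.reals 2 = σ₁.reals 2 := by rw [k₃ 2 (by decide), k₂ 2 (by decide)]
  have L₄ : σ₄.reals 2 = σ₁.reals 2 := by rw [k₄ 2 (by decide), L₃]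
  have g₄ : ∀ k < D, σ₄.reals 14 0 k =
      tableNewton n tab k (n + D) + v * W.normal (t * D + k) := fun k hk => by
    rw [g₄ k hk, L₃, L₁ _ (by omega) k hk, v₃, w₃, w₂, w₁, h.draws]
  -- the objective
  obtain ⟨σ₅, hσ₅⟩ : ∃ τ, τ = objective.exec W σ₄ := ⟨_, rfl⟩
  have in₅ : HasRoundInput n T D lam R B δ e σ₅ := by
    rw [hσ₅]; exact in₄.exec _ (by decide)
  have k₅ : ∀ k, k ∉ objective.arrays → σ₅.reals k = σ₄.reals k := fun k hk => by
    rw [hσ₅]; exact exec_reals_of_notMem _ hk σ₄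
  obtain ⟨w₅, w₅', w₅''⟩ := exec_world_of_isOffline (W := W) objective rfl σ₄
  rw [← hσ₅] at w₅ w₅' w₅''
  have hθ : thetaHat lam (fun s => φ (σ.played s)) (fun s => W.reward s (σ.played s)) t =
      M⁻¹ *ᵥ b := rfl
  obtain ⟨μ, hμ⟩ : ∃ μ : Fin D → ℝ, μ = thetaHat lam (fun s => φ (σ.played s))
    (fun s => W.reward s (σ.played s)) t +
      v • (choleskyFactor D n tab)⁻¹ᵀ *ᵥ fun i : Fin D => W.normal (t * D + i) := ⟨_, rfl⟩
  have o₅ : ∀ j < n, σ₅.reals 4 j 0 = μ ⬝ᵥ φ j := fun j hj => by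
    rw [hμ, sample_dotProduct_eq hMpos htab (b := b) hθ (hfeat j hj) hvec, hσ₅,
      objective_reals in₄ j hj, Finset.sum_range]
    refine Finset.sum_congr rfl fun k _ => ?_
    rw [L₄, L₁ j (by omega) k k.isLt, g₄ k k.isLt]
  -- the selected arm
  obtain ⟨σ₆, hσ₆⟩ : ∃ τ, τ = argmax.exec W σ₅ := ⟨_, rfl⟩
  have in₆ : HasRoundInput n T D lam R B δ e σ₆ := by
    rw [hσ₆]; exact in₅.exec _ (by decide)
  have k₆ : σ₆.reals = σ₅.reals := hσ₆ ▸ funext fun k => argmax_reals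
  obtain ⟨w₆, w₆', w₆''⟩ := exec_world_of_isOffline (W := W) argmax rfl σ₅
  rw [← hσ₆] at w₆ w₆' w₆''
  obtain ⟨a₆, b₆⟩ := argmax_spec (W := W) (σ := σ₅) (by rw [in₅.ints0]; exact hn) in₅.ints2
  rw [← hσ₆, in₅.ints0] at a₆ b₆
  obtain ⟨p, hp⟩ : ∃ p, p = σ₆.ints 9 := ⟨_, rfl⟩
  rw [← hp] at a₆ b₆
  have best : ∀ j < n, μ ⬝ᵥ φ j ≤ μ ⬝ᵥ φ p := fun j hj => by
    rw [← o₅ j hj, ← o₅ p a₆]; exact b₆ j hj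
  -- the update of `ψ`
  obtain ⟨σ₇, hσ₇⟩ : ∃ τ, τ = updatePsi.exec W σ₆ := ⟨_, rfl⟩
  have in₇ : HasRoundInput n T D lam R B δ e σ₇ := by
    rw [hσ₇]; exact in₆.exec _ (by decide)
  have k₇ : ∀ k, k ∉ updatePsi.arrays → σ₇.reals k = σ₆.reals k := fun k hk => by
    rw [hσ₇]; exact exec_reals_of_notMem _ hk σ₆
  obtain ⟨w₇, w₇', w₇''⟩ := exec_world_of_isOffline (W := W) updatePsi rfl σ₆
  rw [← hσ₇] at w₇ w₇' w₇''
  have p₇ : σ₇.ints 9 = p := by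
    rw [hp, hσ₇]; exact exec_ints_of_notMem updatePsi (by decide) σ₆
  have psi₇ : σ₇.reals 10 0 0 = APG.psi lam (fun s => φ (σ.played s)) t + mahalanobis M (φ p) := by
    rw [hσ₇, updatePsi_reals in₆, ← hp, k₆, k₅ 10 (by decide), k₄ 10 (by decide), k₃ 10 (by decide),
      k₂ 10 (by decide), k₁ 10 (by decide), h.psi,
      mahalanobis_eq_sqrt_sum hMpos htab (hfeat p a₆)]
    congr 2
    refine Finset.sum_congr rfl fun k hk => ?_
    rw [k₅ 2 (by decide), L₄, L₁ p (by omega) k (Finset.mem_range.1 hk)]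
  -- the pull
  obtain ⟨σ₈, hσ₈⟩ : ∃ τ, τ = (pull (reg 11) 9).exec W σ₇ := ⟨_, rfl⟩
  have in₈ : HasRoundInput n T D lam R B δ e σ₈ := by
    rw [hσ₈]; exact in₇.exec _ (by decide)
  have rounds₇ : σ₇.rounds = t := by
    rw [w₇', w₆', w₅', w₄', w₃', w₂', w₁', h.rounds]
  have played₇ : σ₇.played = σ.played := by
    rw [w₇'', w₆'', w₅'', w₄'', w₃'', w₂'', w₁'']
  have k₈ : ∀ k ≠ 11, σ₈.reals k = σ₇.reals k := fun k hk =>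
    hσ₈ ▸ State.set_reals_of_ne _ _ _ hk
  have y₈ : σ₈.reals 11 0 0 = W.reward t p := by
    simp [hσ₈, exec, State.set_reals, in₇.ints2, rounds₇, p₇]
  have p₈ : σ₈.ints 9 = p := hσ₈ ▸ p₇
  have played₈ : σ₈.played = Function.update σ.played t p := by
    rw [← played₇, ← rounds₇, ← p₇, hσ₈]; rfl
  -- the updates of the matrix and of the vector
  obtain ⟨σ₉, hσ₉⟩ : ∃ τ, τ = updateGram.exec W σ₈ := ⟨_, rfl⟩
  have in₉ : HasRoundInput n T D lam R B δ e σ₉ := by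
    rw [hσ₉]; exact in₈.exec _ (by decide)
  have k₉ : ∀ k, k ∉ updateGram.arrays → σ₉.reals k = σ₈.reals k := fun k hk => by
    rw [hσ₉]; exact exec_reals_of_notMem _ hk σ₈
  obtain ⟨w₉, w₉', w₉''⟩ := exec_world_of_isOffline (W := W) updateGram rfl σ₈
  rw [← hσ₉] at w₉ w₉' w₉''
  have p₉ : σ₉.ints 9 = p :=
    hσ₉ ▸ (exec_ints_of_notMem updateGram (by decide) σ₈).trans p₈
  have tab₈ : σ₈.reals 1 = tab := by
    rw [k₈ 1 (by decide), k₇ 1 (by decide), k₆, k₅ 1 (by decide), k₄ 1 (by decide),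
      k₃ 1 (by decide), k₂ 1 (by decide), k₁ 1 (by decide)]
  have m₉ := updateGram_reals (W := W) in₈ (by rw [p₈]; exact a₆)
  rw [← hσ₉, tab₈, p₈] at m₉
  obtain ⟨σ', hσ'⟩ : ∃ τ, τ = updateVector.exec W σ₉ := ⟨_, rfl⟩
  have in' : HasRoundInput n T D lam R B δ e σ' := by
    rw [hσ']; exact in₉.exec _ (by decide)
  have k' : ∀ k, k ∉ updateVector.arrays → σ'.reals k = σ₉.reals k := fun k hk => by
    rw [hσ']; exact exec_reals_of_notMem _ hk σ₉
  obtain ⟨w', w'', w'''⟩ := exec_world_of_isOffline (W := W) updateVector rfl σ₉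
  rw [← hσ'] at w' w'' w'''
  have m' := updateVector_reals (W := W) in₉
  rw [← hσ', p₉, k₉ 11 (by decide), y₈] at m'
  have hexec : round.exec W σ = σ' := by
    rw [hσ', hσ₉, hσ₈, hσ₇, hσ₆, hσ₅, hσ₄, hσ₃, hσ₂, hσ₁]; rfl
  rw [hexec]
  -- the new invariant
  have played' : σ'.played = Function.update σ.played t p := by rw [w''', w₉'', played₈]
  have hlt : ∀ s < t, σ'.played s = σ.played s := fun s hs => by
    rw [played', Function.update_of_ne hs.ne]
  have ht : σ'.played t = p := by rw [played', Function.update_self]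
  have hφlt : ∀ s < t, φ (σ'.played s) = φ (σ.played s) := fun s hs => by rw [hlt s hs]
  have feat₉ : ∀ c : Fin D, σ₉.reals 1 p c = φ p c := fun c => by
    rw [m₉, if_neg (by omega), hfeat p a₆]
  refine ⟨in', fun j hj k => ?_, fun r c => ?_, fun c => ?_, ?_, ?_, ?_, fun s hs => ?_⟩
  · rw [m', if_neg (by omega), m₉, if_neg (by omega), hfeat j hj]
  · rw [m', if_neg (by have := r.isLt; omega), m₉,
      if_pos ⟨by omega, by have := r.isLt; omega, c.isLt⟩, Nat.add_sub_cancel_left, htab,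
      hfeat p a₆, hfeat p a₆, gram_succ, gram_congr hφlt, ht]
    rfl
  · rw [m', if_pos ⟨rfl, c.isLt⟩, m₉, if_neg (by omega), hvec c, feat₉,
      Finset.sum_range_succ, ht,
      Finset.sum_congr rfl fun s hs => by rw [hlt s (Finset.mem_range.1 hs)]]
    rfl
  · rw [k' 10 (by decide), k₉ 10 (by decide), k₈ 10 (by decide), psi₇, APG.psi, APG.psi,
      Finset.sum_range_succ, ht, gram_congr hφlt]
    congr 1
    exact (psi_congr hφlt).symm
  · rw [w', w₉, hσ₈]
    change σ₇.draws = _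
    rw [w₇, w₆, w₅, w₄, w₃, w₂, w₁, h.draws, Nat.succ_mul]
  · rw [w'', w₉', hσ₈]
    change σ₇.rounds + 1 = _
    rw [rounds₇]
  · rcases Nat.lt_succ_iff_lt_or_eq.1 hs with hs | rfl
    · exact (h.sampled s hs).congr fun r hr => (hlt r (by omega)).symm
    · refine ⟨by rw [ht]; exact a₆, μ, ?_, by rw [ht]; exact best⟩
      rw [gram_congr hφlt, thetaHat_congr hφlt fun r hr => by rw [hlt r hr], width_congr hφlt, ← hv]
      exact ⟨choleskyFactor D n tab, choleskyFactor_eq_zero hMpos htab,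
        choleskyFactor_diag_pos hMpos htab, choleskyFactor_mul_transpose hMpos htab, hμ⟩

end Cmd

namespace Cmd

/-! ### The complete program -/

/-- The program APG-TS: the P-greedy algorithm, followed by `T` rounds of Thompson Sampling. -/
def apgTS : Cmd := .seq pGreedy (.seq initRounds (.loop 6 1 round))

variable {W : World} {σ : State} {n T D : ℕ} {lam R B δ e : ℝ} {φ : ℕ → Fin D → ℝ}

lemma initRounds_spec {W₀ : World} {i : ℕ} {ξ : ℕ → ℕ}
    (h : GreedyInv W₀ n T lam R B δ e i D ξ σ)
    (hφ : ∀ j < n, ∀ k : Fin D, φ j k = newton W₀.kernel ξ k j) (hψ : σ.reals 10 0 0 = 0)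
    (hd : σ.draws = 0) (hr : σ.rounds = 0) :
    RoundInv W n T lam R B δ e φ 0 (initRounds.exec W σ) := by
  obtain ⟨ρ, hρ⟩ : ∃ ρ, ρ = (intAdd 5 12 3).exec W ((intAdd 12 0 4).exec W σ) := ⟨_, rfl⟩
  have hexec : initRounds.exec W σ =
      (loop 10 4 (.seq (.intAdd 11 0 10) (.unary .copy ⟨1, 11, 10⟩ (reg 20)))).exec W ρ := by
    rw [hρ]; rfl
  have r5 : ρ.ints 5 = n + D + 1 := by
    simp [hρ, exec, State.setInt_ints, h.input.ints0, h.input.ints3, h.ints4]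
  have r1 : ∀ v, v ≠ 5 ∧ v ≠ 12 → ρ.ints v = σ.ints v := fun v hv => by
    simp [hρ, exec, State.setInt_ints, hv]
  have r2 : ρ.reals = σ.reals := by rw [hρ]; rfl
  have htab : ∀ i j, (initRounds.exec W σ).reals 1 i j =
      if ∃ m < D, i = n + m ∧ j = m then lam else σ.reals 1 i j := fun i j => by
    have hl := exec_loop_reals (W := W) (σ := ρ)
      (c := .seq (.intAdd 11 0 10) (.unary .copy ⟨1, 11, 10⟩ (reg 20))) (v := 10) (w := 4) (d := 1)
      (fun m i j => i = n + m ∧ j = m) (fun _ _ => lam)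
      (fun m _ τ k₁ k₂ k₃ _ i j => by
        have e0 : τ.ints 0 = n := by
          rw [k₁ 0 (by decide) (by decide), r1 0 (by decide), h.input.ints0]
        have e2 : τ.ints 2 = 0 := by
          rw [k₁ 2 (by decide) (by decide), r1 2 (by decide), h.input.ints2]
        have e20 : τ.reals 20 0 0 = lam := by rw [k₃ 20 (by decide), r2, h.input.reals20]
        simp [exec, State.set_reals, State.setInt_ints, State.get, UnOp.eval, e0, e2, e20, k₂])
      i j
    rw [hexec, hl, r1 4 (by decide), h.ints4, r2]
    congr
  obtain ⟨w₁, w₂, w₃⟩ := exec_world_of_isOffline (W := W) initRounds rfl σ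
  refine ⟨⟨h.input.exec _ (by decide), ?_, ?_⟩, fun j hj k => ?_, fun r c => ?_, fun c => ?_, ?_,
    ?_, ?_, fun s hs => absurd hs (Nat.not_lt_zero s)⟩
  · rw [exec_ints_of_notMem initRounds (by decide), h.ints4]
  · rw [hexec, exec_ints_of_notMem _ (by decide), r5]
  · rw [htab, if_neg (by rintro ⟨m, _, h, _⟩; omega), h.basis j hj k k.isLt, hφ j hj]
  · rw [htab, gram_zero, Matrix.smul_apply, Matrix.one_apply]
    by_cases hrc : r = c
    · rw [if_pos ⟨r, r.isLt, rfl, by rw [hrc]⟩, if_pos hrc, smul_eq_mul, mul_one]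
    · rw [if_neg, if_neg hrc, h.zero _ (by omega), smul_zero]
      rintro ⟨m, _, h1, h2⟩
      exact hrc (Fin.ext (by omega))
  · rw [htab, if_neg (by rintro ⟨m, hm, h1, h2⟩; omega), h.zero _ (by omega)]
    rfl
  · rw [exec_reals_of_notMem initRounds (by decide), hψ]
    rfl
  · rw [w₁, hd, zero_mul]
  · rw [w₂, hr]

lemma initRounds_cost (n T D : ℕ) :
    initRounds.IsBounded (bnd n T D) ∧ initRounds.cost (bnd n T D) ≤ 3 + 3 * D := by
  constructor
  · simp [initRounds, IsBounded, bnd]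
  · simp only [initRounds, cost, bnd]
    omega

lemma rounds_isBounded (n T D : ℕ) : (loop 6 1 round).IsBounded (bnd n T D) := by
  simp [round, cholesky, determinant, scale, sample, objective, updatePsi, updateGram,
    updateGramRow, updateVector, IsBounded, colStep, reduce, dot, argmax, bnd]
  omega

/-- A round applies `L⁻¹` to `n + D + 1` rows, which takes `O(n D² + D³)` steps. -/
lemma round_cost_le (T : ℕ) (hn : 1 ≤ n) (hD : 1 ≤ D) :
    round.cost (bnd n T D) ≤ 300 * (n * D ^ 2 + D ^ 3) := by
  simp only [round, cholesky, determinant, scale, sample, objective, updatePsi, updateGram,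
    updateGramRow, updateVector, cost, colStep, reduce, dot, argmax, bnd]
  have h1 : 1 ≤ D ^ 2 := Nat.one_le_pow _ _ hD
  have h2 : n ≤ n * D := Nat.le_mul_of_pos_right n hD
  have h3 : n * D ≤ n * D ^ 2 := Nat.mul_le_mul_left n (Nat.le_self_pow two_ne_zero D)
  have h4 : D ^ 2 ≤ D ^ 3 := Nat.pow_le_pow_right hD (by norm_num)
  have h5 : D ≤ D ^ 2 := Nat.le_self_pow two_ne_zero D
  ring_nf
  linarith

/-- After `T` rounds, every round was sampled correctly, and the number of steps is as claimed. -/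
lemma apgTS_spec {W₀ : World} {ξ : ℕ → ℕ} (hW : W.kernel = W₀.kernel) (hn : 0 < n)
    (hT : 1 ≤ T) (hl : 0 < lam) (hD : 0 < D)
    (h : GreedyInv W₀ n T lam R B δ e n D ξ (pGreedy.exec W₀ (startState n T lam R B δ e)))
    (hφ : ∀ j < n, ∀ k : Fin D, φ j k = newton W₀.kernel ξ k j) :
    RoundInv W n T lam R B δ e φ T (apgTS.exec W (startState n T lam R B δ e)) ∧
    (apgTS.exec W (startState n T lam R B δ e)).steps ≤ 2000 * (n * T * D ^ 2 + T * D ^ 3) := by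
  obtain ⟨σ, hσ⟩ : ∃ σ, σ = pGreedy.exec W₀ (startState n T lam R B δ e) := ⟨_, rfl⟩
  have hσ' : pGreedy.exec W (startState n T lam R B δ e) = σ := by
    rw [hσ]; exact exec_congr_of_isOffline hW _ rfl _
  rw [← hσ] at h
  obtain ⟨w₁, w₂, w₃⟩ := exec_world_of_isOffline (W := W₀) pGreedy rfl (startState n T lam R B δ e)
  rw [← hσ] at w₁ w₂ w₃
  have hψ : σ.reals 10 0 0 = 0 := by
    rw [hσ, exec_reals_of_notMem _ (by decide)]; rfl
  have hinit := initRounds_spec (W := W) h hφ hψ w₁ w₂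
  obtain ⟨b₁, s₁⟩ := exec_steps_le (W := W) initRounds (initRounds_cost n T D).1 h.bound
  obtain ⟨b₂, s₂⟩ := exec_steps_le (W := W) (loop 6 1 round) (rounds_isBounded n T D) b₁
  have hexec : apgTS.exec W (startState n T lam R B δ e) =
      (loop 6 1 round).exec W (initRounds.exec W σ) := by
    rw [apgTS, exec, exec, hσ']
  rw [hexec]
  constructor
  · rw [exec, hinit.input.ints1]
    refine State.iter_induction (fun t τ => RoundInv W n T lam R B δ e φ t τ)
      (hinit.of_eq ⟨hinit.input.tick, hinit.input.ints4, hinit.input.ints5⟩ rfl rfl rfl rfl rfl)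
      fun t ht τ hτ => RoundInv.step hl hn (hτ.of_eq ⟨(hτ.input.setInt (by decide) t).tick, ?_, ?_⟩
        rfl rfl rfl rfl rfl)
    · rw [State.tick_ints, State.setInt_ints, if_neg (by decide), hτ.input.ints4]
    · rw [State.tick_ints, State.setInt_ints, if_neg (by decide), hτ.input.ints5]
  · have s₀ := h.steps
    have c₁ := (initRounds_cost n T D).2
    have c₂ := round_cost_le T hn hD
    have c₃ : (loop 6 1 round).cost (bnd n T D) = 1 + T * (1 + round.cost (bnd n T D)) := rfl
    have c₄ : T * round.cost (bnd n T D) ≤ T * (300 * (n * D ^ 2 + D ^ 3)) :=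
      Nat.mul_le_mul_left T c₂
    have h1 : 1 ≤ D ^ 2 := Nat.one_le_pow _ _ hD
    have h2 : n ≤ n * D := Nat.le_mul_of_pos_right n hD
    have h3 : n * D ≤ n * D ^ 2 := Nat.mul_le_mul_left n (Nat.le_self_pow two_ne_zero D)
    have h4 : D ^ 2 ≤ D ^ 3 := Nat.pow_le_pow_right hD (by norm_num)
    have h5 : D ≤ D ^ 2 := Nat.le_self_pow two_ne_zero D
    have h6 : n * D ^ 2 ≤ T * (n * D ^ 2) := Nat.le_mul_of_pos_left _ hT
    have h7 : D ^ 3 ≤ T * D ^ 3 := Nat.le_mul_of_pos_left _ hT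
    have h8 : T ≤ T * D ^ 3 := Nat.le_mul_of_pos_right _ (by omega)
    have h9 : D * (61 * ((n + D + 1) * (D + 1))) =
        61 * (n * D ^ 2 + n * D + D ^ 3 + 2 * D ^ 2 + D) := by ring
    have h10 : n * T * D ^ 2 + T * D ^ 3 = T * (n * D ^ 2) + T * D ^ 3 := by ring
    have h11 : T * (300 * (n * D ^ 2 + D ^ 3)) = 300 * (T * (n * D ^ 2)) + 300 * (T * D ^ 3) := by
      ring
    rw [h9] at s₀
    rw [c₃, mul_add, mul_one] at s₂
    rw [h11] at c₄
    rw [h10]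
    omega

/-- The points and `D` are those of the run of `pGreedy` in a world whose rewards and draws are zero;
as `pGreedy` is offline, the run is the same in every world with that kernel. -/
theorem apgTS_correct {X : Type*} {K : X → X → ℝ} (hK : IsKernel K) {A : Finset X}
    (hA : A.Nonempty) {a : ℕ → X} (ha : Set.BijOn a (Set.Iio A.card) A) {T : ℕ} (hT : 1 ≤ T)
    (B R : ℝ) {lam e : ℝ} (δ : ℝ) (hl : 1 ≤ lam) (he : 0 < e) :
    ∃ (D : ℕ) (ξ : ℕ → X), IsPGreedy K A e D ξ ∧ ∀ (reward : ℕ → ℕ → ℝ) (z : ℕ → ℝ),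
      let σ := apgTS.exec ⟨fun i j => K (a i) (a j), reward, z⟩
        (startState A.card T lam R B δ e)
      let φ := feature K ξ D
      let x := fun t => a (σ.played t)
      let y := fun t => reward t (σ.played t)
      σ.rounds = T ∧
      (∀ t < T, σ.played t < A.card ∧ ∃ μ : Fin D → ℝ,
        IsCholeskySample (gram lam (fun s => φ (x s)) t)
          (thetaHat lam (fun s => φ (x s)) y t)
          (width R B lam δ (B * e) (fun s => φ (x s)) t) (fun i => z (t * D + i)) μ ∧
        IsBest A φ μ (x t)) ∧
      σ.steps ≤ 2000 * (A.card * T * D ^ 2 + T * D ^ 3) := by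
  have hn : 0 < A.card := hA.card_pos
  obtain ⟨D, ξ, hinv, hgreedy⟩ := pGreedy_spec (W := ⟨fun i j => K (a i) (a j), fun _ _ => 0,
    fun _ => 0⟩) (T := T) (lam := lam) (R := R) (B := B) (δ := δ) hn he
    (fun i j => hK.symm _ _) (fun i _ => hK.diag_pos _)
  refine ⟨D, fun m => a (ξ m), IsPGreedy_comp ha hgreedy, fun reward z => ?_⟩
  intro σ φ x y
  obtain ⟨h, hsteps⟩ := apgTS_spec (W := ⟨fun i j => K (a i) (a j), reward, z⟩)
    (W₀ := ⟨fun i j => K (a i) (a j), fun _ _ => 0, fun _ => 0⟩) (φ := fun j => φ (a j)) rfl hn hT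
    (by linarith) hgreedy.pos hinv
    (fun j _ k => newton_comp a ξ k j)
  refine ⟨h.rounds, fun t ht => ?_, hsteps⟩
  obtain ⟨h1, μ, h2, h3⟩ := h.sampled t ht
  refine ⟨h1, μ, h2, ha.mapsTo h1, fun x' hx' => ?_⟩
  obtain ⟨j, hj, rfl⟩ := ha.surjOn hx'
  exact h3 j hj

end Cmd

end APG

end

theorem mainTheorem9 :
    -- the regret bound
    (∃ c : ℕ, ∀ B R lam α : ℝ, 0 ≤ B → 0 ≤ R → 1 ≤ lam → 0 < α → ∃ C : ℝ,
      ∀ (d : ℕ) (Ω : Set (EuclideanSpace ℝ (Fin d))) (K : Ω → Ω → ℝ), APG.IsKernel K →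
      ∀ (H : Type*) [NormedAddCommGroup H] [InnerProductSpace ℝ H] [CompleteSpace H]
        [RKHS ℝ H Ω ℝ], (∀ x y, RKHS.kernel H x y 1 = K x y) →
      ∀ f : H, ‖f‖ ≤ B →
      ∀ (A : Finset Ω) (hA : A.Nonempty) (T : ℕ), 1 ≤ T →
      ∀ q δ : ℝ, 1 / 2 ≤ q → 0 < δ → δ < 1 →
      ∀ (D : ℕ) (ξ : ℕ → Ω), APG.IsPGreedy K A (α / (T : ℝ) ^ q) D ξ →
      ∀ (Ψ : Type*) [mΨ : MeasurableSpace Ψ] (P : Measure Ψ) [IsProbabilityMeasure P]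
        (ℱ : Filtration ℕ mΨ) (x : ℕ → Ψ → Ω) (y : ℕ → Ψ → ℝ)
        (μ : ℕ → Ψ → EuclideanSpace ℝ (Fin D)),
        APG.IsBandit P ℱ (fun a => f a) R T x y →
        APG.IsModifiedTS P A (APG.feature K ξ D) lam R B (B * (α / (T : ℝ) ^ q)) δ T x y μ →
        1 - δ ≤ P.real {ω | APG.regret A hA (fun a => f a) T (fun t => x t ω) ≤
          C * (1 + Real.log T) ^ c * (√(Real.log A.card) *
            (D * √T + √(D * T * Real.log (1 / δ)) + Real.log (1 / δ) * √T))}) ∧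
    -- the computational complexity
    (∃ (prog : APG.Cmd) (C : ℕ),
      ∀ (d : ℕ) (Ω : Set (EuclideanSpace ℝ (Fin d))) (K : Ω → Ω → ℝ), APG.IsKernel K →
      ∀ (A : Finset Ω), A.Nonempty → ∀ a : ℕ → Ω, Set.BijOn a (Set.Iio A.card) A →
      ∀ T : ℕ, 1 ≤ T → ∀ B R lam α q δ : ℝ, 0 ≤ B → 0 ≤ R → 1 ≤ lam → 0 < α → 1 / 2 ≤ q →
        0 < δ → δ < 1 →
      ∃ (D : ℕ) (ξ : ℕ → Ω), APG.IsPGreedy K A (α / (T : ℝ) ^ q) D ξ ∧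
        ∀ (reward : ℕ → ℕ → ℝ) (z : ℕ → ℝ),
          let σ := prog.exec ⟨fun i j => K (a i) (a j), reward, z⟩
            (APG.startState A.card T lam R B δ (α / (T : ℝ) ^ q))
          let φ := APG.feature K ξ D
          let x := fun t => a (σ.played t)
          let y := fun t => reward t (σ.played t)
          σ.rounds = T ∧
          (∀ t < T, σ.played t < A.card ∧ ∃ μ : Fin D → ℝ,
            APG.IsCholeskySample (APG.gram lam (fun s => φ (x s)) t)
              (APG.thetaHat lam (fun s => φ (x s)) y t)
              (APG.width R B lam δ (B * (α / (T : ℝ) ^ q)) (fun s => φ (x s)) t)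
              (fun i => z (t * D + i)) μ ∧
            APG.IsBest A φ μ (x t)) ∧
          σ.steps ≤ C * (A.card * T * D ^ 2 + T * D ^ 3)) := by
  refine ⟨⟨3, fun B R lam α hB hR hl hα => ⟨APG.regretConst B R lam α, ?_⟩⟩,
    APG.Cmd.apgTS, 2000, ?_⟩
  · intro d Ω K hK H _ _ _ _ hker f hf A hA T hT q δ hq hδ hδ1 D ξ hξ Ψ _ P _ ℱ x y μ hband hTS
    exact APG.one_sub_le_measureReal_regret_le hK hker hB hR hl hα hf hA hT hq hδ hδ1 hξ hband hTS
  · intro d Ω K hK A hA a ha T hT B R lam α q δ _ _ hl hα _ _ _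
    have hT0 : (0 : ℝ) < T := by exact_mod_cast hT
    exact APG.Cmd.apgTS_correct hK hA ha hT B R δ hl (by positivity)
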